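/- Let $d\ge 1$. For $\alpha\ge 0$ and a pressure $p$ consider the scaled damped Euler system on $(0,\infty)\times\mathbb R^d$ $$\rho_\tau=\tfrac y2\cdot\nabla\rho-\operatorname{div}n,\qquad n_\tau=\tfrac y2\cdot\nabla n+\tfrac d2 n-\operatorname{div}\Big(\frac{n\otimes n}{\rho}\Big)-e^{d\tau}\big(\nabla p(\rho)+\alpha n\big).$$ Let $h\in C([0,\infty))$ be differentiable on $(0,\infty)$ with $p(z)=zh'(z)-h(z)$ for $z>0$ ($h$ is unique up to a linear function), let $h(r|s)=h(r)-h(s)-h'(s)(r-s)$, and $$\mathcal E(\tau;\rho,n|\bar\rho,\bar n)=\int_{\mathbb R^d}\tfrac12e^{-d\tau}\rho\Big|\frac n\rho-\frac{\bar n}{\bar\rho}\Big|^2+h(\rho|\bar\rho)\,dy\in[0,\infty],$$ where $0/0=0$ and the integrand is $+\infty$ where $\rho<0$, or $\rho=0$ and $n\ne0$. **Energy-variational solutions.** Let $\hat\rho$ be a limit density as in (a) or (b) below, and let $(\rho_0,n_0)\in L^1_{loc}(\mathbb R^d)\times L^1_{loc}(\mathbb R^d;\mathbb R^d)$ with $\mathcal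 E(0;\rho_0,n_0|\hat\rho,0)<\infty$. A triple $(\rho,n,E)$ with $\rho,n\in L^1_{loc}([0,\infty)\times\mathbb R^d)$ and $E:[0,\infty)\to\mathbb R$ of (locally) bounded variation is an energy-variational solution with reference density $\rho_\infty$ and regularity weight $\mathcal K$ if the following holds. * $\rho_\infty\in C^1([0,\infty)\times\mathbb R^d)$, $\rho_\infty\ge0$, $h'(\rho_\infty)$ is well defined and $C^1$ (automatic where $\rho_\infty>0$), and for each $T$ there is $R>0$ with $\rho_\infty(\tau,y)=\hat\rho(y)$ for $\tau\le T$, $|y|>R$. * $\mathcal K:C^1_c(\mathbb R^d;\mathbb R^d)\to[0,\infty)$ satisfies $\mathcal K(\lambda\psi)=\lambda\mathcal K(\psi)$ for $\lambda>0$. * $\mathcal E(\tau;\rho,n|\rho_\infty,0)\le E(\tau)$ for a.a. $\tau>0$. * $p(\rho)\in L^1_{loc}([0,\infty)\times\mathbb R^d)$, and the integrand in the first integral on the right-hand side below is integrable on $(0,T)\times\mathbb R^d$ for all $T$. * For all $\phi\in C_c^1([0,\infty)\times\mathbb R^d)$, $\psi\in C_c^1([0,\infty)\times\mathbb R^d;\mathbb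 R^d)$ and a.a. $\sigma<\tau$, including $\sigma=0$ with $(\rho,n)(0)=(\rho_0,n_0)$, $$\begin{aligned}&\Big[E+\int\phi\rho+\psi\cdot n\,dy\Big]\Big|_\sigma^\tau+\int_\sigma^\tau\tfrac d2E\,d\tau'+\int_\sigma^\tau\!\!\int\alpha\frac{|n|^2}\rho\,dy\,d\tau'-\int_\sigma^\tau\!\!\int\phi_\tau\rho-\nabla\phi\cdot(\tfrac y2\rho-n)-\tfrac d2\phi\rho\,dy\,d\tau'\\&\quad-\int_\sigma^\tau\!\!\int\psi_\tau\cdot n+\nabla\psi:\Big(-n\otimes\tfrac y2+\frac{n\otimes n}\rho+e^{d\tau'}p(\rho)\mathbb I\Big)-\psi\cdot e^{d\tau'}\alpha n\,dy\,d\tau'\\&\le\int_\sigma^\tau\!\!\int-\Big(h'(\rho_\infty)_\tau-\tfrac y2\cdot\nabla h'(\rho_\infty)\Big)(\rho-\rho_\infty)-\nabla h'(\rho_\infty)\cdot n\,dy\,d\tau'+\int_\sigma^\tau e^{d\tau'}\mathcal K(\psi)\big(E-\mathcal E(\tau';\rho,n|\rho_\infty,0)\big)d\tau'.\end{aligned}$$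 **Theorem.** Let one of the following hold. (a) $\alpha\ge0$; $p\in C([0,\infty))\cap C^1((0,\infty))$ with $p'>0$ on $(0,\infty)$; $\rho^*=\hat\rho\ge0$ is constant and $n^*=0$; and if $\rho^*=0$, then there is $c>0$ with $p'(z)\le c\,p(z)/z$ for $z>0$, and $\int_0^1p(z)z^{-2}dz<\infty$. (b) $\alpha>0$; $p(z)=kz^\gamma$ with $k>0$, $\gamma\ge1$; $\hat\rho\in C^1(\mathbb R^d\setminus\{0\};(0,\infty))$ with $\hat\rho(\lambda y)=\hat\rho(y)$ for $\lambda>0$; $(\rho^*,n^*)$ satisfies $$0=\tfrac1\alpha\Delta p(\rho^*)+\tfrac y2\cdot\nabla\rho^*,\qquad 0=n^*+\tfrac1\alpha\nabla p(\rho^*);$$ and assumption (A) holds: $\rho^*\in C^\infty(\mathbb R^d)$ takes values in the convex hull of $\hat\rho(\mathbb R^d\setminus\{0\})$, and $|y|(\rho^*-\hat\rho)$, $|y||\nabla\rho^*|$, $|\nabla^2\rho^*|\in L^1(\mathbb R^d)\cap L^\infty(\mathbb R^d)$. Let $(\rho,n,E)$ be an energy-variational solution with initial data $(\rho_0,n_0)$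 as above; in case (b) let $$\mathcal K(\psi)=\max\big\{2\|[\nabla\psi]_{\mathrm{sym},+}\|_{L^\infty},(\gamma-1)\|[\operatorname{div}\psi]_+\|_{L^\infty}\big\},$$ where $[A]_{\mathrm{sym},+}$ is the positive part of $\frac12(A+A^\top)$, measured in the spectral norm. Define $$\begin{aligned}\mathcal R(\tau)&=E(\tau)-\mathcal E(\tau;\rho(\tau),n(\tau)|\rho_\infty(\tau),0)+\mathcal E(\tau;\rho(\tau),n(\tau)|\rho^*,n^*),\\ \mathcal R_0&=E(0)-\mathcal E(0;\rho_0,n_0|\rho_\infty(0),0)+\mathcal E(0;\rho_0,n_0|\rho^*,n^*).\end{aligned}$$ Then the relative entropies in $\mathcal R_0$ and (for a.a. $\tau>0$) in $\mathcal R(\tau)$ are finite, and $$\mathcal R(\tau)\le e^{-(\frac d2-\theta)\tau+\frac2d\mu}\Big(\mathcal R_0+\frac K\theta\Big)\qquad\text{for a.a. }\tau>0,$$ where $\theta=\mu=K/\theta=0$ in case (a), and in case (b) the numbers $$\theta=\tfrac1\alpha\max\big\{2\|[\nabla^2h'(\rho^*)]_{\mathrm{sym},+}\|_{L^\infty},(\gamma-1)\|[\Delta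 h'(\rho^*)]_+\|_{L^\infty}\big\},\qquad \mu=\Big\|\frac{|R^*|}{2k(\rho^*)^\gamma}+\frac{3|R^*|}{2\rho^*}\Big\|_{L^\infty},\qquad K=\int_{\mathbb R^d}|R^*|\,dy,$$ $$R^*=-\tfrac y2\cdot\nabla n^*-\tfrac d2n^*+\operatorname{div}\Big(\frac{n^*\otimes n^*}{\rho^*}\Big)$$ are finite (with $K/\theta=0$ if $\theta=0$; then $\rho^*$ is constant and $K=0$). In particular, if $\theta<\frac d2$, then $$E(\tau)-\mathcal E(\tau;\rho(\tau),n(\tau)|\rho_\infty(\tau),0)\to0\quad\text{and}\quad\mathcal E(\tau;\rho(\tau),n(\tau)|\rho^*,n^*)\to0$$ as $\tau\to\infty$ (outside of a null set of times). -/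

import Mathlib

open MeasureTheory Set Filter
open scoped Topology ENNReal NNReal

noncomputable section

/-! ### Vector calculus on `ℝ^d` -/

/-- The Euclidean space `ℝ^d`. -/
abbrev Space (d : ℕ) : Type := EuclideanSpace ℝ (Fin d)

/-- The matrix `(∇v)_{ij} = ∂_j v_i` of a vector field. -/
def jacobian {d : ℕ} (v : Space d → Space d) (y : Space d) : Matrix (Fin d) (Fin d) ℝ :=
  fun i j => fderiv ℝ v y (EuclideanSpace.single j 1) i

/-- `div v = ∑_j ∂_j v_j`. -/
def divergence {d : ℕ} (v : Space d → Space d) (y : Space d) : ℝ :=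
  ∑ j, fderiv ℝ v y (EuclideanSpace.single j 1) j

/-- `(div A)_i = ∑_j ∂_j A_{ij}` for a tensor field. -/
def tensorDivergence {d : ℕ} (A : Space d → Matrix (Fin d) (Fin d) ℝ) (y : Space d) : Space d :=
  WithLp.toLp 2 fun i => ∑ j, fderiv ℝ (fun x => A x i j) y (EuclideanSpace.single j 1)

/-- The tensor `(a ⊗ b)_{ij} = a_i b_j`. -/
def tensor {d : ℕ} (a b : Space d) : Matrix (Fin d) (Fin d) ℝ := fun i j => a i * b j

/-- The product `A : B = ∑_{ij} A_{ij} B_{ij}`. -/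
def contraction {d : ℕ} (A B : Matrix (Fin d) (Fin d) ℝ) : ℝ := ∑ i, ∑ j, A i j * B i j

/-- The positive part `[A]_{sym,+}` (spectral calculus) of the symmetric part `(A + Aᵀ) / 2`. -/
def symPosPart {d : ℕ} (A : Matrix (Fin d) (Fin d) ℝ) : Matrix (Fin d) (Fin d) ℝ :=
  cfc (fun t : ℝ => max t 0) ((1 / 2 : ℝ) • (A + A.transpose))

/-- The spectral norm of a matrix. -/
def matrixSpectralNorm {d : ℕ} (A : Matrix (Fin d) (Fin d) ℝ) : ℝ :=
  ‖Matrix.toEuclideanCLM (n := Fin d) (𝕜 := ℝ) A‖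

/-! ### Pressure, potential and relative entropy -/

/-- `p ∈ C([0,∞)) ∩ C¹((0,∞))` with `p' > 0` in `(0,∞)`. -/
structure IsPressure (p : ℝ → ℝ) : Prop where
  continuousOn : ContinuousOn p (Ici 0)
  contDiffOn : ContDiffOn ℝ 1 p (Ioi 0)
  deriv_pos : ∀ z, 0 < z → 0 < deriv p z

/-- The additional assumption on the pressure that allows for a vanishing limit density:
`p'(z) ≤ c p(z) / z` and `∫₀¹ p(z) / z² dz < ∞`. -/
def IsVacuumPressure (p : ℝ → ℝ) : Prop :=
  (∃ c : ℝ, 0 < c ∧ ∀ z, 0 < z → deriv p z ≤ c * (p z / z)) ∧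
    IntegrableOn (fun z => p z / z ^ 2) (Ioc 0 1)

/-- The `γ`-law `p(z) = k z^γ` with `γ ≥ 1` and `k > 0`. -/
def IsGammaLaw (k γ : ℝ) (p : ℝ → ℝ) : Prop :=
  0 < k ∧ 1 ≤ γ ∧ ∀ z, 0 ≤ z → p z = k * z ^ γ

/-- `h` is a potential of the pressure: `p(z) = z h'(z) - h(z)` for `z > 0`, and `h` is
continuous up to `0`. This fixes `h` up to a linear function. -/
structure IsPotential (p h : ℝ → ℝ) : Prop where
  continuousOn : ContinuousOn h (Ici 0)
  differentiableAt : ∀ z, 0 < z → DifferentiableAt ℝ h z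
  pressure_eq : ∀ z, 0 < z → p z = z * deriv h z - h z

/-- The derivative `h'` on `[0,∞)` (one-sided at `0`). -/
def potDeriv (h : ℝ → ℝ) (z : ℝ) : ℝ := derivWithin h (Ici 0) z

/-- The relative potential `h(r | s) = h(r) - h(s) - h'(s) (r - s)`. -/
def relPot (h : ℝ → ℝ) (r s : ℝ) : ℝ := h r - h s - potDeriv h s * (r - s)

/-- The relative entropy density
`η(τ; r, v | s, w) = (1/2) e^{-dτ} r |v/r - w/s|² + h(r | s)`,
with `0/0 = 0`, and with value `∞` if `r < 0`, or if `r = 0` and `v ≠ 0`. -/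
def relEntropyDensity {d : ℕ} (h : ℝ → ℝ) (τ : ℝ) (r : ℝ) (v : Space d) (s : ℝ) (w : Space d) :
    ℝ≥0∞ :=
  open scoped Classical in
  if r < 0 ∨ (r = 0 ∧ v ≠ 0) then ⊤
  else ENNReal.ofReal
    (1 / 2 * Real.exp (-(d * τ)) * r * ‖r⁻¹ • v - s⁻¹ • w‖ ^ 2 + relPot h r s)

/-- The total relative entropy `𝓔(τ; ρ, n | ρ', n')`, with values in `[0,∞]`. -/
def relEntropy {d : ℕ} (h : ℝ → ℝ) (τ : ℝ) (ρ : Space d → ℝ) (n : Space d → Space d)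
    (ρ' : Space d → ℝ) (n' : Space d → Space d) : ℝ≥0∞ :=
  ∫⁻ y, relEntropyDensity h τ (ρ y) (n y) (ρ' y) (n' y)

/-! ### Energy-variational solutions -/

/-- The closed half space `[0,∞) × ℝ^d`. -/
def halfSpace (d : ℕ) : Set (ℝ × Space d) := Ici 0 ×ˢ univ

/-- An angular limit density: `C¹` and positive on `ℝ^d ∖ {0}`, and homogeneous of degree `0`. -/
structure IsAngular {d : ℕ} (ρhat : Space d → ℝ) : Prop where
  contDiffOn : ContDiffOn ℝ 1 ρhat {0}ᶜ
  pos : ∀ y, y ≠ 0 → 0 < ρhat y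
  homogeneous : ∀ c : ℝ, 0 < c → ∀ y, y ≠ 0 → ρhat (c • y) = ρhat y

/-- A reference density: `ρ∞ ∈ C¹([0,∞) × ℝ^d)` is nonnegative, `h'(ρ∞)` is well defined and
`C¹` (automatic where `ρ∞ > 0`), and `ρ∞ = ρ̂` outside of a ball,
uniformly on bounded time intervals. -/
structure IsReferenceDensity {d : ℕ} (h : ℝ → ℝ) (ρhat : Space d → ℝ)
    (ρinf : ℝ → Space d → ℝ) : Prop where
  contDiffOn : ContDiffOn ℝ 1 (fun z : ℝ × Space d => ρinf z.1 z.2) (halfSpace d)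
  nonneg : ∀ τ, 0 ≤ τ → ∀ y, 0 ≤ ρinf τ y
  differentiable_of_eq_zero : ∀ τ, 0 ≤ τ → ∀ y, ρinf τ y = 0 →
    DifferentiableWithinAt ℝ h (Ici 0) 0
  contDiffOn_potDeriv :
    ContDiffOn ℝ 1 (fun z : ℝ × Space d => potDeriv h (ρinf z.1 z.2)) (halfSpace d)
  eq_far : ∀ T : ℝ, ∃ R : ℝ, 0 < R ∧ ∀ τ ∈ Icc 0 T, ∀ y : Space d, R < ‖y‖ → ρinf τ y = ρhat y

/-- The space `C_c¹([0,∞) × ℝ^d; F)` of test functions. -/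
def IsTestFunction {d : ℕ} {F : Type} [NormedAddCommGroup F] [NormedSpace ℝ F]
    (φ : ℝ → Space d → F) : Prop :=
  ContDiffOn ℝ 1 (fun z : ℝ × Space d => φ z.1 z.2) (halfSpace d) ∧
    ∃ R : ℝ, ∀ τ, 0 ≤ τ → ∀ y, (R < τ ∨ R < ‖y‖) → φ τ y = 0

/-- The space `C_c¹(ℝ^d; ℝ^d)`. -/
def IsSpatialTest {d : ℕ} (ψ : Space d → Space d) : Prop :=
  ContDiff ℝ 1 ψ ∧ HasCompactSupport ψ

/-- A `1`-homogeneous regularity weight `C_c¹(ℝ^d; ℝ^d) → [0,∞)`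
(values outside of `C_c¹` are irrelevant). -/
def IsRegularityWeight {d : ℕ} (K : (Space d → Space d) → ℝ≥0) : Prop :=
  ∀ ψ, IsSpatialTest ψ → ∀ c : ℝ≥0, 0 < c → K (fun y => (c : ℝ) • ψ y) = c * K ψ

/-- The expression
`max { 2 ‖[∇v]_{sym,+}‖_{L^∞}, (γ - 1) ‖[div v]_+‖_{L^∞} }`, with values in `[0,∞]`. -/
def gammaWeight {d : ℕ} (γ : ℝ) (v : Space d → Space d) : ℝ≥0∞ :=
  max (2 * eLpNorm (fun y => matrixSpectralNorm (symPosPart (jacobian v y))) ⊤ volume)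
    (ENNReal.ofReal (γ - 1) * eLpNorm (fun y => max (divergence v y) 0) ⊤ volume)

/-- The momentum flux `- n ⊗ y/2 + (n ⊗ n)/ρ + e^{dτ} p(ρ) 𝕀`. -/
def momentumFlux {d : ℕ} (p : ℝ → ℝ) (τ : ℝ) (y : Space d) (r : ℝ) (v : Space d) :
    Matrix (Fin d) (Fin d) ℝ :=
  -tensor v ((1 / 2 : ℝ) • y) + r⁻¹ • tensor v v + (Real.exp (d * τ) * p r) • 1

/-- The integrand of the weak continuity equation,
`φ_τ ρ - ∇φ · (ρ y/2 - n) - (d/2) φ ρ`. -/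
def densityIntegrand {d : ℕ} (ρ : ℝ → Space d → ℝ) (n : ℝ → Space d → Space d)
    (φ : ℝ → Space d → ℝ) (τ : ℝ) (y : Space d) : ℝ :=
  deriv (fun s => φ s y) τ * ρ τ y
    - inner ℝ (gradient (φ τ) y) ((ρ τ y / 2) • y - n τ y) - d / 2 * φ τ y * ρ τ y

/-- The integrand of the weak momentum equation,
`ψ_τ · n + ∇ψ : (- n ⊗ y/2 + (n ⊗ n)/ρ + e^{dτ} p(ρ) 𝕀) - ψ · e^{dτ} α n`. -/
def momentumIntegrand {d : ℕ} (α : ℝ) (p : ℝ → ℝ) (ρ : ℝ → Space d → ℝ)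
    (n : ℝ → Space d → Space d) (ψ : ℝ → Space d → Space d) (τ : ℝ) (y : Space d) : ℝ :=
  inner ℝ (deriv (fun s => ψ s y) τ) (n τ y)
    + contraction (jacobian (ψ τ) y) (momentumFlux p τ y (ρ τ y) (n τ y))
    - inner ℝ (ψ τ y) ((Real.exp (d * τ) * α) • n τ y)

/-- The integrand generated by the reference density,
`-(h'(ρ∞)_τ - y/2 · ∇h'(ρ∞)) (ρ - ρ∞) - ∇h'(ρ∞) · n`. -/
def referenceIntegrand {d : ℕ} (h : ℝ → ℝ) (ρ : ℝ → Space d → ℝ)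
    (n : ℝ → Space d → Space d) (ρinf : ℝ → Space d → ℝ) (τ : ℝ) (y : Space d) : ℝ :=
  -(deriv (fun s => potDeriv h (ρinf s y)) τ
      - inner ℝ ((1 / 2 : ℝ) • y) (gradient (fun x => potDeriv h (ρinf τ x)) y))
      * (ρ τ y - ρinf τ y)
    - inner ℝ (gradient (fun x => potDeriv h (ρinf τ x)) y) (n τ y)

/-- The energy-variational inequality between the times `σ < τ`, where `(rσ, vσ)` is the state
at the time `σ`. All terms except for the one with the regularity weight are collected on the
left; the weight term is an integral of a nonnegative function. -/
def EnvarInequality {d : ℕ} (α : ℝ) (p h : ℝ → ℝ) (ρ : ℝ → Space d → ℝ)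
    (n : ℝ → Space d → Space d) (E : ℝ → ℝ) (ρinf : ℝ → Space d → ℝ)
    (K : (Space d → Space d) → ℝ≥0) (φ : ℝ → Space d → ℝ) (ψ : ℝ → Space d → Space d)
    (σ τ : ℝ) (rσ : Space d → ℝ) (vσ : Space d → Space d) : Prop :=
  ENNReal.ofReal (
      (E τ + ∫ y, (φ τ y * ρ τ y + inner ℝ (ψ τ y) (n τ y)))
      - (E σ + ∫ y, (φ σ y * rσ y + inner ℝ (ψ σ y) (vσ y)))
      + (∫ s in σ..τ, (d : ℝ) / 2 * E s)
      + (∫ s in σ..τ, ∫ y, α * (‖n s y‖ ^ 2 / ρ s y))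
      - (∫ s in σ..τ, ∫ y, densityIntegrand ρ n φ s y)
      - (∫ s in σ..τ, ∫ y, momentumIntegrand α p ρ n ψ s y)
      - ∫ s in σ..τ, ∫ y, referenceIntegrand h ρ n ρinf s y)
    ≤ ∫⁻ s in Ioc σ τ, ENNReal.ofReal (Real.exp (d * s) * K (ψ s) *
        (E s - (relEntropy h s (ρ s) (n s) (ρinf s) (fun _ => 0)).toReal))

/-- `(ρ, n, E)` is an energy-variational solution of the scaled damped Euler system
`ρ_τ = y/2 · ∇ρ - div n`,
`n_τ = y/2 · ∇n + (d/2) n - div (n ⊗ n / ρ) - e^{dτ} (∇p(ρ) + α n)`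
with initial data `(ρ₀, n₀)`, limit density `ρ̂`, reference density `ρ∞` and
regularity weight `K`. The two integrability conditions express that the integrals
in the variational inequality exist. -/
structure IsEnergyVariationalSolution {d : ℕ} (α : ℝ) (p h : ℝ → ℝ) (ρhat : Space d → ℝ)
    (ρ₀ : Space d → ℝ) (n₀ : Space d → Space d) (ρ : ℝ → Space d → ℝ)
    (n : ℝ → Space d → Space d) (E : ℝ → ℝ) (ρinf : ℝ → Space d → ℝ)
    (K : (Space d → Space d) → ℝ≥0) : Prop where
  initial_density : LocallyIntegrable ρ₀
  initial_momentum : LocallyIntegrable n₀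
  initial_finite : relEntropy h 0 ρ₀ n₀ ρhat (fun _ => 0) ≠ ⊤
  density : LocallyIntegrableOn (fun z : ℝ × Space d => ρ z.1 z.2) (halfSpace d)
  momentum : LocallyIntegrableOn (fun z : ℝ × Space d => n z.1 z.2) (halfSpace d)
  energy_bv : LocallyBoundedVariationOn E (Ici 0)
  reference : IsReferenceDensity h ρhat ρinf
  energy_ge : ∀ᵐ τ : ℝ, 0 < τ → relEntropy h τ (ρ τ) (n τ) (ρinf τ) (fun _ => 0) ≠ ⊤ ∧
    (relEntropy h τ (ρ τ) (n τ) (ρinf τ) (fun _ => 0)).toReal ≤ E τ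
  weight : IsRegularityWeight K
  pressure_integrable :
    LocallyIntegrableOn (fun z : ℝ × Space d => p (ρ z.1 z.2)) (halfSpace d)
  reference_integrable : ∀ T : ℝ, IntegrableOn
    (fun z : ℝ × Space d => referenceIntegrand h ρ n ρinf z.1 z.2) (Ioc 0 T ×ˢ univ)
  inequality : ∀ (φ : ℝ → Space d → ℝ) (ψ : ℝ → Space d → Space d),
    IsTestFunction φ → IsTestFunction ψ →
      (∀ᵐ σ : ℝ, 0 < σ → ∀ᵐ τ : ℝ, σ < τ →
        EnvarInequality α p h ρ n E ρinf K φ ψ σ τ (ρ σ) (n σ)) ∧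
      (∀ᵐ τ : ℝ, 0 < τ → EnvarInequality α p h ρ n E ρinf K φ ψ 0 τ ρ₀ n₀)

/-! ### The similarity profile and its constants -/

/-- The profile equations `0 = (1/α) Δp(ρ*) + y/2 · ∇ρ*` and `0 = n* + (1/α) ∇p(ρ*)`. -/
def IsSimilarityProfile {d : ℕ} (α : ℝ) (p : ℝ → ℝ) (ρs : Space d → ℝ)
    (ns : Space d → Space d) : Prop :=
  (∀ y, 0 = 1 / α * divergence (gradient fun x => p (ρs x)) y
      + inner ℝ ((1 / 2 : ℝ) • y) (gradient ρs y)) ∧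
    ∀ y, 0 = ns y + (1 / α) • gradient (fun x => p (ρs x)) y

open scoped ContDiff in
/-- The assumption on the profile: `ρ* ∈ C^∞(ℝ^d)` takes values in the smallest interval that
contains the values of `ρ̂`, and `|y| (ρ* - ρ̂)`, `|y| |∇ρ*|`, `|∇²ρ*|` belong to `L¹ ∩ L^∞`. -/
structure IsAdmissibleProfile {d : ℕ} (ρhat ρs : Space d → ℝ) : Prop where
  contDiff : ContDiff ℝ ∞ ρs
  range_subset : range ρs ⊆ convexHull ℝ (ρhat '' {0}ᶜ)
  difference : ∀ q : ℝ≥0∞, q = 1 ∨ q = ⊤ → MemLp (fun y => ‖y‖ * (ρs y - ρhat y)) q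
  gradient : ∀ q : ℝ≥0∞, q = 1 ∨ q = ⊤ → MemLp (fun y => ‖y‖ * ‖gradient ρs y‖) q
  hessian : ∀ q : ℝ≥0∞, q = 1 ∨ q = ⊤ → MemLp (fun y => ‖iteratedFDeriv ℝ 2 ρs y‖) q

/-- `R* = - y/2 · ∇n* - (d/2) n* + div (n* ⊗ n* / ρ*)`. -/
def profileResidual {d : ℕ} (ρs : Space d → ℝ) (ns : Space d → Space d) (y : Space d) :
    Space d :=
  -fderiv ℝ ns y ((1 / 2 : ℝ) • y) - ((d : ℝ) / 2) • ns y
    + tensorDivergence (fun x => (ρs x)⁻¹ • tensor (ns x) (ns x)) y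

/-- `θ = (1/α) max { 2 ‖[∇²h'(ρ*)]_{sym,+}‖_{L^∞}, (γ - 1) ‖[Δh'(ρ*)]_+‖_{L^∞} }`. -/
def profileTheta {d : ℕ} (α γ : ℝ) (h : ℝ → ℝ) (ρs : Space d → ℝ) : ℝ≥0∞ :=
  ENNReal.ofReal (1 / α) * gammaWeight γ (gradient fun x => potDeriv h (ρs x))

/-- `μ = ‖ |R*| / (2 k (ρ*)^γ) + 3 |R*| / (2 ρ*) ‖_{L^∞}`. -/
def profileMu {d : ℕ} (k γ : ℝ) (ρs : Space d → ℝ) (ns : Space d → Space d) : ℝ≥0∞ :=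
  eLpNorm (fun y => ‖profileResidual ρs ns y‖ / (2 * k * ρs y ^ γ)
    + 3 * ‖profileResidual ρs ns y‖ / (2 * ρs y)) ⊤ volume

/-- `K = ∫ |R*| dy`. -/
def profileK {d : ℕ} (ρs : Space d → ℝ) (ns : Space d → Space d) : ℝ≥0∞ :=
  ∫⁻ y, ‖profileResidual ρs ns y‖ₑ

/-! ### Convergence -/

/-- The energy defect `E - 𝓔(τ; r, v | ρ∞(τ), 0)`, where `(r, v)` is the state at time `τ`. -/
def energyDefect {d : ℕ} (h : ℝ → ℝ) (E : ℝ → ℝ) (ρinf : ℝ → Space d → ℝ) (τ : ℝ)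
    (r : Space d → ℝ) (v : Space d → Space d) : ℝ :=
  E τ - (relEntropy h τ r v (ρinf τ) (fun _ => 0)).toReal

/-- The quantity `𝓡 = (E - 𝓔(τ; r, v | ρ∞(τ), 0)) + 𝓔(τ; r, v | ρ*, n*)`. -/
def totalDeviation {d : ℕ} (h : ℝ → ℝ) (E : ℝ → ℝ) (ρinf : ℝ → Space d → ℝ)
    (ρs : Space d → ℝ) (ns : Space d → Space d) (τ : ℝ)
    (r : Space d → ℝ) (v : Space d → Space d) : ℝ :=
  energyDefect h E ρinf τ r v + (relEntropy h τ r v ρs ns).toReal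

/-- Convergence of `(ρ, n, E)` to `(ρ*, n*)`: the relative entropies in `𝓡₀` and `𝓡` are finite,
`𝓡(τ) ≤ e^{-(d/2 - θ) τ + 2μ/d} (𝓡₀ + Q)` for almost all `τ > 0`, and if `θ < d/2`, then the
energy defect and the relative entropy tend to `0` as `τ → ∞`
(outside of a null set of times, as they are defined for almost all `τ` only). -/
structure ConvergesToProfile {d : ℕ} (h : ℝ → ℝ)
    (ρ₀ : Space d → ℝ) (n₀ : Space d → Space d) (ρ : ℝ → Space d → ℝ)
    (n : ℝ → Space d → Space d) (E : ℝ → ℝ) (ρinf : ℝ → Space d → ℝ)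
    (ρs : Space d → ℝ) (ns : Space d → Space d) (θ μ Q : ℝ) : Prop where
  initial_ref_finite : relEntropy h 0 ρ₀ n₀ (ρinf 0) (fun _ => 0) ≠ ⊤
  initial_finite : relEntropy h 0 ρ₀ n₀ ρs ns ≠ ⊤
  finite : ∀ᵐ τ : ℝ, 0 < τ → relEntropy h τ (ρ τ) (n τ) ρs ns ≠ ⊤
  decay : ∀ᵐ τ : ℝ, 0 < τ →
    totalDeviation h E ρinf ρs ns τ (ρ τ) (n τ) ≤
      Real.exp (-((d : ℝ) / 2 - θ) * τ + 2 * μ / d) *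
        (totalDeviation h E ρinf ρs ns 0 ρ₀ n₀ + Q)
  defect_tendsto : θ < (d : ℝ) / 2 →
    Tendsto (fun τ => energyDefect h E ρinf τ (ρ τ) (n τ)) (atTop ⊓ ae volume) (𝓝 0)
  entropy_tendsto : θ < (d : ℝ) / 2 →
    Tendsto (fun τ => relEntropy h τ (ρ τ) (n τ) ρs ns) (atTop ⊓ ae volume) (𝓝 0)

end

noncomputable section

/-! ### Convexity of the potential -/

/-! The proof is the relative entropy method. With u* = n*/ρ*, the energy-variational inequality is
tested with φ = h'(ρ∞) - h'(ρ*) + ½e^{-dτ}|u*|² and ψ = -e^{-dτ}u*. By the three-point identity for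
relative entropies, E + ∫φρ + ψ·n is then 𝓡 plus ∫π(ρ∞) - π(ρ*), where π(s) = sh'(s) - h(s), and
this extra term is balanced by the part of the space-time integral that does not contain the
solution (`relative_identity`, `integral_explicit`).

In both cases αu* = -∇h'(ρ*). This removes the terms linear in the solution and leaves the damping
αρ|u - u*|² ≥ 0, a term quadratic in u - u* with coefficient ∇u*, the term (γ-1)h(ρ|ρ*) div u*, and
the residual R*. The second and third are at least -θ times the relative entropy density, because
-∇u* = (1/α)∇²h'(ρ*). The residual carries the factor e^{-dτ}; Young's inequality bounds it by
e^{-dτ/2}(μ · relative entropy density + |R*|) (`dissipation_ge`). The weight term costs at most θ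
times the energy defect, since e^{dτ} and the factor e^{-dτ} in ψ cancel by homogeneity. As the
terms with d/2 add up to (d/2)𝓡, the result is, for almost all σ < τ, 𝓡(τ) ≤ 𝓡(σ) + ∫ (-(d/2-θ) +
μe^{-ds/2}) 𝓡 + Ke^{-ds/2} ds (`totalDeviation_le`), and Grönwall's inequality `gronwall_exp_ae`
gives the decay. For a constant profile with n* = 0 all error terms vanish.

Since φ and ψ have no compact support, they are multiplied by spatial cutoffs χ_j with |∇χ_j|(1+|y|)
bounded. Every cutoff error in the integrals is an integral over {|y| > j} of a function dominated
by the relative entropy density and a fixed integrable function (`exists_domination`), so it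
vanishes in the limit. `IsRelativeProfile` collects what this argument needs of a profile;
`IsRelativeProfile.convergesToProfile` is the common conclusion for (a) and (b).

In case (b) it remains to show that μ and K are finite, although R* contains y·∇u* and the
assumption has no weight |y| on second derivatives. For d ≥ 2, dilating ρ* shows that ρ̂ has
vanishing weak gradient away from 0; hence ρ̂ and ρ* are constant and R* = 0. For d = 1 the profile
equations are an ordinary differential equation, from which n* and R* decay like a Gaussian, up to
polynomials. If θ = 0, then h'(ρ*) is bounded and concave, hence constant, and again R* = 0. -/

/-- The values `s ≥ 0` at which `h'(s)` is well defined. -/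
def HasPotDeriv (h : ℝ → ℝ) (s : ℝ) : Prop :=
  0 < s ∨ s = 0 ∧ DifferentiableWithinAt ℝ h (Ici 0) 0

/-- The pressure `s h'(s) - h(s)` expressed by the potential. -/
def potPressure (h : ℝ → ℝ) (s : ℝ) : ℝ := s * potDeriv h s - h s

lemma HasPotDeriv.nonneg {h : ℝ → ℝ} {s : ℝ} (hs : HasPotDeriv h s) : 0 ≤ s := by
  rcases hs with hs | ⟨rfl, -⟩
  exacts [hs.le, le_rfl]

lemma potDeriv_of_pos {h : ℝ → ℝ} {z : ℝ} (hz : 0 < z) : potDeriv h z = deriv h z :=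
  derivWithin_of_mem_nhds (Ici_mem_nhds hz)

lemma potDeriv_eq {p h : ℝ → ℝ} (hh : IsPotential p h) {z : ℝ} (hz : 0 < z) :
    potDeriv h z = (p z + h z) / z := by
  rw [potDeriv_of_pos hz, hh.pressure_eq z hz]
  field_simp
  ring

lemma potPressure_of_pos {p h : ℝ → ℝ} (hh : IsPotential p h) {z : ℝ} (hz : 0 < z) :
    potPressure h z = p z := by
  rw [potPressure, potDeriv_of_pos hz, hh.pressure_eq z hz]

lemma hasDerivWithinAt_potential {p h : ℝ → ℝ} (hh : IsPotential p h) {s : ℝ}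
    (hs : HasPotDeriv h s) : HasDerivWithinAt h (potDeriv h s) (Ici 0) s := by
  rcases hs with hs | ⟨rfl, hs⟩
  · exact (hh.differentiableAt s hs).differentiableWithinAt.hasDerivWithinAt
  · exact hs.hasDerivWithinAt

/-- No second derivative of h is assumed: `pressure_eq` gives h' = (p + h)/z, and this quotient is
differentiable. -/
lemma hasDerivAt_potDeriv {p h : ℝ → ℝ} (hp : IsPressure p) (hh : IsPotential p h) {z : ℝ}
    (hz : 0 < z) : HasDerivAt (potDeriv h) (deriv p z / z) z := by
  have hp' : HasDerivAt p (deriv p z) z :=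
    ((hp.contDiffOn.contDiffAt (Ioi_mem_nhds hz)).differentiableAt one_ne_zero).hasDerivAt
  have h1 : HasDerivAt (fun x => (p x + h x) / x)
      (((deriv p z + deriv h z) * z - (p z + h z) * 1) / z ^ 2) z :=
    (hp'.add (hh.differentiableAt z hz).hasDerivAt).div (hasDerivAt_id z) hz.ne'
  have h2 : ((deriv p z + deriv h z) * z - (p z + h z) * 1) / z ^ 2 = deriv p z / z := by
    rw [hh.pressure_eq z hz]
    field_simp
    ring
  rw [h2] at h1
  refine h1.congr_of_eventuallyEq ?_
  filter_upwards [Ioi_mem_nhds hz] with x hx using potDeriv_eq hh hx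

lemma strictMonoOn_potDeriv {p h : ℝ → ℝ} (hp : IsPressure p) (hh : IsPotential p h) :
    StrictMonoOn (potDeriv h) (Ioi 0) := by
  refine strictMonoOn_of_deriv_pos (convex_Ioi 0)
    (fun z hz => (hasDerivAt_potDeriv hp hh hz).continuousAt.continuousWithinAt) ?_
  intro z hz
  rw [interior_Ioi] at hz
  rw [(hasDerivAt_potDeriv hp hh hz).deriv]
  exact div_pos (hp.deriv_pos z hz) hz

lemma convexOn_potential {p h : ℝ → ℝ} (hp : IsPressure p) (hh : IsPotential p h) :
    ConvexOn ℝ (Ici 0) h := by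
  refine (StrictMonoOn.strictConvexOn_of_deriv (convex_Ici 0) hh.continuousOn ?_).convexOn
  rw [interior_Ici]
  exact (strictMonoOn_potDeriv hp hh).congr fun z hz => potDeriv_of_pos hz

lemma relPot_nonneg {p h : ℝ → ℝ} (hp : IsPressure p) (hh : IsPotential p h) {r s : ℝ}
    (hr : 0 ≤ r) (hs : HasPotDeriv h s) : 0 ≤ relPot h r s := by
  have hd := hasDerivWithinAt_potential hh hs
  have hc := convexOn_potential hp hh
  rw [relPot]
  rcases lt_trichotomy r s with hrs | rfl | hrs
  · have hs' : 0 < s := hr.trans_lt hrs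
    have h1 := hc.slope_le_of_hasDerivAt hr hs.nonneg hrs
      (hd.hasDerivAt (Ici_mem_nhds hs'))
    rw [slope_def_field, div_le_iff₀ (by linarith)] at h1
    linarith
  · simp
  · have h1 := hc.le_slope_of_hasDerivWithinAt hs.nonneg hr hrs hd
    rw [slope_def_field, le_div_iff₀ (by linarith)] at h1
    linarith

/-- Since h' increases strictly, h(·|s) grows at least linearly beyond a + 1, with slope h'(a+1) -
h'(a) independent of s ≤ M < a. This is how relative entropy controls mass. -/
lemma le_relPot_bound {p h : ℝ → ℝ} (hp : IsPressure p) (hh : IsPotential p h) (M : ℝ) :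
    ∃ C : ℝ, 0 ≤ C ∧ ∀ r s : ℝ, 0 ≤ r → HasPotDeriv h s → s ≤ M →
      r ≤ C * (1 + relPot h r s) := by
  set a : ℝ := max M 0 + 1 with ha
  have ha0 : 0 < a := by positivity
  have hMa : M ≤ a := (le_max_left M 0).trans (by linarith)
  set κ : ℝ := potDeriv h (a + 1) - potDeriv h a with hκ
  have hκ0 : 0 < κ := sub_pos.2 (strictMonoOn_potDeriv hp hh ha0
    (by simp only [mem_Ioi]; linarith) (by linarith))
  refine ⟨a + 1 + κ⁻¹, by positivity, fun r s hr hs hsM => ?_⟩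
  have h0 := relPot_nonneg hp hh hr hs
  have hi : 0 < κ⁻¹ := inv_pos.2 hκ0
  rcases le_total r (a + 1) with h1 | h1
  · nlinarith
  · have e1 := relPot_nonneg hp hh ha0.le hs
    have e2 := relPot_nonneg hp hh hs.nonneg (Or.inl ha0)
    have e3 := relPot_nonneg hp hh hr (Or.inl (by linarith : 0 < a + 1))
    have e4 := relPot_nonneg hp hh (by linarith : 0 ≤ a + 1) (Or.inl ha0)
    -- The inequality h'(s) ≤ h'(a) is taken from the sum of `e1` and `e2`, not from monotonicity on
    -- (0,∞), because s = 0 is allowed.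
    have e5 : 0 ≤ (potDeriv h a - potDeriv h s) * (r - a) := by
      rcases (hsM.trans hMa).eq_or_lt with rfl | hlt
      · simp
      · have : 0 ≤ (potDeriv h a - potDeriv h s) * (a - s) := by
          simp only [relPot] at e1 e2
          linarith
        have := nonneg_of_mul_nonneg_left this (sub_pos.2 hlt)
        exact mul_nonneg this (by linarith)
    -- Chain of the supporting-line inequalities at s, a and a + 1, with h'(s) replaced by the
    -- larger h'(a).
    have e6 : κ * (r - (a + 1)) ≤ relPot h r s := by
      simp only [relPot] at e1 e2 e3 e4 ⊢
      rw [hκ]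
      linarith
    have e7 : r - (a + 1) ≤ κ⁻¹ * relPot h r s := by
      rw [inv_mul_eq_div, le_div_iff₀ hκ0]
      linarith
    nlinarith

/-- As h(r|s) = h(r) - h'(s)r + `potPressure h s`, a change of the base point costs a term linear in
r and a term independent of r. Only because of this can the reference density be exchanged for the
profile by means of test functions. -/
lemma relPot_change (h : ℝ → ℝ) (r s t : ℝ) :
    relPot h r t = relPot h r s + (potDeriv h s - potDeriv h t) * r
      + (potPressure h t - potPressure h s) := by
  simp only [relPot, potPressure]
  ring

lemma measurable_potential_max {p h : ℝ → ℝ} (hh : IsPotential p h) :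
    Measurable fun z : ℝ => h (max z 0) :=
  (hh.continuousOn.comp_continuous (by fun_prop) fun z => le_max_right z 0).measurable

/-- On (0,∞) the derivative is the quotient (p + h)/z of functions continuous there; the truncation
sends all other arguments to the single value `potDeriv h 0`. -/
lemma measurable_potDeriv_max {p h : ℝ → ℝ} (hp : IsPressure p) (hh : IsPotential p h) :
    Measurable fun z : ℝ => potDeriv h (max z 0) := by
  have h2 : Measurable fun z : ℝ => p (max z 0) :=
    (hp.continuousOn.comp_continuous (by fun_prop) fun z => le_max_right z 0).measurable
  have h3 : Measurable fun z : ℝ =>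
      if z ≤ 0 then potDeriv h 0 else (p (max z 0) + h (max z 0)) / z :=
    Measurable.ite measurableSet_Iic measurable_const
      ((h2.add (measurable_potential_max hh)).div measurable_id)
  convert h3 using 2 with z
  split_ifs with hz
  · simp [hz]
  · have hz' := not_le.1 hz
    simp [hz'.le, potDeriv_eq hh hz']

lemma aemeasurable_potential {p h : ℝ → ℝ} (hh : IsPotential p h) {X : Type*}
    [MeasurableSpace X] {ν : Measure X} {f : X → ℝ} (hf : AEMeasurable f ν)
    (hf0 : ∀ᵐ x ∂ν, 0 ≤ f x) : AEMeasurable (fun x => h (f x)) ν := by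
  refine ((measurable_potential_max hh).comp_aemeasurable hf).congr ?_
  filter_upwards [hf0] with x hx
  simp [hx]

lemma aemeasurable_potDeriv {p h : ℝ → ℝ} (hp : IsPressure p) (hh : IsPotential p h) {X : Type*}
    [MeasurableSpace X] {ν : Measure X} {f : X → ℝ} (hf : AEMeasurable f ν)
    (hf0 : ∀ᵐ x ∂ν, 0 ≤ f x) : AEMeasurable (fun x => potDeriv h (f x)) ν := by
  refine ((measurable_potDeriv_max hp hh).comp_aemeasurable hf).congr ?_
  filter_upwards [hf0] with x hx
  simp [hx]

lemma aemeasurable_potPressure {p h : ℝ → ℝ} (hp : IsPressure p) (hh : IsPotential p h)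
    {X : Type*} [MeasurableSpace X] {ν : Measure X} {f : X → ℝ} (hf : AEMeasurable f ν)
    (hf0 : ∀ᵐ x ∂ν, 0 ≤ f x) : AEMeasurable (fun x => potPressure h (f x)) ν :=
  (hf.mul (aemeasurable_potDeriv hp hh hf hf0)).sub (aemeasurable_potential hh hf hf0)

/-! ### A Grönwall inequality for almost all pairs of times -/

/-- Fubini exchanges the two null-set quantifiers; the set of pairs must be measurable, hence the
measurable representative. In Grönwall's argument the final time is fixed and monotonicity is needed
for almost all earlier times. -/
lemma ae_ae_swap_lt {m : ℝ → ℝ} (hm : AEMeasurable m (volume.restrict (Ioi 0)))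
    (h1 : ∀ᵐ σ : ℝ, 0 < σ → ∀ᵐ τ : ℝ, σ < τ → m τ ≤ m σ) :
    ∀ᵐ τ : ℝ, 0 < τ → ∀ᵐ σ : ℝ, 0 < σ → σ < τ → m τ ≤ m σ := by
  set m' := hm.mk m
  have hm' : ∀ᵐ s : ℝ, 0 < s → m s = m' s := (ae_restrict_iff' measurableSet_Ioi).1 hm.ae_eq_mk
  have hmeas : Measurable m' := hm.measurable_mk
  have h2 : ∀ᵐ σ : ℝ, ∀ᵐ τ : ℝ, (0 < σ → σ < τ → m' τ ≤ m' σ) := by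
    filter_upwards [h1, hm'] with σ hσ hσ'
    by_cases h0 : 0 < σ
    · filter_upwards [hσ h0, hm'] with τ hτ hτ' _ hlt
      rw [← hτ' (h0.trans hlt), ← hσ' h0]
      exact hτ hlt
    · exact Eventually.of_forall fun _ h => absurd h h0
  have hset : MeasurableSet {x : ℝ × ℝ | 0 < x.1 → x.1 < x.2 → m' x.2 ≤ m' x.1} := by
    have e1 : MeasurableSet {x : ℝ × ℝ | 0 < x.1} := measurableSet_lt measurable_const measurable_fst
    have e2 : MeasurableSet {x : ℝ × ℝ | x.1 < x.2} := measurableSet_lt measurable_fst measurable_snd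
    have e3 : MeasurableSet {x : ℝ × ℝ | m' x.2 ≤ m' x.1} :=
      measurableSet_le (hmeas.comp measurable_snd) (hmeas.comp measurable_fst)
    exact e1.imp (e2.imp e3)
  rw [Measure.ae_ae_comm (p := fun σ τ => 0 < σ → σ < τ → m' τ ≤ m' σ) hset] at h2
  filter_upwards [h2, hm'] with τ hτ hτ' h0
  filter_upwards [hτ, hm'] with σ hσ hσ' hσ0 hlt
  rw [hτ' h0, hσ' hσ0]
  exact hσ hσ0 hlt

/-- An antitone rate changes sign at most once, at s₀. Up to s₀ the integral is at most M₀(1 -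
A(s₀)), because (-A)' = gA; beyond s₀ the integrand is nonpositive. Thus rates that become negative
are admitted, which is the case of interest. -/
lemma integral_mul_le_of_antitone_rate {A g M : ℝ → ℝ} {t M₀ : ℝ} (ht : 0 ≤ t)
    (hg : Continuous g) (hg' : Antitone g) (hA : ∀ s, HasDerivAt A (-(g s * A s)) s)
    (hA0 : A 0 = 1) (hApos : ∀ s, 0 < A s) (hMi : IntervalIntegrable M volume 0 t)
    (hM : ∀ᵐ s : ℝ, 0 < s → s < t → 0 ≤ M s ∧ M s ≤ M₀) (hM₀ : 0 ≤ M₀) :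
    ∫ s in 0..t, A s * g s * M s ≤ M₀ := by
  have hAc : Continuous A := continuous_iff_continuousAt.2 fun s => (hA s).continuousAt
  have hsplit : ∃ s₀ ∈ Icc 0 t, (∀ s ∈ Ioo 0 s₀, 0 ≤ g s) ∧ ∀ s ∈ Ioo s₀ t, g s ≤ 0 := by
    rcases le_total (g 0) 0 with h0 | h0
    · exact ⟨0, ⟨le_rfl, ht⟩, by simp, fun s hs => (hg' hs.1.le).trans h0⟩
    rcases le_total 0 (g t) with h1 | h1
    · exact ⟨t, ⟨ht, le_rfl⟩, fun s hs => h1.trans (hg' hs.2.le), by simp⟩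
    · obtain ⟨s₀, hs₀, hgs⟩ := intermediate_value_Icc' ht hg.continuousOn ⟨h1, h0⟩
      exact ⟨s₀, hs₀, fun s hs => hgs ▸ hg' hs.2.le, fun s hs => hgs ▸ hg' hs.1.le⟩
  obtain ⟨s₀, hs₀, hpos, hneg⟩ := hsplit
  have hi : IntervalIntegrable (fun s => A s * g s * M s) volume 0 t :=
    hMi.continuousOn_mul (hAc.mul hg).continuousOn
  have hi1 : IntervalIntegrable (fun s => A s * g s * M s) volume 0 s₀ :=
    hi.mono_set (by rw [uIcc_of_le hs₀.1, uIcc_of_le ht]; exact Icc_subset_Icc_right hs₀.2)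
  have hi2 : IntervalIntegrable (fun s => A s * g s * M s) volume s₀ t :=
    hi.mono_set (by rw [uIcc_of_le hs₀.2, uIcc_of_le ht]; exact Icc_subset_Icc_left hs₀.1)
  have hft : ∫ s in 0..s₀, A s * g s = 1 - A s₀ := by
    have := intervalIntegral.integral_eq_sub_of_hasDerivAt (a := 0) (b := s₀)
      (fun s _ => (hA s).neg) ((by fun_prop : Continuous fun s => - -(g s * A s)).intervalIntegrable _ _)
    simp only [Pi.neg_apply, neg_neg, hA0] at this
    simp only [mul_comm (A _)]
    linarith
  have e1 : ∫ s in 0..s₀, A s * g s * M s ≤ ∫ s in 0..s₀, A s * g s * M₀ := by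
    refine intervalIntegral.integral_mono_ae_restrict hs₀.1 hi1
      ((by fun_prop : Continuous fun s => A s * g s * M₀).intervalIntegrable _ _) ?_
    rw [restrict_Ioo_eq_restrict_Icc.symm]
    refine (ae_restrict_iff' measurableSet_Ioo).2 ?_
    filter_upwards [hM] with s hs hs'
    exact mul_le_mul_of_nonneg_left (hs hs'.1 (hs'.2.trans_le hs₀.2)).2
      (mul_nonneg (hApos s).le (hpos s hs'))
  have e2 : ∫ s in s₀..t, A s * g s * M s ≤ ∫ s in s₀..t, (0 : ℝ) := by
    refine intervalIntegral.integral_mono_ae_restrict hs₀.2 hi2 (by simp) ?_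
    rw [restrict_Ioo_eq_restrict_Icc.symm]
    refine (ae_restrict_iff' measurableSet_Ioo).2 ?_
    filter_upwards [hM] with s hs hs'
    exact mul_nonpos_of_nonpos_of_nonneg
      (mul_nonpos_of_nonneg_of_nonpos (hApos s).le (hneg s hs'))
      (hs (hs₀.1.trans_lt hs'.1) hs'.2).1
  rw [intervalIntegral.integral_mul_const, hft] at e1
  rw [intervalIntegral.integral_zero] at e2
  rw [← intervalIntegral.integral_add_adjacent_intervals hi1 hi2]
  nlinarith [hApos s₀]

/-- Grönwall's inequality for a function that satisfies the integral inequality for almost all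
pairs of times, with an antitone rate `g`. -/
lemma gronwall_ae {f g k : ℝ → ℝ} {f₀ : ℝ} (hg : Continuous g) (hg' : Antitone g)
    (hk : Continuous k) (hf : ∀ t, 0 ≤ t → IntervalIntegrable f volume 0 t)
    {A : ℝ → ℝ} (hA : ∀ s, HasDerivAt A (-(g s * A s)) s) (hA0 : A 0 = 1) (hApos : ∀ s, 0 < A s)
    (h1 : ∀ᵐ σ : ℝ, 0 < σ → ∀ᵐ τ : ℝ, σ < τ →
      f τ ≤ f σ + ∫ s in σ..τ, (g s * f s + k s))
    (h2 : ∀ᵐ τ : ℝ, 0 < τ → f τ ≤ f₀ + ∫ s in 0..τ, (g s * f s + k s)) :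
    ∀ᵐ t : ℝ, 0 < t → A t * f t ≤ f₀ + ∫ s in 0..t, A s * k s := by
  have hAc : Continuous A := continuous_iff_continuousAt.2 fun s => (hA s).continuousAt
  set φ : ℝ → ℝ := fun s => g s * f s + k s with hφ
  have hφi : ∀ t, 0 ≤ t → IntervalIntegrable φ volume 0 t := fun t ht =>
    ((hf t ht).continuousOn_mul hg.continuousOn).add (hk.intervalIntegrable _ _)
  set F : ℝ → ℝ := fun t => ∫ s in 0..t, φ s with hF
  set m : ℝ → ℝ := fun t => f t - F t with hm
  have hFAC : ∀ t, 0 ≤ t → AbsolutelyContinuousOnInterval F 0 t := fun t ht =>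
    (hφi t ht).absolutelyContinuousOnInterval_intervalIntegral (c := 0) (by simp)
  have hmi : ∀ t, 0 ≤ t → IntervalIntegrable m volume 0 t := fun t ht =>
    (hf t ht).sub (hFAC t ht).continuousOn.intervalIntegrable
  have hmm : AEMeasurable m (volume.restrict (Ioi 0)) := by
    have : (Ioi (0 : ℝ)) = ⋃ k : ℕ, Ioc (0 : ℝ) k := by
      ext x
      simp only [mem_Ioi, mem_iUnion, mem_Ioc]
      refine ⟨fun hx => ?_, fun ⟨_, h, _⟩ => h⟩
      obtain ⟨k, hk⟩ := exists_nat_ge x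
      exact ⟨k, hx, hk⟩
    rw [this, aemeasurable_iUnion_iff]
    intro k
    have := (hmi k k.cast_nonneg).1
    exact this.aestronglyMeasurable.aemeasurable
  have hmono : ∀ᵐ σ : ℝ, 0 < σ → ∀ᵐ τ : ℝ, σ < τ → m τ ≤ m σ := by
    filter_upwards [h1] with σ hσ h0
    filter_upwards [hσ h0] with τ hτ hlt
    have := intervalIntegral.integral_add_adjacent_intervals (hφi σ h0.le)
      ((hφi σ h0.le).symm.trans (hφi τ (h0.trans hlt).le))
    have h3 := hτ hlt
    simp only [hm, hF]
    linarith
  have hle0 : ∀ᵐ τ : ℝ, 0 < τ → m τ ≤ f₀ := by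
    filter_upwards [h2] with τ hτ h0
    have := hτ h0
    simp only [hm, hF]
    linarith
  filter_upwards [ae_ae_swap_lt hmm hmono, hle0] with t ht ht0 h0
  have hAd : deriv A = fun s => -(g s * A s) := funext fun s => (hA s).deriv
  have hAAC : AbsolutelyContinuousOnInterval A 0 t :=
    (contDiff_one_iff_deriv.2 ⟨fun s => (hA s).differentiableAt, by
      rw [hAd]; fun_prop⟩).contDiffOn.absolutelyContinuousOnInterval
  -- Integration by parts applies to F alone. With A' = -gA it yields A(t)F(t) = ∫ A g m + ∫ A k,
  -- see `e2`.
  have hparts := hAAC.integral_mul_deriv_eq_deriv_mul (hFAC t h0.le)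
  have hFd : ∫ s in 0..t, A s * deriv F s = ∫ s in 0..t, A s * φ s := by
    refine intervalIntegral.integral_congr_ae ?_
    filter_upwards [(hφi t h0.le).ae_hasDerivAt_integral] with s hs hs'
    rw [(hs (uIoc_subset_uIcc hs') 0 (by simp)).deriv]
  have hF0 : F 0 = 0 := by simp [hF]
  rw [hFd, hF0, hAd] at hparts
  have hAF : IntervalIntegrable (fun s => -(g s * A s) * F s) volume 0 t :=
    (hFAC t h0.le).continuousOn.intervalIntegrable.continuousOn_mul
      (by fun_prop : Continuous fun s => -(g s * A s)).continuousOn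
  have hAφ : IntervalIntegrable (fun s => A s * φ s) volume 0 t :=
    (hφi t h0.le).continuousOn_mul hAc.continuousOn
  -- Because ∫ A g = 1 - A(t), the sum A(t)m(t) + ∫ A g m equals m(t) + ∫ A g (m - m(t)). The values
  -- of m - m(t) lie in [0, f₀ - m(t)], so the sum is at most f₀.
  have hM := integral_mul_le_of_antitone_rate (M := fun s => m s - m t) (M₀ := f₀ - m t) h0.le hg
    hg' hA hA0 hApos ((hmi t h0.le).sub (by simp))
    (by
      filter_upwards [ht h0, hle0] with s hs hs' hs0 hst
      exact ⟨sub_nonneg.2 (hs hs0 hst), sub_le_sub_right (hs' hs0) _⟩)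
    (sub_nonneg.2 (ht0 h0))
  have hAgi : IntervalIntegrable (fun s => A s * g s) volume 0 t :=
    (by fun_prop : Continuous fun s => A s * g s).intervalIntegrable _ _
  have hAg : ∫ s in 0..t, A s * g s = 1 - A t := by
    have := intervalIntegral.integral_eq_sub_of_hasDerivAt (a := 0) (b := t)
      (fun s _ => (hA s).neg) ((by fun_prop : Continuous fun s => - -(g s * A s)).intervalIntegrable _ _)
    simp only [Pi.neg_apply, neg_neg, hA0] at this
    simp only [mul_comm (A _)]
    linarith
  have hAgm : IntervalIntegrable (fun s => A s * g s * m s) volume 0 t :=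
    (hmi t h0.le).continuousOn_mul (by fun_prop : Continuous fun s => A s * g s).continuousOn
  have e1 : ∫ s in 0..t, A s * g s * (m s - m t)
      = (∫ s in 0..t, A s * g s * m s) - (1 - A t) * m t := by
    rw [← hAg, ← intervalIntegral.integral_mul_const, ← intervalIntegral.integral_sub hAgm
      (hAgi.mul_const _)]
    simp only [mul_sub]
  have e2 : (∫ s in 0..t, A s * φ s) + ∫ s in 0..t, -(g s * A s) * F s
      = (∫ s in 0..t, A s * g s * m s) + ∫ s in 0..t, A s * k s := by
    rw [← intervalIntegral.integral_add hAφ hAF, ← intervalIntegral.integral_add hAgm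
      ((by fun_prop : Continuous fun s => A s * k s).intervalIntegrable _ _)]
    refine intervalIntegral.integral_congr fun s _ => ?_
    simp only [hφ, hm]
    ring
  have e3 : f t = m t + F t := by simp [hm]
  rw [e3]
  linarith

/-- The integrating factor is A = exp(-∫ rate). The decaying part of the rate contributes at most
∫₀^∞ μe^{-cs} ds = μ/c to the exponent, and Aκe^{-cs} ≤ κe^{-θs} has integral at most κ/θ. If θ = 0,
then κ = 0 and κ/θ = 0 by the convention for division by zero. -/
lemma gronwall_exp_ae {f : ℝ → ℝ} {f₀ c θ μ κ : ℝ} (hc : 0 < c) (hθ : 0 ≤ θ) (hμ : 0 ≤ μ)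
    (hκ : 0 ≤ κ) (hθκ : θ = 0 → κ = 0)
    (hf : ∀ t, 0 ≤ t → IntervalIntegrable f volume 0 t)
    (hf0 : ∀ᵐ t : ℝ, 0 < t → 0 ≤ f t)
    (h1 : ∀ᵐ σ : ℝ, 0 < σ → ∀ᵐ τ : ℝ, σ < τ → f τ ≤ f σ +
      ∫ s in σ..τ, ((-(c - θ) + μ * Real.exp (-(c * s))) * f s + κ * Real.exp (-(c * s))))
    (h2 : ∀ᵐ τ : ℝ, 0 < τ → f τ ≤ f₀ +
      ∫ s in 0..τ, ((-(c - θ) + μ * Real.exp (-(c * s))) * f s + κ * Real.exp (-(c * s)))) :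
    ∀ᵐ t : ℝ, 0 < t → f t ≤ Real.exp (-(c - θ) * t + μ / c) * (f₀ + κ / θ) := by
  set A : ℝ → ℝ := fun s => Real.exp ((c - θ) * s - μ / c * (1 - Real.exp (-(c * s)))) with hAdef
  have hA : ∀ s, HasDerivAt A (-((-(c - θ) + μ * Real.exp (-(c * s))) * A s)) s := by
    intro s
    have e1 : HasDerivAt (fun s : ℝ => Real.exp (-(c * s))) (Real.exp (-(c * s)) * -(c * 1)) s :=
      (((hasDerivAt_id s).const_mul c).neg).exp
    have e2 := ((((hasDerivAt_id s).const_mul (c - θ)).sub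
      ((e1.const_sub 1).const_mul (μ / c))).exp)
    refine e2.congr_deriv ?_
    simp only [hAdef, id, Pi.sub_apply]
    field_simp
    ring
  have hant : Antitone fun s : ℝ => -(c - θ) + μ * Real.exp (-(c * s)) := by
    intro s t hst
    have : Real.exp (-(c * t)) ≤ Real.exp (-(c * s)) := Real.exp_le_exp.2 (by nlinarith)
    simp only
    nlinarith
  have hgr := gronwall_ae (by fun_prop) hant
    (by fun_prop : Continuous fun s : ℝ => κ * Real.exp (-(c * s))) hf hA (by simp [hAdef])
    (fun s => Real.exp_pos _) h1 h2
  have hAk : ∀ s, 0 ≤ s → A s * (κ * Real.exp (-(c * s))) ≤ κ * Real.exp (-(θ * s)) := by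
    intro s hs
    have h3 : Real.exp (-(c * s)) ≤ 1 := Real.exp_le_one_iff.2 (by nlinarith)
    have h4 : A s ≤ Real.exp ((c - θ) * s) := by
      refine Real.exp_le_exp.2 ?_
      have : 0 ≤ μ / c * (1 - Real.exp (-(c * s))) :=
        mul_nonneg (div_nonneg hμ hc.le) (by linarith)
      linarith
    calc A s * (κ * Real.exp (-(c * s)))
        ≤ Real.exp ((c - θ) * s) * (κ * Real.exp (-(c * s))) :=
          mul_le_mul_of_nonneg_right h4 (by positivity)
      _ = κ * (Real.exp ((c - θ) * s) * Real.exp (-(c * s))) := by ring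
      _ = κ * Real.exp (-(θ * s)) := by rw [← Real.exp_add]; ring_nf
  have hAc : Continuous A := continuous_iff_continuousAt.2 fun s => (hA s).continuousAt
  have hInt : ∀ t, 0 ≤ t → ∫ s in 0..t, A s * (κ * Real.exp (-(c * s))) ≤ min (κ / θ) (κ * t) := by
    intro t ht
    have e1 : ∫ s in 0..t, A s * (κ * Real.exp (-(c * s))) ≤ ∫ s in 0..t, κ * Real.exp (-(θ * s)) :=
      intervalIntegral.integral_mono_on ht
        ((by fun_prop : Continuous fun s => A s * (κ * Real.exp (-(c * s)))).intervalIntegrable _ _)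
        ((by fun_prop : Continuous fun s => κ * Real.exp (-(θ * s))).intervalIntegrable _ _)
        fun s hs => hAk s hs.1
    refine e1.trans (le_min ?_ ?_)
    · rcases hθ.eq_or_lt with h0 | h0
      · simp [hθκ h0.symm]
      · have e2 := intervalIntegral.integral_eq_sub_of_hasDerivAt (a := 0) (b := t)
          (f := fun s => -(κ / θ) * Real.exp (-(θ * s))) (f' := fun s => κ * Real.exp (-(θ * s)))
          (fun s _ => by
            refine (((((hasDerivAt_id s).const_mul θ).neg).exp).const_mul (-(κ / θ))).congr_deriv ?_
            simp only [id, Pi.neg_apply]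
            field_simp)
          ((by fun_prop : Continuous fun s => κ * Real.exp (-(θ * s))).intervalIntegrable _ _)
        rw [e2]
        have : 0 ≤ κ / θ * Real.exp (-(θ * t)) := by positivity
        simp only [mul_zero, neg_zero, Real.exp_zero]
        linarith
    · have e2 : ∫ s in 0..t, κ * Real.exp (-(θ * s)) ≤ ∫ s in 0..t, κ :=
        intervalIntegral.integral_mono_on ht
          ((by fun_prop : Continuous fun s => κ * Real.exp (-(θ * s))).intervalIntegrable _ _)
          (by simp) fun s hs => by
            have : Real.exp (-(θ * s)) ≤ 1 := Real.exp_le_one_iff.2 (by nlinarith [hs.1])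
            nlinarith
      simpa [mul_comm] using e2
  -- The bound κt of the source integral is small for small t, so a negative f₀ would force f < 0 on
  -- the interval (0, ε). Nonnegativity of f₀ is needed at the end, where (A t)⁻¹ is replaced by a
  -- larger factor.
  have hf₀ : 0 ≤ f₀ := by
    by_contra! hneg
    set ε := -f₀ / (κ + 1) with hε
    have hε0 : 0 < ε := div_pos (by linarith) (by linarith)
    have hbad : ∀ᵐ t : ℝ, t ∉ Ioo 0 ε := by
      filter_upwards [hgr, hf0] with t ht ht0 hmem
      have h3 := ht hmem.1
      have h4 := ht0 hmem.1
      have h5 := (hInt t hmem.1.le).trans (min_le_right _ _)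
      have h6 : 0 ≤ A t * f t := mul_nonneg (Real.exp_pos _).le h4
      have h7 : t * (κ + 1) < -f₀ := (lt_div_iff₀ (by linarith)).1 hmem.2
      nlinarith [hmem.1]
    have : volume (Ioo 0 ε) = 0 := by
      rw [← compl_mem_ae_iff]
      exact hbad
    simp [hε0.not_ge] at this
  filter_upwards [hgr] with t ht h0
  have h3 := ht h0
  have h4 := (hInt t h0.le).trans (min_le_left _ _)
  have h5 : A t * f t ≤ f₀ + κ / θ := by linarith
  have h6 : f t = (A t)⁻¹ * (A t * f t) := by
    rw [inv_mul_cancel_left₀ (Real.exp_pos _).ne']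
  rw [h6]
  have h7 : (A t)⁻¹ ≤ Real.exp (-(c - θ) * t + μ / c) := by
    rw [hAdef, ← Real.exp_neg]
    refine Real.exp_le_exp.2 ?_
    have : 0 ≤ μ / c * Real.exp (-(c * t)) := by positivity
    linarith
  have h8 : 0 ≤ κ / θ := by positivity
  calc (A t)⁻¹ * (A t * f t) ≤ (A t)⁻¹ * (f₀ + κ / θ) :=
        mul_le_mul_of_nonneg_left h5 (inv_nonneg.2 (Real.exp_pos _).le)
    _ ≤ _ := mul_le_mul_of_nonneg_right h7 (by linarith)

/-! ### Vector calculus -/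

lemma inner_gradient_eq {d : ℕ} (f : Space d → ℝ) (y v : Space d) :
    inner ℝ (gradient f y) v = fderiv ℝ f y v := by
  rw [gradient, InnerProductSpace.toDual_symm_apply]

lemma inner_gradient_eq' {d : ℕ} (f : Space d → ℝ) (y v : Space d) :
    inner ℝ v (gradient f y) = fderiv ℝ f y v := by
  rw [real_inner_comm, inner_gradient_eq]

lemma sum_smul_single {d : ℕ} (v : Space d) :
    ∑ j, v j • (EuclideanSpace.single j (1 : ℝ) : Space d) = v := by
  have := (EuclideanSpace.basisFun (Fin d) ℝ).sum_repr v
  simpa using this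

lemma contraction_jacobian_tensor {d : ℕ} (ψ : Space d → Space d) (y a b : Space d) :
    contraction (jacobian ψ y) (tensor a b) = inner ℝ (fderiv ℝ ψ y b) a := by
  conv_rhs => rw [← sum_smul_single b, map_sum, sum_inner]
  simp only [contraction, jacobian, tensor, map_smul, PiLp.inner_apply, PiLp.smul_apply,
    smul_eq_mul, RCLike.inner_apply, conj_trivial]
  rw [Finset.sum_comm]
  refine Finset.sum_congr rfl fun j _ => Finset.sum_congr rfl fun i _ => ?_
  ring

lemma contraction_jacobian_one {d : ℕ} (ψ : Space d → Space d) (y : Space d) :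
    contraction (jacobian ψ y) 1 = divergence ψ y := by
  simp [contraction, jacobian, divergence, Matrix.one_apply]

lemma contraction_add {d : ℕ} (A B C : Matrix (Fin d) (Fin d) ℝ) :
    contraction A (B + C) = contraction A B + contraction A C := by
  simp [contraction, mul_add, Finset.sum_add_distrib]

lemma contraction_smul {d : ℕ} (c : ℝ) (A B : Matrix (Fin d) (Fin d) ℝ) :
    contraction A (c • B) = c * contraction A B := by
  simp only [contraction, Matrix.smul_apply, smul_eq_mul, Finset.mul_sum]
  exact Finset.sum_congr rfl fun i _ => Finset.sum_congr rfl fun j _ => by ring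

lemma contraction_neg {d : ℕ} (A B : Matrix (Fin d) (Fin d) ℝ) :
    contraction A (-B) = -contraction A B := by
  simp [contraction]

/-- The divergence as a continuous linear functional of the derivative. -/
def traceCLM (d : ℕ) : (Space d →L[ℝ] Space d) →L[ℝ] ℝ :=
  ∑ j, (EuclideanSpace.proj j).comp
    (ContinuousLinearMap.apply ℝ (Space d) (EuclideanSpace.single j (1 : ℝ)))

lemma divergence_eq_traceCLM {d : ℕ} (ψ : Space d → Space d) (y : Space d) :
    divergence ψ y = traceCLM d (fderiv ℝ ψ y) := by
  simp [divergence, traceCLM]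

/-- With the gradient seen as a linear map and the divergence as its trace, the product rule and the
tensor algebra of the entropy identity become identities between inner products. -/
lemma momentumIntegrand_eq {d : ℕ} (α : ℝ) (p : ℝ → ℝ) (ρ : ℝ → Space d → ℝ)
    (n : ℝ → Space d → Space d) (ψ : ℝ → Space d → Space d) (τ : ℝ) (y : Space d) :
    momentumIntegrand α p ρ n ψ τ y = inner ℝ (deriv (fun s => ψ s y) τ) (n τ y)
      - (1 / 2) * inner ℝ (fderiv ℝ (ψ τ) y y) (n τ y)
      + (ρ τ y)⁻¹ * inner ℝ (fderiv ℝ (ψ τ) y (n τ y)) (n τ y)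
      + Real.exp (d * τ) * p (ρ τ y) * traceCLM d (fderiv ℝ (ψ τ) y)
      - Real.exp (d * τ) * α * inner ℝ (ψ τ y) (n τ y) := by
  rw [momentumIntegrand, momentumFlux, contraction_add, contraction_add, contraction_neg,
    contraction_smul, contraction_smul, contraction_jacobian_tensor, contraction_jacobian_tensor,
    contraction_jacobian_one, divergence_eq_traceCLM, map_smul, real_inner_smul_left,
    real_inner_smul_right]
  ring

lemma densityIntegrand_eq {d : ℕ} (ρ : ℝ → Space d → ℝ) (n : ℝ → Space d → Space d)
    (φ : ℝ → Space d → ℝ) (τ : ℝ) (y : Space d) :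
    densityIntegrand ρ n φ τ y = deriv (fun s => φ s y) τ * ρ τ y
      - (ρ τ y / 2 * fderiv ℝ (φ τ) y y - fderiv ℝ (φ τ) y (n τ y)) - d / 2 * φ τ y * ρ τ y := by
  rw [densityIntegrand, inner_gradient_eq, map_sub, map_smul, smul_eq_mul]

lemma referenceIntegrand_eq {d : ℕ} (h : ℝ → ℝ) (ρ : ℝ → Space d → ℝ)
    (n : ℝ → Space d → Space d) (ρinf : ℝ → Space d → ℝ) (τ : ℝ) (y : Space d) :
    referenceIntegrand h ρ n ρinf τ y =
      -(deriv (fun s => potDeriv h (ρinf s y)) τ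
        - 1 / 2 * fderiv ℝ (fun x => potDeriv h (ρinf τ x)) y y) * (ρ τ y - ρinf τ y)
      - fderiv ℝ (fun x => potDeriv h (ρinf τ x)) y (n τ y) := by
  rw [referenceIntegrand, inner_gradient_eq, real_inner_smul_left, inner_gradient_eq']

/-! ### Functions of class `C¹` on the half space -/

section HalfSpace

variable {d : ℕ} {F : Type} [NormedAddCommGroup F] [NormedSpace ℝ F]

lemma uniqueDiffOn_halfSpace : UniqueDiffOn ℝ (halfSpace d) :=
  (uniqueDiffOn_Ici 0).prod uniqueDiffOn_univ

lemma halfSpace_mem_nhds {z : ℝ × Space d} (hz : 0 < z.1) : halfSpace d ∈ 𝓝 z :=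
  prod_mem_nhds (Ici_mem_nhds hz) univ_mem

/-- The derivative in time and space. -/
def spaceTimeDeriv (f : ℝ → Space d → F) (z : ℝ × Space d) : (ℝ × Space d) →L[ℝ] F :=
  fderivWithin ℝ (fun z : ℝ × Space d => f z.1 z.2) (halfSpace d) z

variable {f : ℝ → Space d → F}

lemma continuousOn_spaceTimeDeriv
    (hf : ContDiffOn ℝ 1 (fun z : ℝ × Space d => f z.1 z.2) (halfSpace d)) :
    ContinuousOn (spaceTimeDeriv f) (halfSpace d) :=
  hf.continuousOn_fderivWithin uniqueDiffOn_halfSpace le_rfl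

/-- For positive times the half space is a neighbourhood, so the one-sided derivative behind
`spaceTimeDeriv` is a genuine one. The time 0 is excluded from all slabs. -/
lemma hasFDerivAt_spaceTime
    (hf : ContDiffOn ℝ 1 (fun z : ℝ × Space d => f z.1 z.2) (halfSpace d))
    {z : ℝ × Space d} (hz : 0 < z.1) :
    HasFDerivAt (fun z : ℝ × Space d => f z.1 z.2) (spaceTimeDeriv f z) z :=
  ((hf.differentiableOn one_ne_zero) z ⟨hz.le, trivial⟩).hasFDerivWithinAt.hasFDerivAt
    (halfSpace_mem_nhds hz)

lemma hasDerivAt_time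
    (hf : ContDiffOn ℝ 1 (fun z : ℝ × Space d => f z.1 z.2) (halfSpace d))
    {τ : ℝ} (hτ : 0 < τ) (y : Space d) :
    HasDerivAt (fun s => f s y) (spaceTimeDeriv f (τ, y) (1, 0)) τ := by
  have h1 := hasFDerivAt_spaceTime hf (z := (τ, y)) hτ
  have h2 : HasDerivAt (fun s : ℝ => (s, y)) ((1 : ℝ), (0 : Space d)) τ :=
    (hasDerivAt_id τ).prodMk (hasDerivAt_const τ y)
  exact h1.comp_hasDerivAt τ h2

lemma hasFDerivAt_space
    (hf : ContDiffOn ℝ 1 (fun z : ℝ × Space d => f z.1 z.2) (halfSpace d))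
    {τ : ℝ} (hτ : 0 < τ) (y : Space d) :
    HasFDerivAt (f τ) ((spaceTimeDeriv f (τ, y)).comp (ContinuousLinearMap.inr ℝ ℝ (Space d))) y := by
  have h1 := hasFDerivAt_spaceTime hf (z := (τ, y)) hτ
  have h2 : HasFDerivAt (fun x : Space d => (τ, x)) (ContinuousLinearMap.inr ℝ ℝ (Space d)) y :=
    hasFDerivAt_prodMk_right τ y
  exact h1.comp y h2

lemma fderiv_space_apply
    (hf : ContDiffOn ℝ 1 (fun z : ℝ × Space d => f z.1 z.2) (halfSpace d))
    {τ : ℝ} (hτ : 0 < τ) (y v : Space d) :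
    fderiv ℝ (f τ) y v = spaceTimeDeriv f (τ, y) (0, v) := by
  rw [(hasFDerivAt_space hf hτ y).fderiv]
  simp

lemma contDiff_slice
    (hf : ContDiffOn ℝ 1 (fun z : ℝ × Space d => f z.1 z.2) (halfSpace d))
    {τ : ℝ} (hτ : 0 ≤ τ) : ContDiff ℝ 1 (f τ) := by
  rw [← contDiffOn_univ]
  exact hf.comp (f := fun x : Space d => (τ, x)) (by fun_prop) fun x _ => ⟨hτ, trivial⟩

end HalfSpace

/-! ### Integrability of the weak formulation -/

section TestFunction

variable {d : ℕ} {F : Type} [NormedAddCommGroup F] [NormedSpace ℝ F]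

/-- The time slab `(0,T] × ℝ^d`. -/
def slab (d : ℕ) (T : ℝ) : Set (ℝ × Space d) := Ioc 0 T ×ˢ univ

lemma measurableSet_slab (T : ℝ) : MeasurableSet (slab d T) :=
  measurableSet_Ioc.prod MeasurableSet.univ

lemma slab_subset_halfSpace (T : ℝ) : slab d T ⊆ halfSpace d :=
  prod_mono (fun _ h => h.1.le) le_rfl

lemma IsTestFunction.exists_support {f : ℝ → Space d → F} (hf : IsTestFunction f) :
    ∃ R : ℝ, ∀ z ∈ halfSpace d, R < ‖z.2‖ → f z.1 z.2 = 0 ∧ spaceTimeDeriv f z = 0 := by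
  obtain ⟨R, hR⟩ := hf.2
  refine ⟨R, fun z hz hzR => ⟨hR z.1 hz.1 z.2 (Or.inr hzR), ?_⟩⟩
  have h1 : (fun z : ℝ × Space d => f z.1 z.2) =ᶠ[𝓝[halfSpace d] z] fun _ => 0 := by
    have h2 : ∀ᶠ x : ℝ × Space d in 𝓝 z, R < ‖x.2‖ :=
      (isOpen_lt continuous_const (by fun_prop)).mem_nhds hzR
    filter_upwards [mem_nhdsWithin_of_mem_nhds h2, self_mem_nhdsWithin] with x hx hx'
    exact hR x.1 hx'.1 x.2 (Or.inr hx)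
  rw [spaceTimeDeriv, h1.fderivWithin_eq (hR z.1 hz.1 z.2 (Or.inr hzR))]
  simp

/-- The continuous factor is bounded on the compact set [0,T] × B̄_R and vanishes on the rest of the
slab; hence local integrability of the other factor suffices. -/
lemma integrableOn_slab_bilinear {V W G : Type} [NormedAddCommGroup V] [NormedSpace ℝ V]
    [NormedAddCommGroup W] [NormedSpace ℝ W] [NormedAddCommGroup G] [NormedSpace ℝ G]
    (B : V →L[ℝ] W →L[ℝ] G) {a : ℝ × Space d → V} {g : ℝ × Space d → W} {R : ℝ} (T : ℝ)
    (ha : ContinuousOn a (halfSpace d)) (ha0 : ∀ z ∈ halfSpace d, R < ‖z.2‖ → a z = 0)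
    (hg : LocallyIntegrableOn g (halfSpace d)) :
    IntegrableOn (fun z => B (a z) (g z)) (slab d T) := by
  set C : Set (ℝ × Space d) := Icc 0 T ×ˢ Metric.closedBall 0 R with hC
  have hCc : IsCompact C := isCompact_Icc.prod (isCompact_closedBall _ _)
  have hCs : C ⊆ halfSpace d := prod_mono (fun _ h => h.1) (subset_univ _)
  have hCm : MeasurableSet C := hCc.measurableSet
  have hgC : IntegrableOn g C := hg.integrableOn_compact_subset hCs hCc
  have hsecond : SecondCountableTopologyEither (ℝ × Space d) V := inferInstance
  have haC : AEStronglyMeasurable a (volume.restrict C) :=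
    (ha.mono hCs).aestronglyMeasurable hCm
  obtain ⟨M, hM⟩ := hCc.exists_bound_of_continuousOn (ha.mono hCs)
  have h1 : IntegrableOn (fun z => B (a z) (g z)) C := by
    refine Integrable.mono' (hgC.norm.const_mul (‖B‖ * M)) (B.aestronglyMeasurable_comp₂ haC
      hgC.aestronglyMeasurable) ?_
    refine (ae_restrict_iff' hCm).2 (Eventually.of_forall fun z hz => ?_)
    calc ‖B (a z) (g z)‖ ≤ ‖B‖ * ‖a z‖ * ‖g z‖ := B.le_opNorm₂ _ _
      _ ≤ ‖B‖ * M * ‖g z‖ := by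
        gcongr
        exact hM z hz
  refine h1.of_forall_sdiff_eq_zero (measurableSet_slab T) fun z hz => ?_
  have hz2 : R < ‖z.2‖ := by
    by_contra hle
    exact hz.2 ⟨⟨hz.1.1.1.le, hz.1.1.2⟩, by simpa using hle⟩
  rw [ha0 z (slab_subset_halfSpace T hz.1) hz2]
  simp

lemma integrableOn_densityIntegrand {ρ : ℝ → Space d → ℝ} {n : ℝ → Space d → Space d}
    {φ : ℝ → Space d → ℝ} (hφ : IsTestFunction φ)
    (hρ : LocallyIntegrableOn (fun z : ℝ × Space d => ρ z.1 z.2) (halfSpace d))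
    (hn : LocallyIntegrableOn (fun z : ℝ × Space d => n z.1 z.2) (halfSpace d)) (T : ℝ) :
    IntegrableOn (fun z : ℝ × Space d => densityIntegrand ρ n φ z.1 z.2) (slab d T) := by
  obtain ⟨R, hR⟩ := hφ.exists_support
  have hD := continuousOn_spaceTimeDeriv hφ.1
  have e1 := integrableOn_slab_bilinear (ContinuousLinearMap.mul ℝ ℝ)
    (a := fun z => spaceTimeDeriv φ z (1, 0)) (R := R) T (hD.clm_apply continuousOn_const)
    (fun z hz hzR => by simp [(hR z hz hzR).2]) hρ
  have e2 := integrableOn_slab_bilinear (ContinuousLinearMap.mul ℝ ℝ)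
    (a := fun z => spaceTimeDeriv φ z (0, z.2)) (R := R) T (hD.clm_apply (by fun_prop))
    (fun z hz hzR => by simp [(hR z hz hzR).2]) hρ
  have e3 := integrableOn_slab_bilinear (ContinuousLinearMap.mul ℝ ℝ)
    (a := fun z => φ z.1 z.2) (R := R) T hφ.1.continuousOn
    (fun z hz hzR => (hR z hz hzR).1) hρ
  have e4 := integrableOn_slab_bilinear (ContinuousLinearMap.id ℝ (Space d →L[ℝ] ℝ))
    (a := fun z => (spaceTimeDeriv φ z).comp (ContinuousLinearMap.inr ℝ ℝ (Space d))) (R := R) T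
    (hD.clm_comp continuousOn_const) (fun z hz hzR => by simp [(hR z hz hzR).2]) hn
  have := (((e1.sub (e2.const_mul (1 / 2))).add e4).sub (e3.const_mul ((d : ℝ) / 2)))
  refine IntegrableOn.congr_fun this (fun z hz => ?_) (measurableSet_slab T)
  rw [densityIntegrand_eq, fderiv_space_apply hφ.1 hz.1.1, fderiv_space_apply hφ.1 hz.1.1,
    (hasDerivAt_time hφ.1 hz.1.1 z.2).deriv]
  simp only [Pi.sub_apply, Pi.add_apply, ContinuousLinearMap.mul_apply', Prod.mk.eta,
    ContinuousLinearMap.coe_id', id_eq, ContinuousLinearMap.comp_apply,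
    ContinuousLinearMap.inr_apply]
  ring

/-- All terms except the convective one pair a continuous compactly supported factor with a locally
integrable one. The convective term is dominated by |∇ψ| |n|²/ρ, and so by the kinetic energy. -/
lemma integrableOn_momentumIntegrand {α : ℝ} {p : ℝ → ℝ} {ρ : ℝ → Space d → ℝ}
    {n : ℝ → Space d → Space d} {ψ : ℝ → Space d → Space d} (hψ : IsTestFunction ψ)
    (hρ : LocallyIntegrableOn (fun z : ℝ × Space d => ρ z.1 z.2) (halfSpace d))
    (hn : LocallyIntegrableOn (fun z : ℝ × Space d => n z.1 z.2) (halfSpace d))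
    (hp : LocallyIntegrableOn (fun z : ℝ × Space d => p (ρ z.1 z.2)) (halfSpace d)) {T : ℝ}
    (hq : IntegrableOn (fun z : ℝ × Space d => ‖n z.1 z.2‖ ^ 2 / ρ z.1 z.2) (slab d T)) :
    IntegrableOn (fun z : ℝ × Space d => momentumIntegrand α p ρ n ψ z.1 z.2) (slab d T) := by
  obtain ⟨R, hR⟩ := hψ.exists_support
  have hD := continuousOn_spaceTimeDeriv hψ.1
  have hD2 : ContinuousOn (fun z => (spaceTimeDeriv ψ z).comp
      (ContinuousLinearMap.inr ℝ ℝ (Space d))) (halfSpace d) := hD.clm_comp continuousOn_const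
  have e1 : IntegrableOn (fun z : ℝ × Space d =>
      inner ℝ (spaceTimeDeriv ψ z (1, 0)) (n z.1 z.2)) (slab d T) := integrableOn_slab_bilinear (innerSL ℝ)
    (a := fun z => spaceTimeDeriv ψ z (1, 0)) (R := R) T (hD.clm_apply continuousOn_const)
    (fun z hz hzR => by simp [(hR z hz hzR).2]) hn
  have e2 : IntegrableOn (fun z : ℝ × Space d =>
      inner ℝ (spaceTimeDeriv ψ z (0, z.2)) (n z.1 z.2)) (slab d T) := integrableOn_slab_bilinear (innerSL ℝ)
    (a := fun z => spaceTimeDeriv ψ z (0, z.2)) (R := R) T (hD.clm_apply (by fun_prop))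
    (fun z hz hzR => by simp [(hR z hz hzR).2]) hn
  have e3 : IntegrableOn (fun z : ℝ × Space d =>
      inner ℝ (Real.exp (d * z.1) • ψ z.1 z.2) (n z.1 z.2)) (slab d T) := integrableOn_slab_bilinear (innerSL ℝ)
    (a := fun z => Real.exp (d * z.1) • ψ z.1 z.2) (R := R) T
    (ContinuousOn.smul (f := fun z : ℝ × Space d => Real.exp (d * z.1)) (by fun_prop) hψ.1.continuousOn)
    (fun z hz hzR => by simp [(hR z hz hzR).1]) hn
  have e4 := integrableOn_slab_bilinear (ContinuousLinearMap.mul ℝ ℝ)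
    (a := fun z => Real.exp (d * z.1) * traceCLM d ((spaceTimeDeriv ψ z).comp
      (ContinuousLinearMap.inr ℝ ℝ (Space d)))) (R := R) T
    (ContinuousOn.mul (f := fun z : ℝ × Space d => Real.exp (d * z.1)) (by fun_prop) ((traceCLM d).continuous.comp_continuousOn hD2))
    (fun z hz hzR => by simp [(hR z hz hzR).2]) hp
  have hnm : AEStronglyMeasurable (fun z : ℝ × Space d => n z.1 z.2)
      (volume.restrict (slab d T)) :=
    (hn.aestronglyMeasurable).mono_set (slab_subset_halfSpace T)
  have hρm : AEStronglyMeasurable (fun z : ℝ × Space d => ρ z.1 z.2)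
      (volume.restrict (slab d T)) :=
    (hρ.aestronglyMeasurable).mono_set (slab_subset_halfSpace T)
  have hDm : AEStronglyMeasurable (fun z => (spaceTimeDeriv ψ z).comp
      (ContinuousLinearMap.inr ℝ ℝ (Space d))) (volume.restrict (slab d T)) :=
    (hD2.mono (slab_subset_halfSpace T)).aestronglyMeasurable (measurableSet_slab T)
  have hbd : ∃ M : ℝ, ∀ z ∈ slab d T, ‖(spaceTimeDeriv ψ z).comp
      (ContinuousLinearMap.inr ℝ ℝ (Space d))‖ ≤ M := by
    obtain ⟨M, hM⟩ := (isCompact_Icc.prod (isCompact_closedBall (0 : Space d) R) :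
      IsCompact (Icc 0 T ×ˢ Metric.closedBall (0 : Space d) R)).exists_bound_of_continuousOn
      (hD2.mono (prod_mono (fun _ h => h.1) (subset_univ _)))
    refine ⟨max M 0, fun z hz => ?_⟩
    by_cases hz2 : ‖z.2‖ ≤ R
    · exact (hM z ⟨⟨hz.1.1.le, hz.1.2⟩, by simpa using hz2⟩).trans (le_max_left _ _)
    · rw [(hR z (slab_subset_halfSpace T hz) (not_le.1 hz2)).2]
      simp
  obtain ⟨M, hM⟩ := hbd
  have e5 : IntegrableOn (fun z : ℝ × Space d => (ρ z.1 z.2)⁻¹ *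
      inner ℝ ((spaceTimeDeriv ψ z).comp (ContinuousLinearMap.inr ℝ ℝ (Space d)) (n z.1 z.2))
        (n z.1 z.2)) (slab d T) := by
    refine Integrable.mono' (hq.norm.const_mul M) ?_ ?_
    · exact (hρm.aemeasurable.inv.aestronglyMeasurable).mul
        (((ContinuousLinearMap.id ℝ (Space d →L[ℝ] Space d)).aestronglyMeasurable_comp₂
          hDm hnm).inner hnm)
    · refine (ae_restrict_iff' (measurableSet_slab T)).2 (Eventually.of_forall fun z hz => ?_)
      rw [norm_mul, norm_div, norm_inv, norm_pow, norm_norm, div_eq_mul_inv, mul_comm ‖ρ z.1 z.2‖⁻¹,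
        ← mul_assoc]
      gcongr
      refine (norm_inner_le_norm _ _).trans ?_
      have := ((spaceTimeDeriv ψ z).comp
        (ContinuousLinearMap.inr ℝ ℝ (Space d))).le_opNorm (n z.1 z.2)
      nlinarith [hM z hz, norm_nonneg (n z.1 z.2), mul_le_mul_of_nonneg_right (hM z hz)
        (norm_nonneg (n z.1 z.2))]
  have := ((((e1.sub (e2.const_mul (1 / 2))).add e5).add e4).sub (e3.const_mul α))
  refine IntegrableOn.congr_fun this (fun z hz => ?_) (measurableSet_slab T)
  rw [momentumIntegrand_eq, (hasDerivAt_time hψ.1 hz.1.1 z.2).deriv,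
    fderiv_space_apply hψ.1 hz.1.1, fderiv_space_apply hψ.1 hz.1.1,
    (hasFDerivAt_space hψ.1 hz.1.1 z.2).fderiv]
  simp only [Pi.sub_apply, Pi.add_apply, ContinuousLinearMap.mul_apply', Prod.mk.eta,
    ContinuousLinearMap.comp_apply, real_inner_smul_left,
    ContinuousLinearMap.inr_apply]
  ring

end TestFunction

/-! ### The relative entropy density -/

section Entropy

variable {d : ℕ} {p h : ℝ → ℝ}

/-- The relative entropy density of a state with finite density. -/
def relEntropyReal (h : ℝ → ℝ) (τ r : ℝ) (v : Space d) (s : ℝ) (w : Space d) : ℝ :=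
  1 / 2 * Real.exp (-(d * τ)) * r * ‖r⁻¹ • v - s⁻¹ • w‖ ^ 2 + relPot h r s

/-- The states with finite relative entropy density. -/
def IsState (r : ℝ) (v : Space d) : Prop := 0 ≤ r ∧ (r = 0 → v = 0)

/-- In vacuum the quotient v/r is 0 by convention, so that v = r(v/r) requires v = 0 there. -/
lemma IsState.smul_inv_smul {r : ℝ} {v : Space d} (hv : IsState r v) : r • r⁻¹ • v = v := by
  by_cases hr : r = 0
  · simp [hr, hv.2 hr]
  · rw [smul_inv_smul₀ hr]

lemma relEntropyDensity_of_isState {τ r : ℝ} {v : Space d} (hv : IsState r v) (s : ℝ)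
    (w : Space d) : relEntropyDensity h τ r v s w = ENNReal.ofReal (relEntropyReal h τ r v s w) := by
  rw [relEntropyDensity, if_neg, relEntropyReal]
  rintro (hr | ⟨hr, hv'⟩)
  exacts [hr.not_ge hv.1, hv' (hv.2 hr)]

lemma isState_of_density_ne_top {τ r s : ℝ} {v w : Space d}
    (ht : relEntropyDensity h τ r v s w ≠ ⊤) : IsState r v := by
  by_contra hn
  refine ht (if_pos ?_)
  by_cases hr : 0 ≤ r
  · right
    simpa [IsState, hr] using hn
  · exact Or.inl (not_le.1 hr)

lemma relEntropyReal_nonneg (hp : IsPressure p) (hh : IsPotential p h) {τ r s : ℝ}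
    {v : Space d} (hr : 0 ≤ r) (hs : HasPotDeriv h s) (w : Space d) :
    0 ≤ relEntropyReal h τ r v s w :=
  add_nonneg (by positivity) (relPot_nonneg hp hh hr hs)

/-- Measurability of h and h' is available on [0,∞) only. Truncating their arguments at 0 changes
nothing: for r < 0 the density is ⊤ anyway, and s is nonnegative almost everywhere. -/
lemma aemeasurable_relEntropyDensity (hp : IsPressure p) (hh : IsPotential p h) {X : Type*}
    [MeasurableSpace X] {ν : Measure X} {t r s : X → ℝ} {v w : X → Space d}
    (ht : AEMeasurable t ν) (hr : AEMeasurable r ν) (hv : AEMeasurable v ν)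
    (hs : AEMeasurable s ν) (hw : AEMeasurable w ν) (hs0 : ∀ᵐ x ∂ν, 0 ≤ s x) :
    AEMeasurable (fun x => relEntropyDensity h (t x) (r x) (v x) (s x) (w x)) ν := by
  classical
  let G : ℝ × ℝ × Space d × ℝ × Space d → ℝ≥0∞ := fun q =>
    if q.2.1 < 0 ∨ (q.2.1 = 0 ∧ q.2.2.1 ≠ 0) then ⊤ else ENNReal.ofReal
      (1 / 2 * Real.exp (-(d * q.1)) * q.2.1 * ‖q.2.1⁻¹ • q.2.2.1 - q.2.2.2.1⁻¹ • q.2.2.2.2‖ ^ 2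
        + (h (max q.2.1 0) - h (max q.2.2.2.1 0)
          - potDeriv h (max q.2.2.2.1 0) * (q.2.1 - q.2.2.2.1)))
  have hG : Measurable G := by
    refine Measurable.ite ?_ measurable_const (ENNReal.measurable_ofReal.comp ?_)
    · have q1 : Measurable fun q : ℝ × ℝ × Space d × ℝ × Space d => q.2.1 := by fun_prop
      have q2 : Measurable fun q : ℝ × ℝ × Space d × ℝ × Space d => q.2.2.1 := by fun_prop
      exact (measurableSet_lt q1 measurable_const).union
        ((measurableSet_eq_fun q1 measurable_const).inter
          (measurableSet_eq_fun q2 measurable_const).compl)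
    · have h1 := measurable_potential_max hh
      have h2 := measurable_potDeriv_max hp hh
      refine Measurable.add (by fun_prop) (Measurable.sub (Measurable.sub ?_ ?_)
        (Measurable.mul ?_ (by fun_prop)))
      · exact h1.comp (by fun_prop : Measurable fun q : ℝ × ℝ × Space d × ℝ × Space d => q.2.1)
      · exact h1.comp (by fun_prop : Measurable fun q : ℝ × ℝ × Space d × ℝ × Space d => q.2.2.2.1)
      · exact h2.comp (by fun_prop : Measurable fun q : ℝ × ℝ × Space d × ℝ × Space d => q.2.2.2.1)
  refine (hG.comp_aemeasurable (ht.prodMk (hr.prodMk (hv.prodMk (hs.prodMk hw))))).congr ?_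
  filter_upwards [hs0] with x hx
  simp only [Function.comp_apply, G, relEntropyDensity, relPot, max_eq_left hx]
  split_ifs with hc
  · rfl
  · have : 0 ≤ r x := not_lt.1 fun hlt => hc (Or.inl hlt)
    rw [max_eq_left this]

lemma relEntropyReal_eq_of_zero {τ r s : ℝ} {v : Space d} :
    relEntropyReal h τ r v s 0 = 1 / 2 * Real.exp (-(d * τ)) * (‖v‖ ^ 2 / r) + relPot h r s := by
  rw [relEntropyReal, smul_zero, sub_zero, norm_smul, mul_pow, norm_inv, inv_pow, Real.norm_eq_abs,
    sq_abs]
  congr 1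
  by_cases hr : r = 0
  · simp [hr]
  · field_simp

/-- Integrability of the relative entropy density with respect to a general measure. -/
lemma state_and_integrable_of_lintegral_ne_top (hp : IsPressure p) (hh : IsPotential p h)
    {X : Type*} [MeasurableSpace X] {ν : Measure X} {t r s : X → ℝ} {v w : X → Space d}
    (ht : AEMeasurable t ν) (hr : AEMeasurable r ν) (hv : AEMeasurable v ν)
    (hs : AEMeasurable s ν) (hw : AEMeasurable w ν) (hs0 : ∀ᵐ x ∂ν, HasPotDeriv h (s x))
    (hfin : ∫⁻ x, relEntropyDensity h (t x) (r x) (v x) (s x) (w x) ∂ν ≠ ⊤) :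
    (∀ᵐ x ∂ν, IsState (r x) (v x)) ∧
      Integrable (fun x => relEntropyReal h (t x) (r x) (v x) (s x) (w x)) ν ∧
      (∫⁻ x, relEntropyDensity h (t x) (r x) (v x) (s x) (w x) ∂ν).toReal =
        ∫ x, relEntropyReal h (t x) (r x) (v x) (s x) (w x) ∂ν := by
  have hm := aemeasurable_relEntropyDensity hp hh ht hr hv hs hw (hs0.mono fun x hx => hx.nonneg)
  have hst : ∀ᵐ x ∂ν, IsState (r x) (v x) := by
    filter_upwards [ae_lt_top' hm hfin] with x hx using isState_of_density_ne_top hx.ne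
  have hr0 : ∀ᵐ x ∂ν, 0 ≤ r x := hst.mono fun x hx => hx.1
  have heq : (fun x => relEntropyReal h (t x) (r x) (v x) (s x) (w x)) =ᵐ[ν]
      fun x => (relEntropyDensity h (t x) (r x) (v x) (s x) (w x)).toReal := by
    filter_upwards [hst, hs0] with x hx hx'
    rw [relEntropyDensity_of_isState hx, ENNReal.toReal_ofReal
      (relEntropyReal_nonneg hp hh hx.1 hx' _)]
  refine ⟨hst, (integrable_toReal_of_lintegral_ne_top hm hfin).congr heq.symm, ?_⟩
  rw [integral_congr_ae heq, integral_toReal hm]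
  filter_upwards [hst] with x hx
  rw [relEntropyDensity_of_isState hx]
  exact ENNReal.ofReal_lt_top

lemma lintegral_density_of_integrable (hp : IsPressure p) (hh : IsPotential p h)
    {X : Type*} [MeasurableSpace X] {ν : Measure X} {t r s : X → ℝ} {v w : X → Space d}
    (hst : ∀ᵐ x ∂ν, IsState (r x) (v x)) (hs0 : ∀ᵐ x ∂ν, HasPotDeriv h (s x))
    (hint : Integrable (fun x => relEntropyReal h (t x) (r x) (v x) (s x) (w x)) ν) :
    ∫⁻ x, relEntropyDensity h (t x) (r x) (v x) (s x) (w x) ∂ν =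
        ENNReal.ofReal (∫ x, relEntropyReal h (t x) (r x) (v x) (s x) (w x) ∂ν) := by
  rw [ofReal_integral_eq_lintegral_ofReal hint]
  · refine lintegral_congr_ae ?_
    filter_upwards [hst] with x hx using relEntropyDensity_of_isState hx _ _
  · filter_upwards [hst, hs0] with x hx hx' using relEntropyReal_nonneg hp hh hx.1 hx' _

end Entropy

/-! ### Cutoff functions and integration by parts -/

/-- A sequence of cutoff functions. -/
structure IsCutoffSequence {d : ℕ} (C : ℝ) (χ : ℕ → Space d → ℝ) : Prop where
  contDiff : ∀ j, ContDiff ℝ 1 (χ j)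
  hasCompactSupport : ∀ j, HasCompactSupport (χ j)
  nonneg : ∀ (j : ℕ) (y : Space d), 0 ≤ χ j y
  le_one : ∀ (j : ℕ) (y : Space d), χ j y ≤ 1
  eq_one : ∀ (j : ℕ) (y : Space d), ‖y‖ ≤ j → χ j y = 1
  fderiv_eq_zero : ∀ (j : ℕ) (y : Space d), ‖y‖ ≤ j → fderiv ℝ (χ j) y = 0
  norm_fderiv_le : ∀ (j : ℕ) (y : Space d), ‖fderiv ℝ (χ j) y‖ ≤ C / (j + 1)
  norm_fderiv_mul_le : ∀ (j : ℕ) (y : Space d), ‖fderiv ℝ (χ j) y‖ * (1 + ‖y‖) ≤ C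

/-- These are the dilations χ_j(y) = g(y/(j+1)) of one bump function g. On the support 1 + |y| ≤
3(j+1), while |∇χ_j| ≤ M/(j+1); so |∇χ_j|(1+|y|) is bounded by 3M, and the unbounded drift y/2 does
no harm. -/
lemma exists_cutoffSequence (d : ℕ) :
    ∃ C : ℝ, 0 ≤ C ∧ ∃ χ : ℕ → Space d → ℝ, IsCutoffSequence C χ := by
  let g : ContDiffBump (0 : Space d) := ⟨1, 2, one_pos, one_lt_two⟩
  have hg : ContDiff ℝ 1 g := g.contDiff
  have hgc : HasCompactSupport g := g.hasCompactSupport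
  obtain ⟨M, hM⟩ := (hgc.fderiv (𝕜 := ℝ)).exists_bound_of_continuous
    (hg.continuous_fderiv one_ne_zero)
  have hM0 : 0 ≤ M := (norm_nonneg _).trans (hM 0)
  have hfd : ∀ (j : ℕ) (y : Space d), fderiv ℝ (fun y => g (((j : ℝ) + 1)⁻¹ • y)) y
      = ((j : ℝ) + 1)⁻¹ • fderiv ℝ g (((j : ℝ) + 1)⁻¹ • y) := by
    intro j y
    have h1 : HasFDerivAt (fun y : Space d => ((j : ℝ) + 1)⁻¹ • y)
        (((j : ℝ) + 1)⁻¹ • ContinuousLinearMap.id ℝ (Space d)) y :=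
      (((j : ℝ) + 1)⁻¹ • ContinuousLinearMap.id ℝ (Space d)).hasFDerivAt
    have h2 := ((hg.differentiable one_ne_zero) (((j : ℝ) + 1)⁻¹ • y)).hasFDerivAt.comp y h1
    rw [show (fun y => g (((j : ℝ) + 1)⁻¹ • y)) = g ∘ fun y => ((j : ℝ) + 1)⁻¹ • y from rfl,
      h2.fderiv]
    ext v
    simp
  have hnorm : ∀ (j : ℕ) (y : Space d), ‖((j : ℝ) + 1)⁻¹ • y‖ = ‖y‖ / (j + 1) := by
    intro j y
    rw [norm_smul, norm_inv, Real.norm_eq_abs, abs_of_pos (by positivity), inv_mul_eq_div]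
  have hlt : ∀ (j : ℕ) (y : Space d), ‖y‖ ≤ j → ((j : ℝ) + 1)⁻¹ • y ∈ Metric.ball (0 : Space d) 1 := by
    intro j y hy
    rw [mem_ball_zero_iff, hnorm, div_lt_one (by positivity)]
    linarith
  have hle : ∀ (j : ℕ) (y : Space d), ‖fderiv ℝ (fun y => g (((j : ℝ) + 1)⁻¹ • y)) y‖
      ≤ M / (j + 1) := by
    intro j y
    rw [hfd, norm_smul, norm_inv, Real.norm_eq_abs, abs_of_pos (by positivity), inv_mul_eq_div]
    gcongr
    exact hM _
  refine ⟨3 * M, by positivity, fun j y => g (((j : ℝ) + 1)⁻¹ • y), ⟨?_, ?_, ?_, ?_, ?_, ?_, ?_, ?_⟩⟩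
  · intro j
    exact hg.comp (contDiff_const_smul _)
  · intro j
    exact hgc.comp_smul (by positivity)
  · exact fun j y => g.nonneg
  · exact fun j y => g.le_one
  · exact fun j y hy => g.one_of_mem_closedBall (Metric.ball_subset_closedBall (hlt j y hy))
  · intro j y hy
    rw [hfd]
    have : g =ᶠ[𝓝 (((j : ℝ) + 1)⁻¹ • y)] fun _ => (1 : ℝ) := by
      filter_upwards [Metric.isOpen_ball.mem_nhds (hlt j y hy)] with x hx
      exact g.one_of_mem_closedBall (Metric.ball_subset_closedBall hx)
    rw [this.fderiv_eq]
    simp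
  · intro j y
    refine (hle j y).trans ?_
    gcongr
    linarith
  · intro j y
    by_cases hy : ‖y‖ ≤ 2 * (j + 1)
    · have hj : (0 : ℝ) < j + 1 := by positivity
      calc _ ≤ M / (j + 1) * (3 * (j + 1)) := by
            refine mul_le_mul (hle j y) ?_ (by positivity) (by positivity)
            linarith [(Nat.cast_nonneg j : (0 : ℝ) ≤ j)]
        _ = 3 * M := by field_simp
    · have h0 : fderiv ℝ (fun y => g (((j : ℝ) + 1)⁻¹ • y)) y = 0 := by
        rw [hfd]
        have h1 : ((j : ℝ) + 1)⁻¹ • y ∉ tsupport g := by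
          rw [g.tsupport_eq, mem_closedBall_zero_iff, hnorm, div_le_iff₀ (by positivity)]
          exact hy
        have h2 := fun hmem => h1 (tsupport_fderiv_subset (𝕜 := ℝ) (f := g) hmem)
        rw [image_eq_zero_of_notMem_tsupport h2, smul_zero]
      rw [h0]
      simp only [norm_zero, zero_mul]
      positivity

/-- The integrand is div(χV), and χV has compact support. -/
lemma integral_divergence_add_eq_zero {d : ℕ} {χ : Space d → ℝ} {V : Space d → Space d}
    (hχ : ContDiff ℝ 1 χ) (hχc : HasCompactSupport χ) (hV : ContDiff ℝ 1 V) :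
    ∫ y, (χ y * traceCLM d (fderiv ℝ V y) + fderiv ℝ χ y (V y)) = 0 := by
  have hχ' := hχ.continuous_fderiv one_ne_zero
  have hV' := hV.continuous_fderiv one_ne_zero
  have hVc := hV.continuous
  have hχc' := hχ.continuous
  let e : Fin d → Space d := fun j => EuclideanSpace.single j 1
  have h1 : ∀ j : Fin d, ∀ y, fderiv ℝ (fun x => V x j) y (e j) = fderiv ℝ V y (e j) j := by
    intro j y
    have := ((EuclideanSpace.proj j : Space d →L[ℝ] ℝ).hasFDerivAt (x := V y)).comp y
      ((hV.differentiable one_ne_zero) y).hasFDerivAt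
    rw [show (fun x => V x j) = (EuclideanSpace.proj j : Space d →L[ℝ] ℝ) ∘ V from rfl, this.fderiv]
    simp
  have hcs1 : ∀ j, HasCompactSupport fun y => fderiv ℝ χ y (e j) * V y j := fun j =>
    ((hχc.fderiv_apply (𝕜 := ℝ) (e j)).mul_right)
  have hcs2 : ∀ j, HasCompactSupport fun y => χ y * fderiv ℝ V y (e j) j := fun j => hχc.mul_right
  have i1 : ∀ j, Integrable fun y => fderiv ℝ χ y (e j) * V y j := fun j =>
    (by fun_prop : Continuous fun y => fderiv ℝ χ y (e j) * V y j).integrable_of_hasCompactSupport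
      (hcs1 j)
  have i2 : ∀ j, Integrable fun y => χ y * fderiv ℝ V y (e j) j := fun j =>
    (by fun_prop : Continuous fun y => χ y * fderiv ℝ V y (e j) j).integrable_of_hasCompactSupport
      (hcs2 j)
  have h2 : ∀ j, ∫ y, (χ y * fderiv ℝ V y (e j) j + fderiv ℝ χ y (e j) * V y j) = 0 := by
    intro j
    have := integral_mul_fderiv_eq_neg_fderiv_mul_of_integrable (μ := volume) (f := χ)
      (g := fun x => V x j) (v := e j) (i1 j) (by simpa only [h1] using i2 j)
      ((by fun_prop : Continuous fun y => χ y * V y j).integrable_of_hasCompactSupport hχc.mul_right)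
      (fun y _ => (hχ.differentiable one_ne_zero) y)
      (fun y _ => ((EuclideanSpace.proj j : Space d →L[ℝ] ℝ).differentiableAt.comp y
        ((hV.differentiable one_ne_zero) y)))
    rw [integral_add (i2 j) (i1 j)]
    simp only [h1] at this
    linarith
  have h3 : ∀ y, χ y * traceCLM d (fderiv ℝ V y) + fderiv ℝ χ y (V y)
      = ∑ j, (χ y * fderiv ℝ V y (e j) j + fderiv ℝ χ y (e j) * V y j) := by
    intro y
    conv_lhs => rw [← divergence_eq_traceCLM, ← sum_smul_single (V y), map_sum]
    simp only [divergence, Finset.mul_sum, Finset.sum_add_distrib, map_smul, smul_eq_mul, e,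
      mul_comm]
  simp only [h3]
  rw [integral_finsetSum Finset.univ (f := fun j y => χ y * fderiv ℝ V y (e j) j
    + fderiv ℝ χ y (e j) * V y j) fun j _ => (i2 j).add (i1 j)]
  exact Finset.sum_eq_zero fun j _ => h2 j

lemma traceCLM_smulRight {d : ℕ} (L : Space d →L[ℝ] ℝ) (v : Space d) :
    traceCLM d (L.smulRight v) = L v := by
  conv_rhs => rw [← sum_smul_single v, map_sum]
  simp [traceCLM, mul_comm]

lemma traceCLM_id (d : ℕ) : traceCLM d (ContinuousLinearMap.id ℝ (Space d)) = d := by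
  simp [traceCLM]

/-! ### The reference density -/

section Reference

variable {d : ℕ} {p h : ℝ → ℝ} {ρhat : Space d → ℝ} {ρinf : ℝ → Space d → ℝ}

lemma IsReferenceDensity.hasPotDeriv (href : IsReferenceDensity h ρhat ρinf) {τ : ℝ}
    (hτ : 0 ≤ τ) (y : Space d) : HasPotDeriv h (ρinf τ y) := by
  rcases (href.nonneg τ hτ y).eq_or_lt with h0 | h0
  · exact Or.inr ⟨h0.symm, href.differentiable_of_eq_zero τ hτ y h0.symm⟩
  · exact Or.inl h0

/-- In the differential of sh'(s) - h(s) the two terms h'(s) ds cancel, which leaves s d(h'(s)).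
Hence h' is never differentiated with respect to s, and the formula holds in vacuum as soon as
h'(ρ∞) is C¹. -/
lemma IsReferenceDensity.hasFDerivWithinAt_potPressure (hh : IsPotential p h)
    (href : IsReferenceDensity h ρhat ρinf) {z : ℝ × Space d} (hz : z ∈ halfSpace d) :
    HasFDerivWithinAt (fun z : ℝ × Space d => potPressure h (ρinf z.1 z.2))
      (ρinf z.1 z.2 • spaceTimeDeriv (fun s y => potDeriv h (ρinf s y)) z) (halfSpace d) z := by
  have h1 : HasFDerivWithinAt (fun z : ℝ × Space d => ρinf z.1 z.2) (spaceTimeDeriv ρinf z)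
      (halfSpace d) z :=
    ((href.contDiffOn.differentiableOn one_ne_zero) z hz).hasFDerivWithinAt
  have h2 : HasFDerivWithinAt (fun z : ℝ × Space d => potDeriv h (ρinf z.1 z.2))
      (spaceTimeDeriv (fun s y => potDeriv h (ρinf s y)) z) (halfSpace d) z :=
    ((href.contDiffOn_potDeriv.differentiableOn one_ne_zero) z hz).hasFDerivWithinAt
  have h3 := (hasDerivWithinAt_potential hh
    (href.hasPotDeriv hz.1 z.2)).comp_hasFDerivWithinAt z h1
    (fun x hx => href.nonneg x.1 hx.1 x.2)
  refine ((h1.mul h2).sub h3).congr_fderiv ?_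
  refine ContinuousLinearMap.ext fun v => ?_
  simp only [sub_apply, add_apply,
    smul_apply, smul_eq_mul]
  ring

lemma IsReferenceDensity.contDiffOn_potPressure (hh : IsPotential p h)
    (href : IsReferenceDensity h ρhat ρinf) :
    ContDiffOn ℝ 1 (fun z : ℝ × Space d => potPressure h (ρinf z.1 z.2)) (halfSpace d) := by
  have h0 : (1 : WithTop ℕ∞) = 0 + 1 := by simp
  rw [h0, contDiffOn_succ_iff_hasFDerivWithinAt_of_uniqueDiffOn uniqueDiffOn_halfSpace]
  refine ⟨by simp, fun z => ρinf z.1 z.2 • spaceTimeDeriv (fun s y => potDeriv h (ρinf s y)) z, ?_,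
    fun z hz => href.hasFDerivWithinAt_potPressure hh hz⟩
  rw [contDiffOn_zero]
  exact href.contDiffOn.continuousOn.smul (continuousOn_spaceTimeDeriv href.contDiffOn_potDeriv)

end Reference

/-! ### The explicit part of the space-time integral -/

lemma volume_restrict_slab {d : ℕ} (σ τ : ℝ) :
    (volume : Measure (ℝ × Space d)).restrict (Ioc σ τ ×ˢ univ) =
      (volume.restrict (Ioc σ τ)).prod volume := by
  rw [Measure.volume_eq_prod, ← Measure.prod_restrict, Measure.restrict_univ]

lemma intervalIntegral_eq_slab {d : ℕ} {F : ℝ → Space d → ℝ} {σ τ : ℝ} (hστ : σ ≤ τ)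
    (hF : IntegrableOn (fun z : ℝ × Space d => F z.1 z.2) (Ioc σ τ ×ˢ univ)) :
    ∫ s in σ..τ, ∫ y, F s y = ∫ z in Ioc σ τ ×ˢ (univ : Set (Space d)), F z.1 z.2 := by
  rw [intervalIntegral.integral_of_le hστ, volume_restrict_slab, integral_prod]
  rwa [IntegrableOn, volume_restrict_slab] at hF

lemma slab_Ioc_subset {d : ℕ} {σ τ T : ℝ} (hσ : 0 ≤ σ) (hT : τ ≤ T) :
    Ioc σ τ ×ˢ (univ : Set (Space d)) ⊆ slab d T :=
  prod_mono (Ioc_subset_Ioc hσ hT) le_rfl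

lemma integrableOn_slab_of_continuousOn {d : ℕ} {a : ℝ × Space d → ℝ} {R : ℝ} (T : ℝ)
    (ha : ContinuousOn a (halfSpace d)) (ha0 : ∀ z ∈ halfSpace d, R < ‖z.2‖ → a z = 0) :
    IntegrableOn a (slab d T) := by
  have := integrableOn_slab_bilinear (ContinuousLinearMap.mul ℝ ℝ) (g := fun _ => (1 : ℝ)) T ha ha0
    ((locallyIntegrable_const 1).locallyIntegrableOn _)
  simpa using this

section Exact

variable {d : ℕ} {f : ℝ → Space d → ℝ} {χ : Space d → ℝ} {V : Space d → Space d}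

lemma exists_support_of_hasCompactSupport (hχc : HasCompactSupport χ) :
    ∃ R : ℝ, ∀ y, R < ‖y‖ → χ y = 0 ∧ fderiv ℝ χ y = 0 := by
  obtain ⟨R, hR⟩ := hχc.isCompact.isBounded.subset_closedBall (0 : Space d)
  refine ⟨R, fun y hy => ?_⟩
  have h1 : y ∉ tsupport χ := fun hmem => by
    have := hR hmem
    rw [mem_closedBall_zero_iff] at this
    linarith
  exact ⟨image_eq_zero_of_notMem_tsupport h1, image_eq_zero_of_notMem_tsupport
    fun hmem => h1 (tsupport_fderiv_subset ℝ hmem)⟩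

lemma continuousOn_explicit
    (hf : ContDiffOn ℝ 1 (fun z : ℝ × Space d => f z.1 z.2) (halfSpace d))
    (hχ : ContDiff ℝ 1 χ) (hV : ContDiff ℝ 1 V) :
    ContinuousOn (fun z : ℝ × Space d => χ z.2 * (-spaceTimeDeriv f z (1, 0)
      + 1 / 2 * spaceTimeDeriv f z (0, z.2) + d / 2 * f z.1 z.2
      + traceCLM d (fderiv ℝ V z.2))) (halfSpace d) ∧
    ContinuousOn (fun z : ℝ × Space d => χ z.2 * spaceTimeDeriv f z (1, 0)) (halfSpace d) ∧
    ContinuousOn (fun z : ℝ × Space d => χ z.2 * (1 / 2 * spaceTimeDeriv f z (0, z.2)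
      + d / 2 * f z.1 z.2 + traceCLM d (fderiv ℝ V z.2))) (halfSpace d) ∧
    ContinuousOn (fun z : ℝ × Space d =>
      fderiv ℝ χ z.2 ((1 / 2 * f z.1 z.2) • z.2 + V z.2)) (halfSpace d) := by
  have h1 := continuousOn_spaceTimeDeriv hf
  have h2 : ContinuousOn (fun z : ℝ × Space d => spaceTimeDeriv f z (1, 0)) (halfSpace d) :=
    h1.clm_apply continuousOn_const
  have h3 : ContinuousOn (fun z : ℝ × Space d => spaceTimeDeriv f z (0, z.2)) (halfSpace d) :=
    h1.clm_apply (by fun_prop)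
  have h4 := hf.continuousOn
  have hχ' := hχ.continuous_fderiv one_ne_zero
  have hV' := hV.continuous_fderiv one_ne_zero
  have h5 : ContinuousOn (fun z : ℝ × Space d => χ z.2) (halfSpace d) :=
    (hχ.continuous.comp continuous_snd).continuousOn
  have h6 : ContinuousOn (fun z : ℝ × Space d => V z.2) (halfSpace d) :=
    (hV.continuous.comp continuous_snd).continuousOn
  have h7 : ContinuousOn (fun z : ℝ × Space d => fderiv ℝ χ z.2) (halfSpace d) :=
    (hχ'.comp continuous_snd).continuousOn
  have h8 : ContinuousOn (fun z : ℝ × Space d => traceCLM d (fderiv ℝ V z.2)) (halfSpace d) :=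
    ((traceCLM d).continuous.comp (hV'.comp continuous_snd)).continuousOn
  exact ⟨h5.mul (((h2.neg.add (continuousOn_const.mul h3)).add (continuousOn_const.mul h4)).add h8),
    h5.mul h2, h5.mul (((continuousOn_const.mul h3).add (continuousOn_const.mul h4)).add h8),
    h7.clm_apply (((continuousOn_const.mul h4).smul continuousOn_snd).add h6)⟩

/-- Since ½y·∇f + (d/2)f = div(½fy), the integrand is χ times a divergence in space and time: the
fundamental theorem of calculus handles the time derivative, integration by parts the rest. It is
applied to f = π(ρ∞) - π(ρ*) and V = π(ρ*)u* with π = `potPressure h`. -/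
lemma integral_explicit
    (hf : ContDiffOn ℝ 1 (fun z : ℝ × Space d => f z.1 z.2) (halfSpace d))
    (hχ : ContDiff ℝ 1 χ) (hχc : HasCompactSupport χ) (hV : ContDiff ℝ 1 V) {σ τ : ℝ}
    (hσ : 0 ≤ σ) (hστ : σ ≤ τ) :
    IntegrableOn (fun z : ℝ × Space d => χ z.2 * (-spaceTimeDeriv f z (1, 0)
        + 1 / 2 * spaceTimeDeriv f z (0, z.2) + d / 2 * f z.1 z.2
        + traceCLM d (fderiv ℝ V z.2))) (Ioc σ τ ×ˢ univ) ∧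
    IntegrableOn (fun z : ℝ × Space d => fderiv ℝ χ z.2 ((1 / 2 * f z.1 z.2) • z.2 + V z.2))
      (Ioc σ τ ×ˢ univ) ∧
    ∫ z in Ioc σ τ ×ˢ (univ : Set (Space d)), χ z.2 * (-spaceTimeDeriv f z (1, 0)
        + 1 / 2 * spaceTimeDeriv f z (0, z.2) + d / 2 * f z.1 z.2
        + traceCLM d (fderiv ℝ V z.2)) =
      -((∫ y, χ y * f τ y) - ∫ y, χ y * f σ y)
      - ∫ z in Ioc σ τ ×ˢ (univ : Set (Space d)),
          fderiv ℝ χ z.2 ((1 / 2 * f z.1 z.2) • z.2 + V z.2) := by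
  obtain ⟨R, hR⟩ := exists_support_of_hasCompactSupport hχc
  obtain ⟨c1, c2, c3, c4⟩ := continuousOn_explicit hf hχ hV
  have hsub : Ioc σ τ ×ˢ (univ : Set (Space d)) ⊆ slab d τ := slab_Ioc_subset hσ le_rfl
  have i1 := (integrableOn_slab_of_continuousOn (R := R) τ c1 fun z _ hz => by
    rw [(hR _ hz).1, zero_mul]).mono_set hsub
  have i2 := (integrableOn_slab_of_continuousOn (R := R) τ c2 fun z _ hz => by
    rw [(hR _ hz).1, zero_mul]).mono_set hsub
  have i3 := (integrableOn_slab_of_continuousOn (R := R) τ c3 fun z _ hz => by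
    rw [(hR _ hz).1, zero_mul]).mono_set hsub
  have i4 := (integrableOn_slab_of_continuousOn (R := R) τ c4 fun z _ hz => by
    rw [(hR _ hz).2]; simp).mono_set hsub
  refine ⟨i1, i4, ?_⟩
  have e1 : ∫ z in Ioc σ τ ×ˢ (univ : Set (Space d)), χ z.2 * spaceTimeDeriv f z (1, 0)
      = (∫ y, χ y * f τ y) - ∫ y, χ y * f σ y := by
    have hi : ∀ s, 0 ≤ s → Integrable fun y => χ y * f s y := fun s hs =>
      (hχ.continuous.mul (contDiff_slice hf hs).continuous).integrable_of_hasCompactSupport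
        hχc.mul_right
    rw [volume_restrict_slab, integral_prod_symm, ← integral_sub (hi τ (hσ.trans hστ)) (hi σ hσ)]
    · refine integral_congr_ae (Eventually.of_forall fun y => ?_)
      simp only
      rw [integral_const_mul, ← mul_sub, ← intervalIntegral.integral_of_le hστ]
      congr 1
      refine intervalIntegral.integral_eq_sub_of_hasDerivAt_of_le hστ ?_
        (fun s hs => hasDerivAt_time hf (hσ.trans_lt hs.1) y) ?_
      · exact hf.continuousOn.comp (f := fun s : ℝ => (s, y)) (by fun_prop)
          fun s hs => ⟨hσ.trans hs.1, trivial⟩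
      · refine ContinuousOn.intervalIntegrable ?_
        rw [uIcc_of_le hστ]
        exact ((continuousOn_spaceTimeDeriv hf).comp (f := fun s : ℝ => (s, y)) (by fun_prop)
          fun s hs => ⟨hσ.trans hs.1, trivial⟩).clm_apply continuousOn_const
    · rwa [IntegrableOn, volume_restrict_slab] at i2
  have e2 : ∫ z in Ioc σ τ ×ˢ (univ : Set (Space d)), (χ z.2 * (1 / 2 * spaceTimeDeriv f z (0, z.2)
      + d / 2 * f z.1 z.2 + traceCLM d (fderiv ℝ V z.2))
      + fderiv ℝ χ z.2 ((1 / 2 * f z.1 z.2) • z.2 + V z.2)) = 0 := by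
    rw [volume_restrict_slab, integral_prod]
    · refine (integral_congr_ae ((ae_restrict_iff' measurableSet_Ioc).2
        (Eventually.of_forall fun s hs => ?_))).trans (integral_zero _ _)
      have hs0 : 0 < s := hσ.trans_lt hs.1
      have hfs := contDiff_slice hf hs0.le
      have hW : ContDiff ℝ 1 fun y => (1 / 2 * f s y) • y + V y :=
        ((contDiff_const.mul hfs).smul contDiff_id).add hV
      refine Eq.trans ?_ (integral_divergence_add_eq_zero hχ hχc hW)
      refine integral_congr_ae (Eventually.of_forall fun y => ?_)
      simp only
      congr 2
      have d1 : HasFDerivAt (fun y => (1 / 2 * f s y) • y + V y) _ y :=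
        ((((hasFDerivAt_space hf hs0 y).const_mul (1 / 2)).smul (hasFDerivAt_id y))).add
          ((hV.differentiable one_ne_zero) y).hasFDerivAt
      rw [d1.fderiv]
      simp only [map_add, map_smul, traceCLM_smulRight, traceCLM_id, smul_eq_mul, id]
      simp
      ring
    · rw [← volume_restrict_slab]
      exact i3.add i4
  rw [integral_add i3 i4] at e2
  have e3 : ∫ z in Ioc σ τ ×ˢ (univ : Set (Space d)), χ z.2 * (-spaceTimeDeriv f z (1, 0)
        + 1 / 2 * spaceTimeDeriv f z (0, z.2) + d / 2 * f z.1 z.2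
        + traceCLM d (fderiv ℝ V z.2)) = (∫ z in Ioc σ τ ×ˢ (univ : Set (Space d)),
          χ z.2 * (1 / 2 * spaceTimeDeriv f z (0, z.2)
        + d / 2 * f z.1 z.2 + traceCLM d (fderiv ℝ V z.2)))
        - ∫ z in Ioc σ τ ×ˢ (univ : Set (Space d)), χ z.2 * spaceTimeDeriv f z (1, 0) := by
    rw [← integral_sub i3 i2]
    refine integral_congr_ae (Eventually.of_forall fun z => ?_)
    simp only
    ring
  rw [e3, e1]
  linarith

end Exact

/-! ### Test functions generated by a profile -/

section Profile

variable {d : ℕ}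

/-- The velocity `w / s` of a profile. -/
def profileVelocity (ρs : Space d → ℝ) (ns : Space d → Space d) (y : Space d) : Space d :=
  (ρs y)⁻¹ • ns y

/-- The variation `h'(ρ∞) - h'(ρ*) + (1/2) e^{-dτ} |u*|²` of the relative entropies with respect
to the density. -/
def densityVariation (h : ℝ → ℝ) (ρinf : ℝ → Space d → ℝ) (ρs : Space d → ℝ)
    (ns : Space d → Space d) (τ : ℝ) (y : Space d) : ℝ :=
  potDeriv h (ρinf τ y) - potDeriv h (ρs y)
    + 1 / 2 * Real.exp (-(d * τ)) * ‖profileVelocity ρs ns y‖ ^ 2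

/-- A smooth cutoff function in time with value `1` up to `T + 1`. -/
def timeCutoff (T τ : ℝ) : ℝ := Real.smoothTransition (T + 2 - τ)

lemma timeCutoff_eq_one {T τ : ℝ} (h : τ ≤ T + 1) : timeCutoff T τ = 1 :=
  Real.smoothTransition.one_of_one_le (by linarith)

lemma timeCutoff_eq_zero {T τ : ℝ} (h : T + 2 ≤ τ) : timeCutoff T τ = 0 :=
  Real.smoothTransition.zero_of_nonpos (by linarith)

lemma contDiff_timeCutoff (T : ℝ) : ContDiff ℝ 1 (timeCutoff T) :=
  Real.smoothTransition.contDiff.comp (by fun_prop)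

/-- The test function for the continuity equation. -/
def densityTest (h : ℝ → ℝ) (ρinf : ℝ → Space d → ℝ) (ρs : Space d → ℝ)
    (ns : Space d → Space d) (χ : Space d → ℝ) (T τ : ℝ) (y : Space d) : ℝ :=
  timeCutoff T τ * (χ y * densityVariation h ρinf ρs ns τ y)

/-- The test function for the momentum equation. -/
def momentumTest (ρs : Space d → ℝ) (ns : Space d → Space d) (χ : Space d → ℝ) (T τ : ℝ)
    (y : Space d) : Space d :=
  (timeCutoff T τ * Real.exp (-(d * τ))) • χ y • -profileVelocity ρs ns y

variable {p h : ℝ → ℝ} {ρhat ρs : Space d → ℝ} {ρinf : ℝ → Space d → ℝ} {ns : Space d → Space d}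
  {χ : Space d → ℝ}

lemma contDiffOn_densityVariation (href : IsReferenceDensity h ρhat ρinf)
    (hb : ContDiff ℝ 1 fun y => potDeriv h (ρs y)) (hu : ContDiff ℝ 1 (profileVelocity ρs ns)) :
    ContDiffOn ℝ 1 (fun z : ℝ × Space d => densityVariation h ρinf ρs ns z.1 z.2)
      (halfSpace d) := by
  have h1 : ContDiff ℝ 1 fun z : ℝ × Space d => potDeriv h (ρs z.2) := hb.comp contDiff_snd
  have h2 : ContDiff ℝ 1 fun z : ℝ × Space d => ‖profileVelocity ρs ns z.2‖ ^ 2 :=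
    (hu.comp contDiff_snd).norm_sq ℝ
  have h3 : ContDiff ℝ 1 fun z : ℝ × Space d => 1 / 2 * Real.exp (-(d * z.1)) := by fun_prop
  exact (href.contDiffOn_potDeriv.sub h1.contDiffOn).add (h3.mul h2).contDiffOn

lemma isTestFunction_densityTest (href : IsReferenceDensity h ρhat ρinf)
    (hb : ContDiff ℝ 1 fun y => potDeriv h (ρs y)) (hu : ContDiff ℝ 1 (profileVelocity ρs ns))
    (hχ : ContDiff ℝ 1 χ) (hχc : HasCompactSupport χ) (T : ℝ) :
    IsTestFunction (densityTest h ρinf ρs ns χ T) := by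
  obtain ⟨R, hR⟩ := exists_support_of_hasCompactSupport hχc
  refine ⟨?_, max R (T + 2), fun τ hτ y hy => ?_⟩
  · have h1 : ContDiff ℝ 1 fun z : ℝ × Space d => timeCutoff T z.1 :=
      (contDiff_timeCutoff T).comp contDiff_fst
    have h2 : ContDiff ℝ 1 fun z : ℝ × Space d => χ z.2 := hχ.comp contDiff_snd
    exact h1.contDiffOn.mul (h2.contDiffOn.mul (contDiffOn_densityVariation href hb hu))
  · rw [densityTest]
    rcases hy with hy | hy
    · rw [timeCutoff_eq_zero ((le_max_right R (T + 2)).trans hy.le), zero_mul]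
    · rw [(hR y ((le_max_left _ _).trans_lt hy)).1, zero_mul, mul_zero]

lemma isTestFunction_momentumTest (hu : ContDiff ℝ 1 (profileVelocity ρs ns))
    (hχ : ContDiff ℝ 1 χ) (hχc : HasCompactSupport χ) (T : ℝ) :
    IsTestFunction (momentumTest ρs ns χ T) := by
  obtain ⟨R, hR⟩ := exists_support_of_hasCompactSupport hχc
  refine ⟨?_, max R (T + 2), fun τ hτ y hy => ?_⟩
  · have h1 : ContDiff ℝ 1 fun z : ℝ × Space d => timeCutoff T z.1 * Real.exp (-(d * z.1)) :=
      ((contDiff_timeCutoff T).comp contDiff_fst).mul (by fun_prop)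
    have h2 : ContDiff ℝ 1 fun z : ℝ × Space d => χ z.2 := hχ.comp contDiff_snd
    have h3 : ContDiff ℝ 1 fun z : ℝ × Space d => -profileVelocity ρs ns z.2 :=
      (hu.comp contDiff_snd).neg
    exact (h1.smul (h2.smul h3)).contDiffOn
  · rw [momentumTest]
    rcases hy with hy | hy
    · rw [timeCutoff_eq_zero ((le_max_right R (T + 2)).trans hy.le), zero_mul, zero_smul]
    · rw [(hR y ((le_max_left _ _).trans_lt hy)).1, zero_smul, smul_zero]

lemma densityTest_eq {T τ : ℝ} (hτ : τ ≤ T) (y : Space d) :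
    densityTest h ρinf ρs ns χ T τ y = χ y * densityVariation h ρinf ρs ns τ y := by
  rw [densityTest, timeCutoff_eq_one (by linarith), one_mul]

lemma momentumTest_eq {T τ : ℝ} (hτ : τ ≤ T) (y : Space d) :
    momentumTest ρs ns χ T τ y = Real.exp (-(d * τ)) • χ y • -profileVelocity ρs ns y := by
  rw [momentumTest, timeCutoff_eq_one (by linarith), one_mul]

/-- The dissipation of the relative entropy at a state `(r, v)`. -/
def relDissipation (α : ℝ) (p h : ℝ → ℝ) (ρs : Space d → ℝ) (ns : Space d → Space d) (τ : ℝ)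
    (y : Space d) (r : ℝ) (v : Space d) : ℝ :=
  α * r * ‖r⁻¹ • v - profileVelocity ρs ns y‖ ^ 2
    + Real.exp (-(d * τ)) * r *
      (inner ℝ (fderiv ℝ (profileVelocity ρs ns) y (r⁻¹ • v - profileVelocity ρs ns y))
          (r⁻¹ • v - profileVelocity ρs ns y)
        + inner ℝ (fderiv ℝ (profileVelocity ρs ns) y (profileVelocity ρs ns y)
            - (1 / 2 : ℝ) • fderiv ℝ (profileVelocity ρs ns) y y
            - ((d : ℝ) / 2) • profileVelocity ρs ns y) (r⁻¹ • v - profileVelocity ρs ns y))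
    + (-(1 / 2 * fderiv ℝ (fun x => potDeriv h (ρs x)) y y) * r
      - α * r * ‖profileVelocity ρs ns y‖ ^ 2
      + p r * traceCLM d (fderiv ℝ (profileVelocity ρs ns) y)
      + 1 / 2 * fderiv ℝ (fun x => potPressure h (ρs x)) y y
      - (potPressure h (ρs y) * traceCLM d (fderiv ℝ (profileVelocity ρs ns) y)
        + fderiv ℝ (fun x => potPressure h (ρs x)) y (profileVelocity ρs ns y)))

/-- The terms that are generated by the gradient of the spatial cutoff function. -/
def cutoffError (p h : ℝ → ℝ) (ρinf : ℝ → Space d → ℝ) (ρs : Space d → ℝ)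
    (ns : Space d → Space d) (χ : Space d → ℝ) (τ : ℝ) (y : Space d) (r : ℝ) (v : Space d) : ℝ :=
  densityVariation h ρinf ρs ns τ y * (r / 2 * fderiv ℝ χ y y - fderiv ℝ χ y v)
    - 1 / 2 * Real.exp (-(d * τ)) * fderiv ℝ χ y y * inner ℝ (profileVelocity ρs ns y) v
    + Real.exp (-(d * τ)) * fderiv ℝ χ y v * inner ℝ (profileVelocity ρs ns y) (r⁻¹ • v)
    + p r * fderiv ℝ χ y (profileVelocity ρs ns y)

lemma hasDerivAt_densityVariation (href : IsReferenceDensity h ρhat ρinf) {τ : ℝ} (hτ : 0 < τ)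
    (y : Space d) :
    HasDerivAt (fun s => densityVariation h ρinf ρs ns s y)
      (spaceTimeDeriv (fun s y => potDeriv h (ρinf s y)) (τ, y) (1, 0)
        - d / 2 * Real.exp (-(d * τ)) * ‖profileVelocity ρs ns y‖ ^ 2) τ := by
  have h1 := hasDerivAt_time (f := fun s y => potDeriv h (ρinf s y)) href.contDiffOn_potDeriv hτ y
  have h2 : HasDerivAt (fun s : ℝ => Real.exp (-(d * s))) (Real.exp (-(d * τ)) * -(d * 1)) τ :=
    (((hasDerivAt_id τ).const_mul (d : ℝ)).neg).exp
  refine ((h1.sub_const _).add ((h2.const_mul (1 / 2)).mul_const _)).congr_deriv ?_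
  ring

lemma hasFDerivAt_densityVariation (href : IsReferenceDensity h ρhat ρinf)
    (hb : ContDiff ℝ 1 fun y => potDeriv h (ρs y)) (hu : ContDiff ℝ 1 (profileVelocity ρs ns))
    {τ : ℝ} (hτ : 0 < τ) (y : Space d) :
    ∃ L : Space d →L[ℝ] ℝ, HasFDerivAt (densityVariation h ρinf ρs ns τ) L y ∧
      ∀ w, L w = spaceTimeDeriv (fun s y => potDeriv h (ρinf s y)) (τ, y) (0, w)
        - fderiv ℝ (fun y => potDeriv h (ρs y)) y w + Real.exp (-(d * τ)) *
          inner ℝ (fderiv ℝ (profileVelocity ρs ns) y w) (profileVelocity ρs ns y) := by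
  have h1 := hasFDerivAt_space (f := fun s y => potDeriv h (ρinf s y)) href.contDiffOn_potDeriv hτ y
  have h2 := ((hb.differentiable one_ne_zero) y).hasFDerivAt
  have h3 := ((hu.differentiable one_ne_zero) y).hasFDerivAt.norm_sq
  refine ⟨_, (h1.sub h2).add (h3.const_mul (1 / 2 * Real.exp (-(d * τ)))), fun w => ?_⟩
  simp [real_inner_comm]
  ring

lemma spaceTimeDeriv_pressureDifference (hh : IsPotential p h)
    (href : IsReferenceDensity h ρhat ρinf) (hπ : ContDiff ℝ 1 fun y => potPressure h (ρs y))
    {τ : ℝ} (hτ : 0 < τ) (y : Space d) (q : ℝ × Space d) :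
    spaceTimeDeriv (fun s y => potPressure h (ρinf s y) - potPressure h (ρs y)) (τ, y) q =
      ρinf τ y * spaceTimeDeriv (fun s y => potDeriv h (ρinf s y)) (τ, y) q
        - fderiv ℝ (fun y => potPressure h (ρs y)) y q.2 := by
  have hz : (τ, y) ∈ halfSpace d := ⟨hτ.le, trivial⟩
  have h1 := href.hasFDerivWithinAt_potPressure hh hz
  have h2 : HasFDerivAt (fun z : ℝ × Space d => potPressure h (ρs z.2)) _ (τ, y) :=
    HasFDerivAt.comp (g := fun y => potPressure h (ρs y)) (τ, y)
      ((hπ.differentiable one_ne_zero) y).hasFDerivAt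
      (ContinuousLinearMap.snd ℝ ℝ (Space d)).hasFDerivAt
  have h3 : HasFDerivWithinAt (fun z : ℝ × Space d =>
      potPressure h (ρinf z.1 z.2) - potPressure h (ρs z.2)) _ (halfSpace d) (τ, y) :=
    h1.sub h2.hasFDerivWithinAt
  rw [spaceTimeDeriv, h3.fderivWithin (uniqueDiffOn_halfSpace _ hz)]
  simp

lemma contDiffOn_pressureDifference (hh : IsPotential p h)
    (href : IsReferenceDensity h ρhat ρinf) (hπ : ContDiff ℝ 1 fun y => potPressure h (ρs y)) :
    ContDiffOn ℝ 1 (fun z : ℝ × Space d =>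
      potPressure h (ρinf z.1 z.2) - potPressure h (ρs z.2)) (halfSpace d) :=
  (href.contDiffOn_potPressure hh).sub (hπ.comp contDiff_snd).contDiffOn

lemma traceCLM_fderiv_pressure_smul (hπ : ContDiff ℝ 1 fun y => potPressure h (ρs y))
    (hu : ContDiff ℝ 1 (profileVelocity ρs ns)) (y : Space d) :
    traceCLM d (fderiv ℝ (fun y => potPressure h (ρs y) • profileVelocity ρs ns y) y) =
      potPressure h (ρs y) * traceCLM d (fderiv ℝ (profileVelocity ρs ns) y)
        + fderiv ℝ (fun x => potPressure h (ρs x)) y (profileVelocity ρs ns y) := by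
  have h1 : HasFDerivAt (fun y => potPressure h (ρs y) • profileVelocity ρs ns y) _ y :=
    ((hπ.differentiable one_ne_zero) y).hasFDerivAt.smul
      ((hu.differentiable one_ne_zero) y).hasFDerivAt
  rw [h1.fderiv, map_add, map_smul,
    traceCLM_smulRight, smul_eq_mul]

/-- The pointwise form of the relative entropy identity. -/
lemma relative_identity {α : ℝ} (hh : IsPotential p h) (href : IsReferenceDensity h ρhat ρinf)
    (hb : ContDiff ℝ 1 fun y => potDeriv h (ρs y))
    (hπ : ContDiff ℝ 1 fun y => potPressure h (ρs y))
    (hu : ContDiff ℝ 1 (profileVelocity ρs ns))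
    (hflux : ∀ y v, fderiv ℝ (fun y => potDeriv h (ρs y)) y v
      = -(α * inner ℝ (profileVelocity ρs ns y) v))
    (hχ : ContDiff ℝ 1 χ) {ρ : ℝ → Space d → ℝ} {n : ℝ → Space d → Space d} {τ T : ℝ}
    (hτ : 0 < τ) (hT : τ ≤ T) (y : Space d) (hst : IsState (ρ τ y) (n τ y)) :
    α * (‖n τ y‖ ^ 2 / ρ τ y) - densityIntegrand ρ n (densityTest h ρinf ρs ns χ T) τ y
        - momentumIntegrand α p ρ n (momentumTest ρs ns χ T) τ y
        - referenceIntegrand h ρ n ρinf τ y =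
      (1 - χ y) * (α * (‖n τ y‖ ^ 2 / ρ τ y) - referenceIntegrand h ρ n ρinf τ y)
      + χ y * (-spaceTimeDeriv (fun s y => potPressure h (ρinf s y) - potPressure h (ρs y))
            (τ, y) (1, 0)
          + 1 / 2 * spaceTimeDeriv (fun s y => potPressure h (ρinf s y) - potPressure h (ρs y))
            (τ, y) (0, y)
          + d / 2 * (potPressure h (ρinf τ y) - potPressure h (ρs y))
          + traceCLM d (fderiv ℝ (fun y => potPressure h (ρs y) • profileVelocity ρs ns y) y))
      + d / 2 * (χ y * (densityVariation h ρinf ρs ns τ y * ρ τ y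
          - Real.exp (-(d * τ)) * inner ℝ (profileVelocity ρs ns y) (n τ y)
          + (potPressure h (ρs y) - potPressure h (ρinf τ y))))
      + χ y * relDissipation α p h ρs ns τ y (ρ τ y) (n τ y)
      + cutoffError p h ρinf ρs ns χ τ y (ρ τ y) (n τ y) := by
  set u := profileVelocity ρs ns with hudef
  -- The time cutoff is 1 up to T + 1 rather than T, hence on a neighbourhood of each τ ≤ T; its
  -- time derivative does not enter.
  have hev : ∀ᶠ s in 𝓝 τ, s ≤ T + 1 := by
    filter_upwards [Iio_mem_nhds (by linarith : τ < T + 1)] with s hs using le_of_lt hs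
  have hχd := ((hχ.differentiable one_ne_zero) y).hasFDerivAt
  have hud := ((hu.differentiable one_ne_zero) y).hasFDerivAt
  -- time derivatives of the test functions
  have t1 : deriv (fun s => densityTest h ρinf ρs ns χ T s y) τ = χ y *
      (spaceTimeDeriv (fun s y => potDeriv h (ρinf s y)) (τ, y) (1, 0)
        - d / 2 * Real.exp (-(d * τ)) * ‖u y‖ ^ 2) := by
    have h1 := (hasDerivAt_densityVariation (ρs := ρs) (ns := ns) href hτ y).const_mul (χ y)
    have h2 : (fun s => densityTest h ρinf ρs ns χ T s y) =ᶠ[𝓝 τ]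
        fun s => χ y * densityVariation h ρinf ρs ns s y := by
      filter_upwards [hev] with s hs
      rw [densityTest, timeCutoff_eq_one hs, one_mul]
    exact (h1.congr_of_eventuallyEq h2).deriv
  have t2 : deriv (fun s => momentumTest ρs ns χ T s y) τ
      = (d * Real.exp (-(d * τ)) * χ y) • u y := by
    have h0 : HasDerivAt (fun s : ℝ => Real.exp (-(d * s))) (Real.exp (-(d * τ)) * -(d * 1)) τ :=
      (((hasDerivAt_id τ).const_mul (d : ℝ)).neg).exp
    have h1 := h0.smul_const (χ y • -u y)
    have h2 : (fun s => momentumTest ρs ns χ T s y) =ᶠ[𝓝 τ]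
        fun s => Real.exp (-(d * s)) • χ y • -u y := by
      filter_upwards [hev] with s hs
      rw [momentumTest, timeCutoff_eq_one hs, one_mul]
    rw [(h1.congr_of_eventuallyEq h2).deriv]
    module
  -- spatial derivatives of the test functions
  obtain ⟨L, hL, hLw⟩ := hasFDerivAt_densityVariation (ρs := ρs) (ns := ns) href hb hu hτ y
  have s1 : ∀ w, fderiv ℝ (densityTest h ρinf ρs ns χ T τ) y w = χ y * L w
      + densityVariation h ρinf ρs ns τ y * fderiv ℝ χ y w := by
    intro w
    have h2 : densityTest h ρinf ρs ns χ T τ = fun y => χ y * densityVariation h ρinf ρs ns τ y :=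
      funext fun y => densityTest_eq hT y
    have h3 : HasFDerivAt (fun y => χ y * densityVariation h ρinf ρs ns τ y) _ y := hχd.mul hL
    rw [h2, h3.fderiv]
    simp
  have s2 : fderiv ℝ (momentumTest ρs ns χ T τ) y = -(Real.exp (-(d * τ)) •
      (χ y • fderiv ℝ u y + (fderiv ℝ χ y).smulRight (u y))) := by
    have h2 : momentumTest ρs ns χ T τ = fun y => Real.exp (-(d * τ)) • χ y • -u y :=
      funext fun y => momentumTest_eq hT y
    have h3 : HasFDerivAt (fun y => Real.exp (-(d * τ)) • χ y • -u y) _ y :=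
      (hχd.smul hud.neg).const_smul (Real.exp (-(d * τ)))
    rw [h2, h3.fderiv]
    ext w
    simp
    ring
  rw [densityIntegrand_eq, momentumIntegrand_eq, referenceIntegrand_eq, t1, t2, s1, s1, s2,
    densityTest_eq hT, momentumTest_eq hT, spaceTimeDeriv_pressureDifference hh href hπ hτ,
    spaceTimeDeriv_pressureDifference hh href hπ hτ, traceCLM_fderiv_pressure_smul hπ hu,
    fderiv_space_apply (f := fun s y => potDeriv h (ρinf s y)) href.contDiffOn_potDeriv hτ, fderiv_space_apply (f := fun s y => potDeriv h (ρinf s y)) href.contDiffOn_potDeriv hτ,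
    (hasDerivAt_time (f := fun s y => potDeriv h (ρinf s y)) href.contDiffOn_potDeriv hτ y).deriv, hLw, hLw, hflux y (n τ y),
    relDissipation, cutoffError, ← hudef]
  set r := ρ τ y
  -- Here m is the velocity n/ρ. Expressing |n|²/ρ and n ⊗ n/ρ through m is also correct in vacuum,
  -- where n = 0 and all quotients are 0.
  obtain ⟨m, hm, hN, hq⟩ : ∃ m : Space d, m = r⁻¹ • n τ y ∧ ‖n τ y‖ ^ 2 / r = r * ‖m‖ ^ 2 ∧
      n τ y = r • m := by
    refine ⟨_, rfl, ?_, hst.smul_inv_smul.symm⟩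
    rw [norm_smul, mul_pow, norm_inv, inv_pow, Real.norm_eq_abs, sq_abs]
    by_cases hr : r = 0
    · simp [hr]
    · field_simp
  have hrr : ∀ A : Space d →L[ℝ] Space d, r⁻¹ * inner ℝ (A (n τ y)) (n τ y)
      = r * inner ℝ (A m) m := by
    intro A
    rw [hq, map_smul, real_inner_smul_left, real_inner_smul_right]
    by_cases hr : r = 0
    · simp [hr]
    · field_simp
  rw [hN, hrr, ← hm, hq]
  have hee : Real.exp (d * τ) * Real.exp (-(d * τ)) = 1 := by rw [← Real.exp_add]; simp
  generalize Real.exp (-(d * τ)) = e at *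
  generalize Real.exp (d * τ) = e' at *
  simp only [map_smul, map_sub, map_neg, map_add, neg_apply, add_apply, smul_apply,
    ContinuousLinearMap.smulRight_apply, traceCLM_smulRight, inner_sub_left, inner_sub_right,
    inner_add_left, inner_neg_left, real_inner_smul_left, real_inner_smul_right,
    smul_eq_mul, smul_neg, ← real_inner_self_eq_norm_sq, mul_neg]
  have hc1 := real_inner_comm (u y) m
  rw [map_zero]
  -- After expansion the identity is polynomial. The only relations needed are e^{dτ}e^{-dτ} = 1,
  -- for the pressure and damping terms paired with ψ, and the symmetry of the inner product.
  linear_combination (p r * (χ y * traceCLM d (fderiv ℝ u y) + fderiv ℝ χ y (u y))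
    - α * r * χ y * inner ℝ (u y) m) * hee + χ y * α * r * hc1

end Profile

/-! ### Profiles with controlled relative dissipation -/

/-- The properties of a profile `(ρ*, n*)` that imply the decay of the relative entropy. -/
structure IsRelativeProfile {d : ℕ} (α : ℝ) (p h : ℝ → ℝ) (ρhat ρs : Space d → ℝ)
    (ns : Space d → Space d) (K : (Space d → Space d) → ℝ≥0) (θ μ : ℝ) (κ : Space d → ℝ) :
    Prop where
  theta_nonneg : 0 ≤ θ
  mu_nonneg : 0 ≤ μ
  kappa_nonneg : ∀ y, 0 ≤ κ y
  kappa_integrable : Integrable κ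
  limit_hasPotDeriv : ∀ y, y ≠ 0 → HasPotDeriv h (ρhat y)
  limit_aemeasurable : AEMeasurable ρhat
  limit_le : ∃ M, ∀ y, y ≠ 0 → ρhat y ≤ M
  hasPotDeriv : ∀ y, HasPotDeriv h (ρs y)
  contDiff_potDeriv : ContDiff ℝ 1 fun y => potDeriv h (ρs y)
  contDiff_potPressure : ContDiff ℝ 1 fun y => potPressure h (ρs y)
  contDiff_velocity : ContDiff ℝ 1 (profileVelocity ρs ns)
  flux : ∀ y v, fderiv ℝ (fun y => potDeriv h (ρs y)) y v
      = -(α * inner ℝ (profileVelocity ρs ns y) v)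
  potDeriv_sub_integrable : Integrable fun y => potDeriv h (ρhat y) - potDeriv h (ρs y)
  potDeriv_sub_le : ∃ M, ∀ y, y ≠ 0 → |potDeriv h (ρhat y) - potDeriv h (ρs y)| ≤ M
  potPressure_sub_integrable :
    Integrable fun y => (1 + ‖y‖) * |potPressure h (ρhat y) - potPressure h (ρs y)|
  potPressure_le : ∃ M, ∀ y, |potPressure h (ρs y)| ≤ M
  velocity_integrable : Integrable (profileVelocity ρs ns)
  velocity_le : ∃ M, ∀ y, ‖profileVelocity ρs ns y‖ ≤ M
  growth : ∃ (C : ℝ) (k : Space d → ℝ), 0 ≤ C ∧ Integrable k ∧ ∀ y r, 0 ≤ r →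
    ‖profileVelocity ρs ns y‖ * |p r| ≤ k y + C * relPot h r (ρs y)
  weight_le : ∃ C : ℝ, 0 ≤ C ∧ ∀ (χ : Space d → ℝ) (δ : ℝ), ContDiff ℝ 1 χ → HasCompactSupport χ →
    (∀ y, 0 ≤ χ y ∧ χ y ≤ 1) → (∀ y, ‖fderiv ℝ χ y‖ ≤ δ) →
    (K (fun y => χ y • -profileVelocity ρs ns y) : ℝ) ≤ θ + C * δ
  dissipation : ∀ τ, 0 ≤ τ → ∀ y (r : ℝ) (v : Space d), IsState r v →
    -((θ + μ * Real.exp (-(d / 2 * τ))) * relEntropyReal h τ r v (ρs y) (ns y)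
      + Real.exp (-(d / 2 * τ)) * κ y) ≤ relDissipation α p h ρs ns τ y r v

section Domination

variable {d : ℕ} {α θ μ : ℝ} {p h : ℝ → ℝ} {ρhat ρs : Space d → ℝ} {ns : Space d → Space d}
  {K : (Space d → Space d) → ℝ≥0} {κ : Space d → ℝ} {ρinf : ℝ → Space d → ℝ}

/-- Expanding r|u - u*|² gives terms linear in (r, v) besides the kinetic energy, and
`relPot_change` does the same for the potential. The coefficients of r and v are the test functions,
up to the cutoffs. -/
lemma relEntropyReal_change {τ r : ℝ} {v : Space d} (hst : IsState r v) (y : Space d) :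
    relEntropyReal h τ r v (ρs y) (ns y) = relEntropyReal h τ r v (ρinf τ y) 0
      + (densityVariation h ρinf ρs ns τ y * r
        - Real.exp (-(d * τ)) * inner ℝ (profileVelocity ρs ns y) v
        + (potPressure h (ρs y) - potPressure h (ρinf τ y))) := by
  rw [relEntropyReal, relEntropyReal, densityVariation, relPot_change h r (ρinf τ y) (ρs y)]
  have h1 : (ρs y)⁻¹ • ns y = profileVelocity ρs ns y := rfl
  have h2 : inner ℝ (profileVelocity ρs ns y) v = r * inner ℝ (r⁻¹ • v) (profileVelocity ρs ns y) := by
    rw [← real_inner_smul_left, hst.smul_inv_smul, real_inner_comm]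
  rw [h1, h2, smul_zero, sub_zero, norm_sub_sq_real]
  ring

/-- By the arithmetic-geometric mean inequality, mass and kinetic energy control the momentum. -/
lemma IsState.norm_le {r : ℝ} {v : Space d} (hst : IsState r v) : ‖v‖ ≤ r + ‖v‖ ^ 2 / r := by
  rcases hst.1.eq_or_lt with h0 | h0
  · rw [hst.2 h0.symm, ← h0]
    simp
  · have h1 : ‖v‖ ^ 2 = r * (‖v‖ ^ 2 / r) := by field_simp
    have h2 : 0 ≤ ‖v‖ ^ 2 / r := by positivity
    nlinarith [norm_nonneg v, sq_nonneg (r - ‖v‖)]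

set_option maxHeartbeats 800000 in
/-- All densities in the relative entropy identity are dominated by the relative entropy density
with respect to the reference density. -/
lemma exists_domination (hp : IsPressure p) (hh : IsPotential p h)
    (href : IsReferenceDensity h ρhat ρinf)
    (hprof : IsRelativeProfile α p h ρhat ρs ns K θ μ κ) {T : ℝ} (hT : 0 ≤ T) :
    ∃ (A : ℝ) (k : Space d → ℝ), 0 ≤ A ∧ Integrable k ∧ (∀ y, 0 ≤ k y) ∧
      ∀ τ ∈ Icc 0 T, ∀ y, y ≠ 0 →
        (1 + ‖y‖) * |potPressure h (ρinf τ y) - potPressure h (ρs y)| ≤ k y ∧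
        ‖potPressure h (ρs y) • profileVelocity ρs ns y‖ ≤ k y ∧
        ∀ (r : ℝ) (v : Space d), IsState r v →
          |densityVariation h ρinf ρs ns τ y| * (r + ‖v‖) ≤
            A * relEntropyReal h τ r v (ρinf τ y) 0 + k y ∧
          ‖profileVelocity ρs ns y‖ * ‖v‖ ≤ A * relEntropyReal h τ r v (ρinf τ y) 0 + k y ∧
          ‖v‖ ^ 2 / r ≤ A * relEntropyReal h τ r v (ρinf τ y) 0 + k y ∧
          ‖profileVelocity ρs ns y‖ * (‖v‖ ^ 2 / r) ≤
            A * relEntropyReal h τ r v (ρinf τ y) 0 + k y ∧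
          ‖profileVelocity ρs ns y‖ * |p r| ≤
            A * relEntropyReal h τ r v (ρinf τ y) 0 + k y := by
  obtain ⟨R, hR0, hR⟩ := href.eq_far T
  obtain ⟨Mhat, hMhat⟩ := hprof.limit_le
  obtain ⟨Md, hMd⟩ := hprof.potDeriv_sub_le
  obtain ⟨Mp, hMp⟩ := hprof.potPressure_le
  obtain ⟨Mu, hMu⟩ := hprof.velocity_le
  obtain ⟨Cg, kg, hCg, hkg, hgrowth⟩ := hprof.growth
  have hMu0 : 0 ≤ Mu := (norm_nonneg _).trans (hMu 0)
  have hMp0 : 0 ≤ Mp := (abs_nonneg _).trans (hMp 0)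
  set C : Set (ℝ × Space d) := Icc 0 T ×ˢ Metric.closedBall 0 R with hC
  have hCc : IsCompact C := isCompact_Icc.prod (isCompact_closedBall _ _)
  have hCs : C ⊆ halfSpace d := prod_mono (fun _ h => h.1) (subset_univ _)
  obtain ⟨Ma, hMa⟩ := hCc.exists_bound_of_continuousOn (href.contDiffOn_potDeriv.continuousOn.mono hCs)
  obtain ⟨Mπ, hMπ⟩ := hCc.exists_bound_of_continuousOn
    ((href.contDiffOn_potPressure hh).continuousOn.mono hCs)
  obtain ⟨Mρ, hMρ⟩ := hCc.exists_bound_of_continuousOn (href.contDiffOn.continuousOn.mono hCs)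
  obtain ⟨Mb, hMb⟩ := (isCompact_closedBall (0 : Space d) R).exists_bound_of_continuousOn
    hprof.contDiff_potDeriv.continuous.continuousOn
  have h0C : ((0 : ℝ), (0 : Space d)) ∈ C := ⟨⟨le_rfl, hT⟩, by simp [hR0.le]⟩
  have hMa0 : 0 ≤ Ma := (norm_nonneg _).trans (hMa _ h0C)
  have hMπ0 : 0 ≤ Mπ := (norm_nonneg _).trans (hMπ _ h0C)
  have hMb0 : 0 ≤ Mb := (norm_nonneg _).trans (hMb 0 (by simp [hR0.le]))
  -- The reference density is bounded by Mρ in the ball of radius R and equals ρ̂ ≤ Mhat outside of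
  -- it (the origin excepted for ρ̂), so one mass bound holds on the whole slab.
  obtain ⟨Cr, hCr, hr⟩ := le_relPot_bound hp hh (max Mρ Mhat)
  -- the integrable majorants
  set B : Set (Space d) := Metric.closedBall 0 R with hB
  set kφ : Space d → ℝ := fun y => B.indicator (fun _ => Ma + Mb) y
    + |potDeriv h (ρhat y) - potDeriv h (ρs y)| + Mu / 2 * ‖profileVelocity ρs ns y‖ with hkφ
  set kπ : Space d → ℝ := fun y => B.indicator (fun _ => (1 + R) * (Mπ + Mp)) y
    + (1 + ‖y‖) * |potPressure h (ρhat y) - potPressure h (ρs y)| with hkπ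
  have hBi : ∀ c : ℝ, Integrable (B.indicator fun _ => c) := fun c =>
    (integrable_indicator_iff (isCompact_closedBall _ _).measurableSet).2
      (continuousOn_const.integrableOn_compact (isCompact_closedBall _ _))
  have hkφi : Integrable kφ := ((hBi _).add hprof.potDeriv_sub_integrable.abs).add
    (hprof.velocity_integrable.norm.const_mul _)
  have hkπi : Integrable kπ := (hBi _).add hprof.potPressure_sub_integrable
  have hind : ∀ (c : ℝ) (y : Space d), 0 ≤ c → 0 ≤ B.indicator (fun _ => c) y ∧
      B.indicator (fun _ => c) y ≤ c := fun c y hc =>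
    ⟨indicator_nonneg (fun _ _ => hc) y, indicator_le_self' (fun _ _ => hc) y⟩
  have hkφ0 : ∀ y, 0 ≤ kφ y := fun y => by
    have := (hind (Ma + Mb) y (by positivity)).1
    simp only [hkφ]
    positivity
  have hkπ0 : ∀ y, 0 ≤ kπ y := fun y => by
    have := (hind ((1 + R) * (Mπ + Mp)) y (by positivity)).1
    simp only [hkπ]
    positivity
  set Mφ : ℝ := Ma + Mb + |Md| + Mu / 2 * Mu with hMφ
  have hkφM : ∀ y, y ≠ 0 → kφ y ≤ Mφ := fun y hy => by
    have h1 := (hind (Ma + Mb) y (by positivity)).2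
    have h2 := (hMd y hy).trans (le_abs_self Md)
    have h3 : Mu / 2 * ‖profileVelocity ρs ns y‖ ≤ Mu / 2 * Mu := by
      gcongr
      exact hMu y
    simp only [hkφ, hMφ]
    linarith
  -- The kinetic part of the relative entropy is ½e^{-dτ}|v|²/r, so |v|²/r is at most 2e^{dτ} times
  -- the relative entropy density; the worst factor on [0,T] is that at T.
  set Ex : ℝ := 2 * Real.exp (d * T) with hEx
  have hEx0 : 0 ≤ Ex := by positivity
  have hMφ0 : 0 ≤ Mφ := by positivity
  -- Both A and k are sums of all constants and majorants that occur in `i1` to `i5` and in the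
  -- first two bounds, so that a single pair serves every estimate.
  set A : ℝ := Mφ * (2 * Cr + Ex) + Mu * (Cr + Ex) + Ex + Mu * Ex + Cg * (1 + Mφ * Cr) with hA
  set k : Space d → ℝ := fun y => 2 * Cr * kφ y + Cr * ‖profileVelocity ρs ns y‖
    + |kg y| + Cg * (Cr * kφ y + kπ y) + kπ y + Mp * ‖profileVelocity ρs ns y‖ with hk
  refine ⟨A, k, by positivity, ?_, fun y => ?_, fun τ hτ y hy => ?_⟩
  · exact (((((hkφi.const_mul _).add (hprof.velocity_integrable.norm.const_mul _)).add
      hkg.abs).add (((hkφi.const_mul _).add hkπi).const_mul _)).add hkπi).add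
        (hprof.velocity_integrable.norm.const_mul _)
  · have := hkφ0 y
    have := hkπ0 y
    simp only [hk]
    positivity
  have hs := href.hasPotDeriv hτ.1 y
  have hφ0 := hkφ0 y
  have hπ0 := hkπ0 y
  have hu0 := norm_nonneg (profileVelocity ρs ns y)
  have hexp1 : Real.exp (-(d * τ)) ≤ 1 :=
    Real.exp_le_one_iff.2 (neg_nonpos.2 (mul_nonneg d.cast_nonneg hτ.1))
  have hexp0 := Real.exp_pos (-(d * τ))
  -- bounds for the variations
  have hab : |potDeriv h (ρinf τ y) - potDeriv h (ρs y)|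
      + Mu / 2 * ‖profileVelocity ρs ns y‖ ≤ kφ y := by
    by_cases hyB : y ∈ B
    · have h1 := hMa (τ, y) ⟨hτ, hyB⟩
      have h2 := hMb y hyB
      rw [Real.norm_eq_abs] at h1 h2
      simp only [hkφ, indicator_of_mem hyB]
      have h3 := abs_sub (potDeriv h (ρinf τ y)) (potDeriv h (ρs y))
      have h4 := abs_nonneg (potDeriv h (ρhat y) - potDeriv h (ρs y))
      linarith
    · rw [hR τ hτ y (by simpa [hB] using hyB)]
      simp [hkφ, indicator_of_notMem hyB]
  have hφ : |densityVariation h ρinf ρs ns τ y| ≤ kφ y := by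
    refine le_trans ?_ hab
    rw [densityVariation]
    refine (abs_add_le _ _).trans (add_le_add le_rfl ?_)
    rw [abs_of_nonneg (by positivity)]
    calc _ ≤ 1 / 2 * 1 * (Mu * ‖profileVelocity ρs ns y‖) := by
          rw [sq]
          gcongr
          exact hMu y
      _ = _ := by ring
  have hab' : |potDeriv h (ρinf τ y) - potDeriv h (ρs y)| ≤ kφ y :=
    le_trans (le_add_of_nonneg_right (by positivity)) hab
  have hπ : (1 + ‖y‖) * |potPressure h (ρinf τ y) - potPressure h (ρs y)| ≤ kπ y := by
    by_cases hyB : y ∈ B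
    · have h1 := hMπ (τ, y) ⟨hτ, hyB⟩
      have h2 := hMp y
      rw [Real.norm_eq_abs] at h1
      have h3 : ‖y‖ ≤ R := by simpa [hB] using hyB
      simp only [hkπ, indicator_of_mem hyB]
      refine le_add_of_le_of_nonneg ?_ (by positivity)
      refine mul_le_mul (by linarith) ?_ (abs_nonneg _) (by positivity)
      exact (abs_sub _ _).trans (add_le_add h1 h2)
    · rw [hR τ hτ y (by simpa [hB] using hyB)]
      simp [hkπ, indicator_of_notMem hyB]
  have hπ' : |potPressure h (ρinf τ y) - potPressure h (ρs y)| ≤ kπ y :=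
    le_trans (le_mul_of_one_le_left (abs_nonneg _) (by linarith [norm_nonneg y])) hπ
  have hρM : ρinf τ y ≤ max Mρ Mhat := by
    by_cases hyB : y ∈ B
    · exact ((le_abs_self _).trans (hMρ (τ, y) ⟨hτ, hyB⟩)).trans (le_max_left _ _)
    · rw [hR τ hτ y (by simpa [hB] using hyB)]
      exact (hMhat y hy).trans (le_max_right _ _)
  have hpos1 : 0 ≤ 2 * Cr * kφ y := by positivity
  have hpos2 : 0 ≤ Cr * ‖profileVelocity ρs ns y‖ := by positivity
  have hpos3 : 0 ≤ |kg y| := abs_nonneg _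
  have hpos4 : 0 ≤ Cg * (Cr * kφ y + kπ y) := by positivity
  have hpos5 : 0 ≤ Mp * ‖profileVelocity ρs ns y‖ := by positivity
  refine ⟨?_, ?_, fun r v hst => ?_⟩
  · simp only [hk]
    linarith
  · rw [norm_smul, Real.norm_eq_abs]
    have := mul_le_mul_of_nonneg_right (hMp y) hu0
    simp only [hk]
    linarith
  have hrp := relPot_nonneg hp hh hst.1 hs
  set N : ℝ := ‖v‖ ^ 2 / r with hN
  have hN0 : 0 ≤ N := div_nonneg (sq_nonneg _) hst.1
  set η : ℝ := relEntropyReal h τ r v (ρinf τ y) 0 with hη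
  have hη1 : relPot h r (ρinf τ y) ≤ η := by
    rw [hη, relEntropyReal_eq_of_zero]
    have : 0 ≤ 1 / 2 * Real.exp (-(d * τ)) * (‖v‖ ^ 2 / r) := by positivity
    linarith
  have hη0 : 0 ≤ η := hrp.trans hη1
  have hNη : N ≤ Ex * η := by
    have h1 : 1 / 2 * Real.exp (-(d * τ)) * N ≤ η := by
      rw [hη, relEntropyReal_eq_of_zero]
      linarith
    have h2 : Real.exp (-(d * T)) ≤ Real.exp (-(d * τ)) :=
      Real.exp_le_exp.2 (neg_le_neg (mul_le_mul_of_nonneg_left hτ.2 d.cast_nonneg))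
    have h3 : Real.exp (d * T) * Real.exp (-(d * T)) = 1 := by rw [← Real.exp_add]; simp
    calc N = Ex * (1 / 2 * Real.exp (-(d * T)) * N) := by
          rw [hEx]
          linear_combination (-N) * h3
      _ ≤ Ex * (1 / 2 * Real.exp (-(d * τ)) * N) := by gcongr
      _ ≤ Ex * η := by gcongr
  have hrη : r ≤ Cr + Cr * η := by
    have := hr r (ρinf τ y) hst.1 hs hρM
    nlinarith
  have hvN := hst.norm_le
  rw [← hN] at hvN
  have hMφy := hkφM y hy
  have huM := hMu y
  have i1 : |densityVariation h ρinf ρs ns τ y| * (r + ‖v‖) ≤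
      2 * Cr * kφ y + Mφ * (2 * Cr + Ex) * η := by
    calc _ ≤ kφ y * (2 * Cr + (2 * Cr + Ex) * η) := by
          refine mul_le_mul hφ (by linarith) (add_nonneg hst.1 (norm_nonneg _)) hφ0
      _ = 2 * Cr * kφ y + kφ y * ((2 * Cr + Ex) * η) := by ring
      _ ≤ 2 * Cr * kφ y + Mφ * ((2 * Cr + Ex) * η) := by gcongr
      _ = _ := by ring
  have i2 : ‖profileVelocity ρs ns y‖ * ‖v‖ ≤ Cr * ‖profileVelocity ρs ns y‖
      + Mu * (Cr + Ex) * η := by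
    calc _ ≤ ‖profileVelocity ρs ns y‖ * (Cr + (Cr + Ex) * η) := by
          gcongr
          linarith
      _ = Cr * ‖profileVelocity ρs ns y‖ + ‖profileVelocity ρs ns y‖ * ((Cr + Ex) * η) := by ring
      _ ≤ Cr * ‖profileVelocity ρs ns y‖ + Mu * ((Cr + Ex) * η) := by gcongr
      _ = _ := by ring
  have i4 : ‖profileVelocity ρs ns y‖ * N ≤ Mu * Ex * η := by
    calc _ ≤ Mu * (Ex * η) := mul_le_mul huM hNη hN0 hMu0
      _ = _ := by ring
  have i5 : ‖profileVelocity ρs ns y‖ * |p r| ≤ |kg y| + Cg * (Cr * kφ y + kπ y)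
      + Cg * (1 + Mφ * Cr) * η := by
    refine (hgrowth y r hst.1).trans ?_
    have h1 : relPot h r (ρs y) ≤ η + (Cr * kφ y + Mφ * Cr * η) + kπ y := by
      rw [relPot_change h r (ρinf τ y) (ρs y)]
      have h2 : (potDeriv h (ρinf τ y) - potDeriv h (ρs y)) * r ≤ Cr * kφ y + Mφ * Cr * η := by
        calc _ ≤ kφ y * (Cr + Cr * η) :=
              mul_le_mul ((le_abs_self _).trans hab') hrη hst.1 hφ0
          _ = Cr * kφ y + kφ y * (Cr * η) := by ring
          _ ≤ Cr * kφ y + Mφ * (Cr * η) := by gcongr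
          _ = _ := by ring
      have h3 := (neg_abs_le (potPressure h (ρinf τ y) - potPressure h (ρs y)))
      linarith
    have h2 := mul_le_mul_of_nonneg_left h1 hCg
    have h3 := le_abs_self (kg y)
    linear_combination h2 + h3
  have a1 : 0 ≤ Mφ * (2 * Cr + Ex) * η := by positivity
  have a2 : 0 ≤ Mu * (Cr + Ex) * η := by positivity
  have a3 : 0 ≤ Ex * η := by positivity
  have a4 : 0 ≤ Mu * Ex * η := by positivity
  have a5 : 0 ≤ Cg * (1 + Mφ * Cr) * η := by positivity
  simp only [hA, hk, add_mul]
  refine ⟨?_, ?_, ?_, ?_, ?_⟩ <;> linarith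

end Domination

/-! ### Energy-variational solutions as functions of time -/

section Solution

variable {d : ℕ} {α θ μ : ℝ} {p h : ℝ → ℝ} {ρhat ρs : Space d → ℝ} {ns : Space d → Space d}
  {K : (Space d → Space d) → ℝ≥0} {κ : Space d → ℝ} {ρinf : ℝ → Space d → ℝ}
  {ρ₀ : Space d → ℝ} {n₀ : Space d → Space d} {ρ : ℝ → Space d → ℝ}
  {n : ℝ → Space d → Space d} {E : ℝ → ℝ}

/-- A state at time `τ` with finite relative entropy with respect to the reference density. -/
structure IsFiniteState (h : ℝ → ℝ) (ρinf : ℝ → Space d → ℝ) (τ : ℝ) (r : Space d → ℝ)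
    (v : Space d → Space d) : Prop where
  density_aemeasurable : AEMeasurable r
  momentum_aemeasurable : AEMeasurable v
  isState : ∀ᵐ y, IsState (r y) (v y)
  integrable : Integrable fun y => relEntropyReal h τ (r y) (v y) (ρinf τ y) 0

lemma IsReferenceDensity.continuous_slice (href : IsReferenceDensity h ρhat ρinf) {τ : ℝ}
    (hτ : 0 ≤ τ) : Continuous (ρinf τ) :=
  (contDiff_slice href.contDiffOn hτ).continuous

lemma isFiniteState_of_ne_top (hp : IsPressure p) (hh : IsPotential p h)
    (href : IsReferenceDensity h ρhat ρinf) {τ : ℝ} (hτ : 0 ≤ τ) {r : Space d → ℝ}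
    {v : Space d → Space d} (hr : AEMeasurable r) (hv : AEMeasurable v)
    (hfin : relEntropy h τ r v (ρinf τ) (fun _ => 0) ≠ ⊤) : IsFiniteState h ρinf τ r v := by
  obtain ⟨h1, h2, -⟩ := state_and_integrable_of_lintegral_ne_top hp hh (t := fun _ => τ)
    aemeasurable_const hr hv (href.continuous_slice hτ).aemeasurable aemeasurable_const
    (Eventually.of_forall fun y => href.hasPotDeriv hτ y) hfin
  exact ⟨hr, hv, h1, h2⟩

lemma IsFiniteState.relEntropy_eq (hp : IsPressure p) (hh : IsPotential p h)
    (href : IsReferenceDensity h ρhat ρinf) {τ : ℝ} (hτ : 0 ≤ τ) {r : Space d → ℝ}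
    {v : Space d → Space d} (hs : IsFiniteState h ρinf τ r v) :
    relEntropy h τ r v (ρinf τ) (fun _ => 0) =
      ENNReal.ofReal (∫ y, relEntropyReal h τ (r y) (v y) (ρinf τ y) 0) :=
  lintegral_density_of_integrable hp hh (t := fun _ => τ) (w := fun _ => 0) hs.isState
    (Eventually.of_forall fun y => href.hasPotDeriv hτ y) hs.integrable

lemma IsFiniteState.toReal_relEntropy (hp : IsPressure p) (hh : IsPotential p h)
    (href : IsReferenceDensity h ρhat ρinf) {τ : ℝ} (hτ : 0 ≤ τ) {r : Space d → ℝ}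
    {v : Space d → Space d} (hs : IsFiniteState h ρinf τ r v) :
    (relEntropy h τ r v (ρinf τ) (fun _ => 0)).toReal =
      ∫ y, relEntropyReal h τ (r y) (v y) (ρinf τ y) 0 := by
  rw [hs.relEntropy_eq hp hh href hτ, ENNReal.toReal_ofReal]
  refine integral_nonneg_of_ae ?_
  filter_upwards [hs.isState] with y hy
    using relEntropyReal_nonneg hp hh hy.1 (href.hasPotDeriv hτ y) _

/-- The difference of the relative entropy densities with respect to the profile and with respect
to the reference density. -/
def entropyShift (h : ℝ → ℝ) (ρinf : ℝ → Space d → ℝ) (ρs : Space d → ℝ)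
    (ns : Space d → Space d) (τ : ℝ) (y : Space d) (r : ℝ) (v : Space d) : ℝ :=
  densityVariation h ρinf ρs ns τ y * r
    - Real.exp (-(d * τ)) * inner ℝ (profileVelocity ρs ns y) v
    + (potPressure h (ρs y) - potPressure h (ρinf τ y))

lemma ae_ne_zero (hd : 1 ≤ d) : ∀ᵐ y : Space d, y ≠ 0 := by
  have : Nonempty (Fin d) := ⟨⟨0, hd⟩⟩
  exact compl_mem_ae_iff.2 (measure_singleton _)

lemma ae_slab_ne_zero (hd : 1 ≤ d) (σ τ : ℝ) :
    ∀ᵐ z ∂(volume.restrict (Ioc σ τ ×ˢ (univ : Set (Space d)))), z.2 ≠ 0 := by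
  rw [volume_restrict_slab]
  exact Measure.quasiMeasurePreserving_snd.ae (ae_ne_zero hd)

lemma aemeasurable_entropyShift (hh : IsPotential p h)
    (href : IsReferenceDensity h ρhat ρinf)
    (hprof : IsRelativeProfile α p h ρhat ρs ns K θ μ κ) {τ : ℝ} (hτ : 0 ≤ τ)
    {r : Space d → ℝ} {v : Space d → Space d} (hr : AEMeasurable r) (hv : AEMeasurable v) :
    AEMeasurable fun y => entropyShift h ρinf ρs ns τ y (r y) (v y) := by
  have h1 : Continuous fun y => densityVariation h ρinf ρs ns τ y :=
    (contDiff_slice (contDiffOn_densityVariation href hprof.contDiff_potDeriv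
      hprof.contDiff_velocity) hτ).continuous
  have h2 := (contDiff_slice (f := fun s y => potPressure h (ρinf s y))
    (href.contDiffOn_potPressure hh) hτ).continuous
  exact ((h1.aemeasurable.mul hr).sub ((hprof.contDiff_velocity.continuous.aemeasurable.inner
    hv).const_mul _)).add (hprof.contDiff_potPressure.continuous.sub h2).aemeasurable

lemma abs_entropyShift_le {A : ℝ} {k : Space d → ℝ} {τ : ℝ} (hτ : 0 ≤ τ) {y : Space d} {r η : ℝ}
    {v : Space d} (hst : IsState r v)
    (h1 : (1 + ‖y‖) * |potPressure h (ρinf τ y) - potPressure h (ρs y)| ≤ k y)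
    (h2 : |densityVariation h ρinf ρs ns τ y| * (r + ‖v‖) ≤ A * η + k y)
    (h3 : ‖profileVelocity ρs ns y‖ * ‖v‖ ≤ A * η + k y) (hη : 0 ≤ A * η) :
    |entropyShift h ρinf ρs ns τ y r v| ≤ 3 * (A * η + k y) := by
  have e1 : |densityVariation h ρinf ρs ns τ y * r| ≤ A * η + k y := by
    rw [abs_mul, abs_of_nonneg hst.1]
    refine le_trans (mul_le_mul_of_nonneg_left ?_ (abs_nonneg _)) h2
    linarith [norm_nonneg v]
  have e2 : |Real.exp (-(d * τ)) * inner ℝ (profileVelocity ρs ns y) v| ≤ A * η + k y := by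
    rw [abs_mul, abs_of_pos (Real.exp_pos _)]
    have hexp1 : Real.exp (-(d * τ)) ≤ 1 :=
      Real.exp_le_one_iff.2 (neg_nonpos.2 (mul_nonneg d.cast_nonneg hτ))
    refine le_trans (mul_le_of_le_one_left (abs_nonneg _) hexp1) ?_
    exact (abs_real_inner_le_norm _ _).trans h3
  have e3 : |potPressure h (ρs y) - potPressure h (ρinf τ y)| ≤ A * η + k y := by
    rw [abs_sub_comm]
    have := le_mul_of_one_le_left (abs_nonneg (potPressure h (ρinf τ y) - potPressure h (ρs y)))
      (by linarith [norm_nonneg y] : 1 ≤ 1 + ‖y‖)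
    linarith
  rw [entropyShift]
  have t1 := abs_add_le (densityVariation h ρinf ρs ns τ y * r
    - Real.exp (-(d * τ)) * inner ℝ (profileVelocity ρs ns y) v)
    (potPressure h (ρs y) - potPressure h (ρinf τ y))
  have t2 := abs_sub (densityVariation h ρinf ρs ns τ y * r)
    (Real.exp (-(d * τ)) * inner ℝ (profileVelocity ρs ns y) v)
  linarith

lemma IsFiniteState.integrable_entropyShift (hd : 1 ≤ d) (hp : IsPressure p)
    (hh : IsPotential p h) (href : IsReferenceDensity h ρhat ρinf)
    (hprof : IsRelativeProfile α p h ρhat ρs ns K θ μ κ) {τ : ℝ} (hτ : 0 ≤ τ)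
    {r : Space d → ℝ} {v : Space d → Space d} (hs : IsFiniteState h ρinf τ r v) :
    Integrable fun y => entropyShift h ρinf ρs ns τ y (r y) (v y) := by
  obtain ⟨A, k, hA, hk, hk0, hdom⟩ := exists_domination hp hh href hprof hτ
  refine Integrable.mono' (((hs.integrable.const_mul A).add hk).const_mul 3)
    (aemeasurable_entropyShift hh href hprof hτ hs.density_aemeasurable
      hs.momentum_aemeasurable).aestronglyMeasurable ?_
  filter_upwards [hs.isState, ae_ne_zero hd] with y hy hy0
  obtain ⟨d1, -, d2⟩ := hdom τ ⟨hτ, le_rfl⟩ y hy0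
  obtain ⟨e1, e2, -⟩ := d2 _ _ hy
  exact abs_entropyShift_le hτ hy d1 e1 e2
    (mul_nonneg hA (relEntropyReal_nonneg hp hh hy.1 (href.hasPotDeriv hτ y) _))

lemma IsFiniteState.integrable_profile (hd : 1 ≤ d) (hp : IsPressure p)
    (hh : IsPotential p h) (href : IsReferenceDensity h ρhat ρinf)
    (hprof : IsRelativeProfile α p h ρhat ρs ns K θ μ κ) {τ : ℝ} (hτ : 0 ≤ τ)
    {r : Space d → ℝ} {v : Space d → Space d} (hs : IsFiniteState h ρinf τ r v) :
    Integrable (fun y => relEntropyReal h τ (r y) (v y) (ρs y) (ns y)) ∧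
    relEntropy h τ r v ρs ns ≠ ⊤ ∧
    (relEntropy h τ r v ρs ns).toReal = ∫ y, relEntropyReal h τ (r y) (v y) (ρs y) (ns y) ∧
    (relEntropy h τ r v ρs ns).toReal = (relEntropy h τ r v (ρinf τ) (fun _ => 0)).toReal
      + ∫ y, entropyShift h ρinf ρs ns τ y (r y) (v y) := by
  have h1 := hs.integrable_entropyShift hd hp hh href hprof hτ
  have heq : (fun y => relEntropyReal h τ (r y) (v y) (ρs y) (ns y)) =ᵐ[volume]
      fun y => relEntropyReal h τ (r y) (v y) (ρinf τ y) 0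
        + entropyShift h ρinf ρs ns τ y (r y) (v y) := by
    filter_upwards [hs.isState] with y hy using relEntropyReal_change hy y
  have hi : Integrable fun y => relEntropyReal h τ (r y) (v y) (ρs y) (ns y) :=
    (hs.integrable.add h1).congr heq.symm
  have h2 : relEntropy h τ r v ρs ns
      = ENNReal.ofReal (∫ y, relEntropyReal h τ (r y) (v y) (ρs y) (ns y)) :=
    lintegral_density_of_integrable hp hh (t := fun _ => τ) hs.isState
      (Eventually.of_forall hprof.hasPotDeriv) hi
  have h3 : (relEntropy h τ r v ρs ns).toReal
      = ∫ y, relEntropyReal h τ (r y) (v y) (ρs y) (ns y) := by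
    rw [h2, ENNReal.toReal_ofReal]
    refine integral_nonneg_of_ae ?_
    filter_upwards [hs.isState] with y hy
      using relEntropyReal_nonneg hp hh hy.1 (hprof.hasPotDeriv y) _
  refine ⟨hi, by rw [h2]; exact ENNReal.ofReal_ne_top, h3, ?_⟩
  rw [h3, hs.toReal_relEntropy hp hh href hτ, integral_congr_ae heq, integral_add hs.integrable h1]

lemma intervalIntegrable_of_locallyBoundedVariationOn (hE : LocallyBoundedVariationOn E (Ici 0))
    {σ τ : ℝ} (hσ : 0 ≤ σ) (hτ : 0 ≤ τ) : IntervalIntegrable E volume σ τ := by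
  obtain ⟨f, g, hf, hg, hfg⟩ := hE.exists_monotoneOn_sub_monotoneOn
  have hsub : uIcc σ τ ⊆ Ici 0 := fun x hx => (le_min hσ hτ).trans hx.1
  rw [hfg]
  exact (hf.mono hsub).intervalIntegrable.sub (hg.mono hsub).intervalIntegrable

lemma IsEnergyVariationalSolution.slice
    (hsol : IsEnergyVariationalSolution α p h ρhat ρ₀ n₀ ρ n E ρinf K)
    (hp : IsPressure p) (hh : IsPotential p h) :
    ∀ᵐ τ : ℝ, 0 < τ → IsFiniteState h ρinf τ (ρ τ) (n τ) ∧
      0 ≤ energyDefect h E ρinf τ (ρ τ) (n τ) := by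
  have hprod : (volume : Measure (ℝ × Space d)).restrict (halfSpace d) =
      (volume.restrict (Ici 0)).prod volume := by
    rw [halfSpace, Measure.volume_eq_prod, ← Measure.prod_restrict, Measure.restrict_univ]
  have h1 := hsol.density.aestronglyMeasurable
  have h2 := hsol.momentum.aestronglyMeasurable
  rw [hprod] at h1 h2
  have h1' := (ae_restrict_iff' measurableSet_Ici).1 h1.prodMk_left
  have h2' := (ae_restrict_iff' measurableSet_Ici).1 h2.prodMk_left
  filter_upwards [h1', h2', hsol.energy_ge] with τ e1 e2 e3 hτ
  exact ⟨isFiniteState_of_ne_top hp hh hsol.reference hτ.le (e1 hτ.le).aemeasurable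
    (e2 hτ.le).aemeasurable (e3 hτ).1, sub_nonneg.2 (e3 hτ).2⟩

/-- By Tonelli, the space-time integral of the relative entropy density is at most ∫|E|, which is
finite as E has locally bounded variation. The kinetic part then controls |n|²/ρ with the factor
2e^{dT}. -/
lemma IsEnergyVariationalSolution.slab_state
    (hsol : IsEnergyVariationalSolution α p h ρhat ρ₀ n₀ ρ n E ρinf K)
    (hp : IsPressure p) (hh : IsPotential p h) {T : ℝ} (hT : 0 ≤ T) :
    (∀ᵐ z ∂(volume.restrict (slab d T)), IsState (ρ z.1 z.2) (n z.1 z.2)) ∧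
      IntegrableOn (fun z : ℝ × Space d =>
        relEntropyReal h z.1 (ρ z.1 z.2) (n z.1 z.2) (ρinf z.1 z.2) 0) (slab d T) ∧
      IntegrableOn (fun z : ℝ × Space d => ‖n z.1 z.2‖ ^ 2 / ρ z.1 z.2) (slab d T) := by
  have href := hsol.reference
  have hρ : AEMeasurable (fun z : ℝ × Space d => ρ z.1 z.2) (volume.restrict (slab d T)) :=
    (hsol.density.aestronglyMeasurable.mono_set (slab_subset_halfSpace T)).aemeasurable
  have hn : AEMeasurable (fun z : ℝ × Space d => n z.1 z.2) (volume.restrict (slab d T)) :=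
    (hsol.momentum.aestronglyMeasurable.mono_set (slab_subset_halfSpace T)).aemeasurable
  have hinf : AEMeasurable (fun z : ℝ × Space d => ρinf z.1 z.2) (volume.restrict (slab d T)) :=
    (href.contDiffOn.continuousOn.mono (slab_subset_halfSpace T)).aemeasurable
      (measurableSet_slab T)
  have hs0 : ∀ᵐ z ∂(volume.restrict (slab d T)), HasPotDeriv h (ρinf z.1 z.2) :=
    (ae_restrict_iff' (measurableSet_slab T)).2
      (Eventually.of_forall fun z hz => href.hasPotDeriv hz.1.1.le z.2)
  have hm := aemeasurable_relEntropyDensity hp hh (t := fun z : ℝ × Space d => z.1)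
    (w := fun _ => 0) measurable_fst.aemeasurable hρ hn hinf aemeasurable_const
    (hs0.mono fun z hz => hz.nonneg)
  have hEi : IntegrableOn E (Ioc 0 T) :=
    (intervalIntegrable_of_locallyBoundedVariationOn hsol.energy_bv le_rfl hT).1
  have hfin : ∫⁻ z in slab d T, relEntropyDensity h z.1 (ρ z.1 z.2) (n z.1 z.2) (ρinf z.1 z.2) 0
      ≠ ⊤ := by
    rw [slab, volume_restrict_slab] at hm ⊢
    rw [lintegral_prod _ hm]
    refine ne_top_of_le_ne_top (ne_of_lt hEi.2) (lintegral_mono_ae ?_)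
    refine (ae_restrict_iff' measurableSet_Ioc).2 ?_
    filter_upwards [hsol.energy_ge] with s hs hs'
    obtain ⟨h1, h2⟩ := hs hs'.1
    rw [← ofReal_norm]
    refine (ENNReal.ofReal_toReal h1).symm.le.trans ?_
    exact ENNReal.ofReal_le_ofReal (h2.trans (le_abs_self _))
  obtain ⟨h1, h2, -⟩ := state_and_integrable_of_lintegral_ne_top hp hh
    (t := fun z : ℝ × Space d => z.1) measurable_fst.aemeasurable hρ hn hinf aemeasurable_const
    hs0 hfin
  refine ⟨h1, h2, ?_⟩
  refine Integrable.mono' (h2.const_mul (2 * Real.exp (d * T))) ?_ ?_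
  · exact ((hn.norm.pow_const 2).div hρ).aestronglyMeasurable
  · filter_upwards [h1, hs0, ae_restrict_mem (measurableSet_slab T)] with z hz hz' hmem
    have h3 : 0 ≤ ‖n z.1 z.2‖ ^ 2 / ρ z.1 z.2 := div_nonneg (sq_nonneg _) hz.1
    have h4 := relPot_nonneg hp hh hz.1 hz'
    rw [Real.norm_eq_abs, abs_of_nonneg h3, relEntropyReal_eq_of_zero]
    have h5 : 1 ≤ Real.exp (d * T) * Real.exp (-(d * z.1)) := by
      rw [← Real.exp_add]
      refine Real.one_le_exp ?_
      have := mul_le_mul_of_nonneg_left hmem.1.2 (d.cast_nonneg : (0 : ℝ) ≤ d)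
      linarith
    have h6 : 0 < Real.exp (d * T) := Real.exp_pos _
    nlinarith [mul_le_mul_of_nonneg_right h5 h3, mul_nonneg h6.le h4]

end Solution

/-! ### The localized relative entropy inequality -/

section Localized

variable {d : ℕ} {α θ μ : ℝ} {p h : ℝ → ℝ} {ρhat ρs : Space d → ℝ} {ns : Space d → Space d}
  {K : (Space d → Space d) → ℝ≥0} {κ : Space d → ℝ} {ρinf : ℝ → Space d → ℝ}
  {ρ₀ : Space d → ℝ} {n₀ : Space d → Space d} {ρ : ℝ → Space d → ℝ}
  {n : ℝ → Space d → Space d} {E : ℝ → ℝ} {C₀ : ℝ} {χ : ℕ → Space d → ℝ}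

/-- Each term contains ∇χ exactly once, and the weight 1 + |y| absorbs y·∇χ. The remaining factors
are those bounded in `exists_domination`. -/
lemma abs_cutoffError_le {g : Space d → ℝ} {τ r : ℝ} (hτ : 0 ≤ τ) {y v : Space d}
    (hst : IsState r v) :
    |cutoffError p h ρinf ρs ns g τ y r v| ≤ ‖fderiv ℝ g y‖ * (1 + ‖y‖) *
      (|densityVariation h ρinf ρs ns τ y| * (r + ‖v‖) + ‖profileVelocity ρs ns y‖ * ‖v‖
        + ‖profileVelocity ρs ns y‖ * (‖v‖ ^ 2 / r) + ‖profileVelocity ρs ns y‖ * |p r|) := by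
  have hexp1 : Real.exp (-(d * τ)) ≤ 1 :=
    Real.exp_le_one_iff.2 (neg_nonpos.2 (mul_nonneg d.cast_nonneg hτ))
  have hexp0 := Real.exp_pos (-(d * τ))
  set u := profileVelocity ρs ns y
  set L := fderiv ℝ g y
  set Φ := densityVariation h ρinf ρs ns τ y
  set X := ‖L‖ * (1 + ‖y‖) with hX
  have hLX : ‖L‖ ≤ X := le_mul_of_one_le_right (norm_nonneg _) (by linarith [norm_nonneg y])
  have hLy : |L y| ≤ X := (L.le_opNorm y).trans (by
    rw [hX]
    gcongr
    linarith)
  have hX0 : 0 ≤ X := (norm_nonneg _).trans hLX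
  have hLv : ∀ v : Space d, |L v| ≤ X * ‖v‖ := fun v =>
    (L.le_opNorm v).trans (mul_le_mul_of_nonneg_right hLX (norm_nonneg _))
  have hr := hst.1
  have t1 : |Φ * (r / 2 * L y - L v)| ≤ X * (|Φ| * (r + ‖v‖)) := by
    rw [abs_mul]
    have : |r / 2 * L y - L v| ≤ X * (r + ‖v‖) := by
      refine (abs_sub _ _).trans ?_
      rw [abs_mul, abs_of_nonneg (by positivity : 0 ≤ r / 2)]
      have e1 : r / 2 * |L y| ≤ r / 2 * X := by gcongr
      have e2 := hLv v
      nlinarith [mul_nonneg hr hX0]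
    calc _ ≤ |Φ| * (X * (r + ‖v‖)) := by gcongr
      _ = _ := by ring
  have t2 : |1 / 2 * Real.exp (-(d * τ)) * L y * inner ℝ u v| ≤ X * (‖u‖ * ‖v‖) := by
    rw [abs_mul, abs_mul, abs_of_nonneg (by positivity : 0 ≤ 1 / 2 * Real.exp (-(d * τ)))]
    have e1 := abs_real_inner_le_norm u v
    refine mul_le_mul ?_ e1 (abs_nonneg _) hX0
    calc _ ≤ 1 * |L y| := by gcongr; linarith
      _ ≤ X := by rw [one_mul]; exact hLy
  have t3 : |Real.exp (-(d * τ)) * L v * inner ℝ u (r⁻¹ • v)| ≤ X * (‖u‖ * (‖v‖ ^ 2 / r)) := by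
    rw [abs_mul, abs_mul, abs_of_nonneg hexp0.le]
    have e1 := abs_real_inner_le_norm u (r⁻¹ • v)
    rw [norm_smul, norm_inv, Real.norm_eq_abs, abs_of_nonneg hr] at e1
    calc _ ≤ 1 * (X * ‖v‖) * (‖u‖ * (r⁻¹ * ‖v‖)) := by
          gcongr
          exact hLv v
      _ = _ := by ring
  have t4 : |p r * L u| ≤ X * (‖u‖ * |p r|) := by
    rw [abs_mul]
    calc _ ≤ |p r| * (X * ‖u‖) := by gcongr; exact hLv u
      _ = _ := by ring
  rw [cutoffError]
  have s1 := abs_add_le (Φ * (r / 2 * L y - L v) - 1 / 2 * Real.exp (-(d * τ)) * L y * inner ℝ u v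
    + Real.exp (-(d * τ)) * L v * inner ℝ u (r⁻¹ • v)) (p r * L u)
  have s2 := abs_add_le (Φ * (r / 2 * L y - L v) - 1 / 2 * Real.exp (-(d * τ)) * L y * inner ℝ u v)
    (Real.exp (-(d * τ)) * L v * inner ℝ u (r⁻¹ • v))
  have s3 := abs_sub (Φ * (r / 2 * L y - L v)) (1 / 2 * Real.exp (-(d * τ)) * L y * inner ℝ u v)
  rw [mul_add, mul_add, mul_add]
  linarith

lemma measurableSet_far (j : ℕ) : MeasurableSet {y : Space d | (j : ℝ) < ‖y‖} :=
  measurableSet_lt measurable_const measurable_norm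

/-- The factor 1 - χ_j lies in [0,1] and vanishes for |y| ≤ j. -/
lemma abs_integral_cutoff_sub_le (hχ : IsCutoffSequence C₀ χ) {w : Space d → ℝ}
    (hw : Integrable w) (j : ℕ) :
    Integrable (fun y => χ j y * w y) ∧
    |(∫ y, χ j y * w y) - ∫ y, w y| ≤ ∫ y in {y : Space d | (j : ℝ) < ‖y‖}, |w y| := by
  have h1 : Integrable fun y => χ j y * w y :=
    hw.bdd_mul (c := 1) (hχ.contDiff j).continuous.aestronglyMeasurable
      (Eventually.of_forall fun y => by
        rw [Real.norm_eq_abs, abs_of_nonneg (hχ.nonneg j y)]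
        exact hχ.le_one j y)
  refine ⟨h1, ?_⟩
  rw [← integral_sub h1 hw, ← integral_indicator (measurableSet_far j)]
  refine (abs_integral_le_integral_abs).trans (integral_mono (h1.sub hw).abs
    (hw.abs.indicator (measurableSet_far j)) fun y => ?_)
  by_cases hy : (j : ℝ) < ‖y‖
  · rw [indicator_of_mem (show y ∈ {y : Space d | (j : ℝ) < ‖y‖} from hy)]
    have : χ j y * w y - w y = -((1 - χ j y) * w y) := by ring
    simp only
    rw [this, abs_neg, abs_mul, abs_of_nonneg (by linarith [hχ.le_one j y])]
    exact mul_le_of_le_one_left (abs_nonneg _) (by linarith [hχ.nonneg j y])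
  · rw [indicator_of_notMem (show y ∉ {y : Space d | (j : ℝ) < ‖y‖} from hy)]
    simp [hχ.eq_one j y (not_lt.1 hy)]

lemma IsFiniteState.abs_test_sub_le (hd : 1 ≤ d) (hp : IsPressure p)
    (hh : IsPotential p h) (href : IsReferenceDensity h ρhat ρinf)
    (hprof : IsRelativeProfile α p h ρhat ρs ns K θ μ κ) (hχ : IsCutoffSequence C₀ χ) {τ T : ℝ}
    (hτ : 0 ≤ τ) (hT : τ ≤ T) {r : Space d → ℝ} {v : Space d → Space d}
    (hs : IsFiniteState h ρinf τ r v) (j : ℕ) :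
    |(∫ y, (densityTest h ρinf ρs ns (χ j) T τ y * r y
        + inner ℝ (momentumTest ρs ns (χ j) T τ y) (v y)))
      - ((∫ y, entropyShift h ρinf ρs ns τ y (r y) (v y))
        + ∫ y, χ j y * (potPressure h (ρinf τ y) - potPressure h (ρs y)))|
      ≤ ∫ y in {y : Space d | (j : ℝ) < ‖y‖}, |entropyShift h ρinf ρs ns τ y (r y) (v y)| := by
  obtain ⟨h1, h2⟩ := abs_integral_cutoff_sub_le hχ
    (hs.integrable_entropyShift hd hp hh href hprof hτ) j
  have h3 : Integrable fun y => χ j y * (potPressure h (ρinf τ y) - potPressure h (ρs y)) := by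
    have h4 := (contDiff_slice (f := fun s y => potPressure h (ρinf s y))
      (href.contDiffOn_potPressure hh) hτ).continuous
    exact ((hχ.contDiff j).continuous.mul (h4.sub
      hprof.contDiff_potPressure.continuous)).integrable_of_hasCompactSupport
        (hχ.hasCompactSupport j).mul_right
  have h5 : ∫ y, (densityTest h ρinf ρs ns (χ j) T τ y * r y
        + inner ℝ (momentumTest ρs ns (χ j) T τ y) (v y))
      = (∫ y, χ j y * entropyShift h ρinf ρs ns τ y (r y) (v y))
        + ∫ y, χ j y * (potPressure h (ρinf τ y) - potPressure h (ρs y)) := by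
    rw [← integral_add h1 h3]
    refine integral_congr_ae (Eventually.of_forall fun y => ?_)
    simp only [densityTest_eq hT, momentumTest_eq hT, entropyShift, real_inner_smul_left,
      inner_neg_left]
    ring
  rw [h5]
  convert h2 using 2
  ring

/-- The momentum test function is e^{-ds} times a fixed field. By homogeneity of the weight this
factor cancels e^{ds}, and the weight term has a coefficient constant in time. -/
lemma lintegral_weight_eq (hK : IsRegularityWeight K)
    (hu : ContDiff ℝ 1 (profileVelocity ρs ns)) (hχ : IsCutoffSequence C₀ χ) {σ τ T : ℝ}
    (hσ : 0 ≤ σ) (hστ : σ ≤ τ) (hT : τ ≤ T) (j : ℕ) {D : ℝ → ℝ}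
    (hD : IntegrableOn D (Ioc σ τ)) (hD0 : ∀ᵐ s : ℝ, 0 < s → 0 ≤ D s) :
    ∫⁻ s in Ioc σ τ, ENNReal.ofReal (Real.exp (d * s) * K (momentumTest ρs ns (χ j) T s) * D s) =
      ENNReal.ofReal (K (fun y => χ j y • -profileVelocity ρs ns y) * ∫ s in σ..τ, D s) := by
  have hspatial : IsSpatialTest fun y => χ j y • -profileVelocity ρs ns y :=
    ⟨(hχ.contDiff j).smul hu.neg, (hχ.hasCompactSupport j).smul_right⟩
  rw [intervalIntegral.integral_of_le hστ, ← integral_const_mul, ofReal_integral_eq_lintegral_ofReal]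
  · refine setLIntegral_congr_fun measurableSet_Ioc fun s hs => ?_
    obtain ⟨c, hc⟩ : ∃ c : ℝ≥0, (c : ℝ) = Real.exp (-(d * s)) := ⟨⟨_, (Real.exp_pos _).le⟩, rfl⟩
    have hc0 : 0 < c := by
      rw [← NNReal.coe_pos, hc]
      exact Real.exp_pos _
    have h1 : momentumTest ρs ns (χ j) T s = fun y =>
        (c : ℝ) • (χ j y • -profileVelocity ρs ns y) := by
      rw [hc]
      exact funext fun y => momentumTest_eq (hs.2.trans hT) y
    rw [h1, hK _ hspatial c hc0, NNReal.coe_mul, hc, ← mul_assoc, ← Real.exp_add]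
    simp
  · exact hD.const_mul _
  · refine (ae_restrict_iff' measurableSet_Ioc).2 ?_
    filter_upwards [hD0] with s hs hs'
    exact mul_nonneg NNReal.zero_le_coe (hs (hσ.trans_lt hs'.1))

end Localized

/-! ### The relative entropy inequality -/

section Inequality

variable {d : ℕ} {α θ μ : ℝ} {p h : ℝ → ℝ} {ρhat ρs : Space d → ℝ} {ns : Space d → Space d}
  {K : (Space d → Space d) → ℝ≥0} {κ : Space d → ℝ} {ρinf : ℝ → Space d → ℝ}
  {ρ₀ : Space d → ℝ} {n₀ : Space d → Space d} {ρ : ℝ → Space d → ℝ}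
  {n : ℝ → Space d → Space d} {E : ℝ → ℝ} {C₀ : ℝ} {χ : ℕ → Space d → ℝ}

lemma tendsto_setIntegral_far {X : Type*} [MeasurableSpace X] {ν : Measure X} {f : X → Space d}
    (hf : Measurable f) {g : X → ℝ} (hg : Integrable g ν) :
    Tendsto (fun j : ℕ => ∫ x in {x | (j : ℝ) < ‖f x‖}, g x ∂ν) atTop (𝓝 0) := by
  have h0 : ⋂ j : ℕ, {x | (j : ℝ) < ‖f x‖} = ∅ := by
    refine eq_empty_of_forall_notMem fun x hx => ?_
    obtain ⟨j, hj⟩ := exists_nat_ge ‖f x‖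
    exact hj.not_gt (mem_iInter.1 hx j)
  have h1 := tendsto_setIntegral_of_antitone (μ := ν) (f := g)
    (s := fun j : ℕ => {x | (j : ℝ) < ‖f x‖})
    (fun j => measurableSet_lt measurable_const hf.norm)
    (fun i j hij x (hx : (j : ℝ) < ‖f x‖) =>
      show (i : ℝ) < ‖f x‖ from lt_of_le_of_lt (Nat.cast_le.2 hij) hx) ⟨0, hg.integrableOn⟩
  rwa [h0, setIntegral_empty] at h1

lemma integrable_comp_snd_slab {k : Space d → ℝ} (hk : Integrable k) (σ τ : ℝ) :
    IntegrableOn (fun z : ℝ × Space d => k z.2) (Ioc σ τ ×ˢ univ) := by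
  rw [IntegrableOn, volume_restrict_slab]
  exact hk.comp_snd _

lemma IsEnergyVariationalSolution.slab_profile (hd : 1 ≤ d)
    (hsol : IsEnergyVariationalSolution α p h ρhat ρ₀ n₀ ρ n E ρinf K)
    (hp : IsPressure p) (hh : IsPotential p h)
    (hprof : IsRelativeProfile α p h ρhat ρs ns K θ μ κ) {T : ℝ} (hT : 0 ≤ T) :
    IntegrableOn (fun z : ℝ × Space d =>
        entropyShift h ρinf ρs ns z.1 z.2 (ρ z.1 z.2) (n z.1 z.2)) (slab d T) ∧
      IntegrableOn (fun z : ℝ × Space d =>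
        relEntropyReal h z.1 (ρ z.1 z.2) (n z.1 z.2) (ρs z.2) (ns z.2)) (slab d T) := by
  have href := hsol.reference
  obtain ⟨hst, hη, -⟩ := hsol.slab_state hp hh hT
  have hρ : AEMeasurable (fun z : ℝ × Space d => ρ z.1 z.2) (volume.restrict (slab d T)) :=
    (hsol.density.aestronglyMeasurable.mono_set (slab_subset_halfSpace T)).aemeasurable
  have hn : AEMeasurable (fun z : ℝ × Space d => n z.1 z.2) (volume.restrict (slab d T)) :=
    (hsol.momentum.aestronglyMeasurable.mono_set (slab_subset_halfSpace T)).aemeasurable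
  obtain ⟨A, k, hA, hk, hk0, hdom⟩ := exists_domination hp hh href hprof hT
  have hm : AEMeasurable (fun z : ℝ × Space d =>
      entropyShift h ρinf ρs ns z.1 z.2 (ρ z.1 z.2) (n z.1 z.2)) (volume.restrict (slab d T)) := by
    have h1 := ((contDiffOn_densityVariation href hprof.contDiff_potDeriv
      hprof.contDiff_velocity).continuousOn.mono (slab_subset_halfSpace T)).aemeasurable
        (μ := volume) (measurableSet_slab T)
    have h2 := ((href.contDiffOn_potPressure hh).continuousOn.mono
      (slab_subset_halfSpace T)).aemeasurable (μ := volume) (measurableSet_slab T)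
    have h3 : Measurable fun z : ℝ × Space d => profileVelocity ρs ns z.2 :=
      (hprof.contDiff_velocity.continuous.comp continuous_snd).measurable
    have h4 : Measurable fun z : ℝ × Space d => potPressure h (ρs z.2) :=
      (hprof.contDiff_potPressure.continuous.comp continuous_snd).measurable
    have h5 : Measurable fun z : ℝ × Space d => Real.exp (-(d * z.1)) := by fun_prop
    exact ((h1.mul hρ).sub (h5.aemeasurable.mul (h3.aemeasurable.inner hn))).add
      (h4.aemeasurable.sub h2)
  have hw : IntegrableOn (fun z : ℝ × Space d =>
      entropyShift h ρinf ρs ns z.1 z.2 (ρ z.1 z.2) (n z.1 z.2)) (slab d T) := by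
    refine Integrable.mono' (((hη.const_mul A).add (integrable_comp_snd_slab hk 0 T)).const_mul 3)
      hm.aestronglyMeasurable ?_
    filter_upwards [hst, ae_slab_ne_zero hd 0 T, ae_restrict_mem (measurableSet_slab T)]
      with z hz hz0 hmem
    obtain ⟨d1, -, d2⟩ := hdom z.1 ⟨hmem.1.1.le, hmem.1.2⟩ z.2 hz0
    obtain ⟨e1, e2, -⟩ := d2 _ _ hz
    exact abs_entropyShift_le hmem.1.1.le hz d1 e1 e2
      (mul_nonneg hA (relEntropyReal_nonneg hp hh hz.1 (href.hasPotDeriv hmem.1.1.le z.2) _))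
  refine ⟨hw, (hη.add hw).congr ?_⟩
  filter_upwards [hst] with z hz using (relEntropyReal_change hz z.2).symm

lemma IsEnergyVariationalSolution.integrableOn_energyDefect
    (hsol : IsEnergyVariationalSolution α p h ρhat ρ₀ n₀ ρ n E ρinf K)
    (hp : IsPressure p) (hh : IsPotential p h) {T : ℝ} (hT : 0 ≤ T) :
    IntegrableOn (fun s => energyDefect h E ρinf s (ρ s) (n s)) (Ioc 0 T) := by
  obtain ⟨-, hη, -⟩ := hsol.slab_state hp hh hT
  rw [slab, IntegrableOn, volume_restrict_slab] at hη
  have hEi : IntegrableOn E (Ioc 0 T) :=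
    (intervalIntegrable_of_locallyBoundedVariationOn hsol.energy_bv le_rfl hT).1
  refine (hEi.sub hη.integral_prod_left).congr ?_
  refine (ae_restrict_iff' measurableSet_Ioc).2 ?_
  filter_upwards [hsol.slice hp hh] with s hs hs'
  obtain ⟨h1, -⟩ := hs hs'.1
  simp only [energyDefect, Pi.sub_apply]
  rw [h1.toReal_relEntropy hp hh hsol.reference hs'.1.le]

end Inequality

/-! ### Pointwise lower bound for the localized space-time integrand -/

section Step

variable {d : ℕ} {α θ μ : ℝ} {p h : ℝ → ℝ} {ρhat ρs : Space d → ℝ} {ns : Space d → Space d}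
  {K : (Space d → Space d) → ℝ≥0} {κ : Space d → ℝ} {ρinf : ℝ → Space d → ℝ}
  {ρ₀ : Space d → ℝ} {n₀ : Space d → Space d} {ρ : ℝ → Space d → ℝ}
  {n : ℝ → Space d → Space d} {E : ℝ → ℝ} {C₀ : ℝ} {χ : ℕ → Space d → ℝ}

set_option maxHeartbeats 800000 in
/-- The space-time integrand of the energy-variational inequality is bounded from below by the
dissipation of the relative entropy, up to a majorant on the complement of a ball. -/
lemma IsEnergyVariationalSolution.exists_integrand_ge (hd : 1 ≤ d)
    (hsol : IsEnergyVariationalSolution α p h ρhat ρ₀ n₀ ρ n E ρinf K)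
    (hp : IsPressure p) (hh : IsPotential p h)
    (hprof : IsRelativeProfile α p h ρhat ρs ns K θ μ κ) (hχ : IsCutoffSequence C₀ χ) {T : ℝ}
    (hT : 0 ≤ T) :
    ∃ H : ℝ × Space d → ℝ, IntegrableOn H (slab d T) ∧
      ∀ j : ℕ, ∀ᵐ z ∂(volume.restrict (slab d T)),
        χ j z.2 * (-spaceTimeDeriv (fun s y => potPressure h (ρinf s y) - potPressure h (ρs y))
              z (1, 0)
            + 1 / 2 * spaceTimeDeriv (fun s y => potPressure h (ρinf s y) - potPressure h (ρs y))
              z (0, z.2)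
            + d / 2 * (potPressure h (ρinf z.1 z.2) - potPressure h (ρs z.2))
            + traceCLM d (fderiv ℝ (fun y => potPressure h (ρs y) • profileVelocity ρs ns y) z.2))
          + fderiv ℝ (χ j) z.2 ((1 / 2 * (potPressure h (ρinf z.1 z.2) - potPressure h (ρs z.2)))
              • z.2 + potPressure h (ρs z.2) • profileVelocity ρs ns z.2)
          + (d / 2 * entropyShift h ρinf ρs ns z.1 z.2 (ρ z.1 z.2) (n z.1 z.2)
            - ((θ + μ * Real.exp (-(d / 2 * z.1)))
                * relEntropyReal h z.1 (ρ z.1 z.2) (n z.1 z.2) (ρs z.2) (ns z.2)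
              + Real.exp (-(d / 2 * z.1)) * κ z.2))
          - {z : ℝ × Space d | (j : ℝ) < ‖z.2‖}.indicator H z
        ≤ α * (‖n z.1 z.2‖ ^ 2 / ρ z.1 z.2)
          - densityIntegrand ρ n (densityTest h ρinf ρs ns (χ j) T) z.1 z.2
          - momentumIntegrand α p ρ n (momentumTest ρs ns (χ j) T) z.1 z.2
          - referenceIntegrand h ρ n ρinf z.1 z.2 := by
  have href := hsol.reference
  obtain ⟨hst, hη, hq⟩ := hsol.slab_state hp hh hT
  obtain ⟨hw, -⟩ := hsol.slab_profile hd hp hh hprof hT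
  obtain ⟨A, k, hA, hk, hk0, hdom⟩ := exists_domination hp hh href hprof hT
  have hki := integrable_comp_snd_slab hk 0 T
  have hC₀ : 0 ≤ C₀ := (mul_nonneg (norm_nonneg (fderiv ℝ (χ 0) 0)) (by positivity)).trans
    (hχ.norm_fderiv_mul_le 0 0)
  -- The first summand pays for the terms that are not tested and appear with 1 - χ_j, the second
  -- for (d/2)(1 - χ_j) times the entropy shift, the third for all terms with ∇χ_j: four from
  -- `cutoffError` and one from the explicit flux.
  refine ⟨fun z => |α * (‖n z.1 z.2‖ ^ 2 / ρ z.1 z.2) - referenceIntegrand h ρ n ρinf z.1 z.2|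
    + d / 2 * |entropyShift h ρinf ρs ns z.1 z.2 (ρ z.1 z.2) (n z.1 z.2)|
    + C₀ * (4 * (A * relEntropyReal h z.1 (ρ z.1 z.2) (n z.1 z.2) (ρinf z.1 z.2) 0 + k z.2)
      + 2 * k z.2), ?_, fun j => ?_⟩
  · exact ((((hq.const_mul α).sub (hsol.reference_integrable T)).abs).add
      (hw.abs.const_mul _)).add (((((hη.const_mul A).add hki).const_mul 4).add
        (hki.const_mul 2)).const_mul C₀)
  filter_upwards [hst, ae_slab_ne_zero hd 0 T, ae_restrict_mem (measurableSet_slab T)]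
    with z hz hz0 hmem
  obtain ⟨s, y⟩ := z
  obtain ⟨⟨hs0, hsT⟩, -⟩ := hmem
  simp only at hz hz0 hs0 hsT ⊢
  obtain ⟨d1, d2, d3⟩ := hdom s ⟨hs0.le, hsT⟩ y hz0
  obtain ⟨e1, e2, -, e3, e4⟩ := d3 _ _ hz
  rw [relative_identity hh href hprof.contDiff_potDeriv hprof.contDiff_potPressure
    hprof.contDiff_velocity hprof.flux (hχ.contDiff j) hs0 hsT y hz]
  have hdis := hprof.dissipation s hs0.le y _ _ hz
  have hη0 := relEntropyReal_nonneg hp hh (τ := s) (v := n s y) hz.1 (hprof.hasPotDeriv y) (ns y)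
  have hcut := abs_cutoffError_le (p := p) (h := h) (ρinf := ρinf) (ρs := ρs) (ns := ns)
    (g := χ j) hs0.le (y := y) hz
  have hχ0 := hχ.nonneg j y
  have hχ1 := hχ.le_one j y
  set w := entropyShift h ρinf ρs ns s y (ρ s y) (n s y) with hwdef
  rw [entropyShift] at hwdef
  rw [← hwdef]
  set f := potPressure h (ρinf s y) - potPressure h (ρs y) with hf
  set G := -spaceTimeDeriv (fun s y => potPressure h (ρinf s y) - potPressure h (ρs y))
      (s, y) (1, 0)
    + 1 / 2 * spaceTimeDeriv (fun s y => potPressure h (ρinf s y) - potPressure h (ρs y))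
      (s, y) (0, y) + d / 2 * f
    + traceCLM d (fderiv ℝ (fun y => potPressure h (ρs y) • profileVelocity ρs ns y) y)
  set D := (θ + μ * Real.exp (-(d / 2 * s))) * relEntropyReal h s (ρ s y) (n s y) (ρs y) (ns y)
    + Real.exp (-(d / 2 * s)) * κ y with hD
  have hD0 : 0 ≤ D := by
    have := hprof.theta_nonneg
    have := hprof.mu_nonneg
    have := hprof.kappa_nonneg y
    positivity
  -- The bound survives multiplication with χ_j ∈ [0,1] because D ≥ 0.
  have hdis' : -D ≤ χ j y * relDissipation α p h ρs ns s y (ρ s y) (n s y) := by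
    have := mul_le_mul_of_nonneg_left hdis hχ0
    nlinarith [mul_le_mul_of_nonneg_right hχ1 hD0]
  -- Where |y| ≤ j, one has χ_j = 1 and ∇χ_j = 0, and only the dissipation bound is used; the
  -- majorant is needed where |y| > j.
  by_cases hy : (j : ℝ) < ‖y‖
  · rw [indicator_of_mem (show (s, y) ∈ {z : ℝ × Space d | (j : ℝ) < ‖z.2‖} from hy)]
    set B := A * relEntropyReal h s (ρ s y) (n s y) (ρinf s y) 0 + k y
    set N := α * (‖n s y‖ ^ 2 / ρ s y) - referenceIntegrand h ρ n ρinf s y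
    have c1 : |cutoffError p h ρinf ρs ns (χ j) s y (ρ s y) (n s y)| ≤ C₀ * (4 * B) := by
      refine hcut.trans (mul_le_mul (hχ.norm_fderiv_mul_le j y) (by linarith) ?_ hC₀)
      have := hz.1
      positivity
    have c2 : |fderiv ℝ (χ j) y ((1 / 2 * f) • y + potPressure h (ρs y) • profileVelocity ρs ns y)|
        ≤ C₀ * (2 * k y) := by
      refine ((fderiv ℝ (χ j) y).le_opNorm _).trans ?_
      have h1 : ‖(1 / 2 * f) • y + potPressure h (ρs y) • profileVelocity ρs ns y‖ ≤ 2 * k y := by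
        refine (norm_add_le _ _).trans ?_
        rw [norm_smul, Real.norm_eq_abs, abs_mul, abs_of_pos (by norm_num : (0 : ℝ) < 1 / 2)]
        nlinarith [abs_nonneg f, norm_nonneg y, mul_nonneg (abs_nonneg f) (norm_nonneg y)]
      have h2 : ‖fderiv ℝ (χ j) y‖ ≤ C₀ :=
        (le_mul_of_one_le_right (norm_nonneg _) (by linarith [norm_nonneg y])).trans
          (hχ.norm_fderiv_mul_le j y)
      exact mul_le_mul h2 h1 (norm_nonneg _) hC₀
    have c3 : -|N| ≤ (1 - χ j y) * N := by
      have h1 : |(1 - χ j y) * N| ≤ |N| := by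
        rw [abs_mul, abs_of_nonneg (by linarith)]
        exact mul_le_of_le_one_left (abs_nonneg _) (by linarith)
      exact (neg_le_neg h1).trans (neg_abs_le _)
    have c4 : d / 2 * w - d / 2 * |w| ≤ d / 2 * (χ j y * w) := by
      have h1 : |(1 - χ j y) * w| ≤ |w| := by
        rw [abs_mul, abs_of_nonneg (by linarith)]
        exact mul_le_of_le_one_left (abs_nonneg _) (by linarith)
      have h2 := (abs_le.1 h1).2
      have h3 : (0 : ℝ) ≤ d / 2 := by positivity
      nlinarith
    have c5 := (abs_le.1 c1).1
    have c6 := (abs_le.1 c2).2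
    linarith
  · rw [indicator_of_notMem (show (s, y) ∉ {z : ℝ × Space d | (j : ℝ) < ‖z.2‖} from hy)]
    have h1 := hχ.eq_one j y (not_lt.1 hy)
    have h2 := hχ.fderiv_eq_zero j y (not_lt.1 hy)
    have h3 : cutoffError p h ρinf ρs ns (χ j) s y (ρ s y) (n s y) = 0 := by
      simp [cutoffError, h2]
    rw [h3, h2, zero_apply]
    rw [h1] at hdis' ⊢
    linarith

end Step

/-! ### Removal of the spatial cutoff -/

section Relative

variable {d : ℕ} {α θ μ : ℝ} {p h : ℝ → ℝ} {ρhat ρs : Space d → ℝ} {ns : Space d → Space d}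
  {K : (Space d → Space d) → ℝ≥0} {κ : Space d → ℝ} {ρinf : ℝ → Space d → ℝ}
  {ρ₀ : Space d → ℝ} {n₀ : Space d → Space d} {ρ : ℝ → Space d → ℝ}
  {n : ℝ → Space d → Space d} {E : ℝ → ℝ} {C₀ : ℝ} {χ : ℕ → Space d → ℝ}

/-- The energy-variational inequality as an inequality between real numbers. -/
lemma IsEnergyVariationalSolution.real_inequality
    (hsol : IsEnergyVariationalSolution α p h ρhat ρ₀ n₀ ρ n E ρinf K)
    (hp : IsPressure p) (hh : IsPotential p h)
    (hprof : IsRelativeProfile α p h ρhat ρs ns K θ μ κ) (hχ : IsCutoffSequence C₀ χ) {σ τ T : ℝ}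
    (hσ : 0 ≤ σ) (hστ : σ < τ) (hT : τ ≤ T) {rσ : Space d → ℝ} {vσ : Space d → Space d} (j : ℕ)
    (hineq : EnvarInequality α p h ρ n E ρinf K (densityTest h ρinf ρs ns (χ j) T)
      (momentumTest ρs ns (χ j) T) σ τ rσ vσ) :
    let F : ℝ × Space d → ℝ := fun z => α * (‖n z.1 z.2‖ ^ 2 / ρ z.1 z.2)
          - densityIntegrand ρ n (densityTest h ρinf ρs ns (χ j) T) z.1 z.2
          - momentumIntegrand α p ρ n (momentumTest ρs ns (χ j) T) z.1 z.2
          - referenceIntegrand h ρ n ρinf z.1 z.2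
    IntegrableOn F (Ioc σ τ ×ˢ univ) ∧
    (E τ + ∫ y, (densityTest h ρinf ρs ns (χ j) T τ y * ρ τ y
        + inner ℝ (momentumTest ρs ns (χ j) T τ y) (n τ y)))
      - (E σ + ∫ y, (densityTest h ρinf ρs ns (χ j) T σ y * rσ y
        + inner ℝ (momentumTest ρs ns (χ j) T σ y) (vσ y)))
      + (∫ s in σ..τ, (d : ℝ) / 2 * E s) + ∫ z in Ioc σ τ ×ˢ univ, F z
      ≤ K (fun y => χ j y • -profileVelocity ρs ns y) *
        ∫ s in σ..τ, energyDefect h E ρinf s (ρ s) (n s) := by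
  intro F
  have hT0 : 0 ≤ T := hσ.trans (hστ.le.trans hT)
  have hsub := slab_Ioc_subset (d := d) hσ hT
  have hφ : IsTestFunction (densityTest h ρinf ρs ns (χ j) T) :=
    isTestFunction_densityTest hsol.reference hprof.contDiff_potDeriv hprof.contDiff_velocity
      (hχ.contDiff j) (hχ.hasCompactSupport j) T
  have hψ : IsTestFunction (momentumTest ρs ns (χ j) T) :=
    isTestFunction_momentumTest hprof.contDiff_velocity (hχ.contDiff j) (hχ.hasCompactSupport j) T
  obtain ⟨-, -, hq⟩ := hsol.slab_state hp hh hT0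
  have i1 : IntegrableOn (fun z : ℝ × Space d => α * (‖n z.1 z.2‖ ^ 2 / ρ z.1 z.2))
      (Ioc σ τ ×ˢ univ) := (hq.mono_set hsub).const_mul α
  have i2 := (integrableOn_densityIntegrand hφ hsol.density hsol.momentum T).mono_set hsub
  have i3 := (integrableOn_momentumIntegrand (α := α) hψ hsol.density hsol.momentum
    hsol.pressure_integrable hq).mono_set hsub
  have i4 := (hsol.reference_integrable T).mono_set hsub
  refine ⟨((i1.sub i2).sub i3).sub i4, ?_⟩
  have hDi := (hsol.integrableOn_energyDefect hp hh hT0).mono_set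
    (Ioc_subset_Ioc hσ hT)
  have hD0 : ∀ᵐ s : ℝ, 0 < s → 0 ≤ energyDefect h E ρinf s (ρ s) (n s) := by
    filter_upwards [hsol.slice hp hh] with s hs hs' using (hs hs').2
  have h1 := lintegral_weight_eq hsol.weight hprof.contDiff_velocity hχ hσ hστ.le hT j hDi hD0
  rw [EnvarInequality] at hineq
  have h2 : (∫⁻ s in Ioc σ τ, ENNReal.ofReal (Real.exp (d * s) *
      K (momentumTest ρs ns (χ j) T s) *
        (E s - (relEntropy h s (ρ s) (n s) (ρinf s) (fun _ => 0)).toReal))) = _ := h1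
  rw [h2] at hineq
  have h3 : 0 ≤ ∫ s in σ..τ, energyDefect h E ρinf s (ρ s) (n s) := by
    rw [intervalIntegral.integral_of_le hστ.le]
    refine integral_nonneg_of_ae ((ae_restrict_iff' measurableSet_Ioc).2 ?_)
    filter_upwards [hD0] with s hs hs' using hs (hσ.trans_lt hs'.1)
  -- Since the right-hand side is nonnegative, the truncation of the left-hand side at 0 by
  -- `ENNReal.ofReal` loses nothing.
  have h4 := (ENNReal.ofReal_le_ofReal_iff (mul_nonneg NNReal.zero_le_coe h3)).1 hineq
  have h5 : ∫ z in Ioc σ τ ×ˢ univ, F z =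
      (∫ s in σ..τ, ∫ y, α * (‖n s y‖ ^ 2 / ρ s y))
      - (∫ s in σ..τ, ∫ y, densityIntegrand ρ n (densityTest h ρinf ρs ns (χ j) T) s y)
      - (∫ s in σ..τ, ∫ y, momentumIntegrand α p ρ n (momentumTest ρs ns (χ j) T) s y)
      - ∫ s in σ..τ, ∫ y, referenceIntegrand h ρ n ρinf s y := by
    rw [intervalIntegral_eq_slab (F := fun s y => α * (‖n s y‖ ^ 2 / ρ s y)) hστ.le i1, intervalIntegral_eq_slab hστ.le i2,
      intervalIntegral_eq_slab hστ.le i3, intervalIntegral_eq_slab hστ.le i4,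
      ← integral_sub' i1 i2, ← integral_sub' (i1.sub i2) i3, ← integral_sub' ((i1.sub i2).sub i3) i4]
    rfl
  rw [h5]
  linarith

set_option maxHeartbeats 800000 in
/-- The relative entropy inequality. -/
lemma IsEnergyVariationalSolution.relative_inequality (hd : 1 ≤ d)
    (hsol : IsEnergyVariationalSolution α p h ρhat ρ₀ n₀ ρ n E ρinf K)
    (hp : IsPressure p) (hh : IsPotential p h)
    (hprof : IsRelativeProfile α p h ρhat ρs ns K θ μ κ) (hχ : IsCutoffSequence C₀ χ) {σ τ T : ℝ}
    (hσ : 0 ≤ σ) (hστ : σ < τ) (hT : τ ≤ T) {rσ : Space d → ℝ} {vσ : Space d → Space d}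
    (hsσ : IsFiniteState h ρinf σ rσ vσ) (hsτ : IsFiniteState h ρinf τ (ρ τ) (n τ))
    (hineq : ∀ j, EnvarInequality α p h ρ n E ρinf K (densityTest h ρinf ρs ns (χ j) T)
      (momentumTest ρs ns (χ j) T) σ τ rσ vσ) :
    (E τ + ∫ y, entropyShift h ρinf ρs ns τ y (ρ τ y) (n τ y))
      - (E σ + ∫ y, entropyShift h ρinf ρs ns σ y (rσ y) (vσ y))
      + (∫ s in σ..τ, (d : ℝ) / 2 * E s)
      + ∫ z in Ioc σ τ ×ˢ (univ : Set (Space d)),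
          (d / 2 * entropyShift h ρinf ρs ns z.1 z.2 (ρ z.1 z.2) (n z.1 z.2)
            - ((θ + μ * Real.exp (-(d / 2 * z.1)))
                * relEntropyReal h z.1 (ρ z.1 z.2) (n z.1 z.2) (ρs z.2) (ns z.2)
              + Real.exp (-(d / 2 * z.1)) * κ z.2))
      ≤ θ * ∫ s in σ..τ, energyDefect h E ρinf s (ρ s) (n s) := by
  have href := hsol.reference
  have hT0 : 0 ≤ T := hσ.trans (hστ.le.trans hT)
  have hsub := slab_Ioc_subset (d := d) hσ hT
  obtain ⟨H, hHi, hH⟩ := hsol.exists_integrand_ge hd hp hh hprof hχ hT0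
  obtain ⟨hw, hη⟩ := hsol.slab_profile hd hp hh hprof hT0
  obtain ⟨Cw, hCw, hweight⟩ := hprof.weight_le
  have hwσ := hsσ.integrable_entropyShift hd hp hh href hprof hσ
  have hwτ := hsτ.integrable_entropyShift hd hp hh href hprof (hσ.trans hστ.le)
  set I := ∫ s in σ..τ, energyDefect h E ρinf s (ρ s) (n s) with hI
  have hI0 : 0 ≤ I := by
    rw [hI, intervalIntegral.integral_of_le hστ.le]
    refine integral_nonneg_of_ae ((ae_restrict_iff' measurableSet_Ioc).2 ?_)
    filter_upwards [hsol.slice hp hh] with s hs hs' using (hs (hσ.trans_lt hs'.1)).2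
  set G : ℝ × Space d → ℝ := fun z =>
    d / 2 * entropyShift h ρinf ρs ns z.1 z.2 (ρ z.1 z.2) (n z.1 z.2)
      - ((θ + μ * Real.exp (-(d / 2 * z.1)))
          * relEntropyReal h z.1 (ρ z.1 z.2) (n z.1 z.2) (ρs z.2) (ns z.2)
        + Real.exp (-(d / 2 * z.1)) * κ z.2) with hG
  have hexp : ∀ z ∈ slab d T, Real.exp (-(d / 2 * z.1)) ≤ 1 := fun z hz =>
    Real.exp_le_one_iff.2 (neg_nonpos.2 (mul_nonneg (by positivity) hz.1.1.le))
  have hGi : IntegrableOn G (Ioc σ τ ×ˢ univ) := by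
    refine IntegrableOn.mono_set ?_ hsub
    refine (hw.const_mul _).sub (Integrable.add ?_ ?_)
    · refine hη.bdd_mul (c := θ + μ) (by fun_prop) ?_
      filter_upwards [ae_restrict_mem (measurableSet_slab T)] with z hz
      have h1 := hprof.theta_nonneg
      have h2 := hprof.mu_nonneg
      rw [Real.norm_eq_abs, abs_of_nonneg (by positivity)]
      have := mul_le_mul_of_nonneg_left (hexp z hz) h2
      linarith
    · refine (integrable_comp_snd_slab hprof.kappa_integrable 0 T).bdd_mul (c := 1)
        (by fun_prop) ?_
      filter_upwards [ae_restrict_mem (measurableSet_slab T)] with z hz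
      rw [Real.norm_eq_abs, abs_of_pos (Real.exp_pos _)]
      exact hexp z hz
  have hHS := hHi.mono_set hsub
  have hmeas : ∀ j : ℕ, MeasurableSet {z : ℝ × Space d | (j : ℝ) < ‖z.2‖} := fun j =>
    measurableSet_lt measurable_const measurable_snd.norm
  -- All errors caused by the cutoff vanish: the weight of the cut field exceeds θ by O(1/(j+1)),
  -- and the other errors are integrals of fixed integrable functions over {|y| > j}.
  have hlim : Tendsto (fun j : ℕ => (θ + Cw * (C₀ / ((j : ℝ) + 1))) * I
      + ((∫ y in {y : Space d | (j : ℝ) < ‖y‖}, |entropyShift h ρinf ρs ns τ y (ρ τ y) (n τ y)|)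
        + (∫ y in {y : Space d | (j : ℝ) < ‖y‖}, |entropyShift h ρinf ρs ns σ y (rσ y) (vσ y)|)
        + ∫ z in {z : ℝ × Space d | (j : ℝ) < ‖z.2‖}, H z
            ∂(volume.restrict (Ioc σ τ ×ˢ (univ : Set (Space d)))))) atTop
      (𝓝 ((θ + Cw * 0) * I + (0 + 0 + 0))) := by
    refine Tendsto.add (Tendsto.mul_const _ (Tendsto.const_add _ (Tendsto.const_mul _ ?_))) ?_
    · exact tendsto_const_nhds.div_atTop
        (tendsto_atTop_add_const_right _ _ tendsto_natCast_atTop_atTop)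
    · exact ((tendsto_setIntegral_far measurable_id hwτ.abs).add
        (tendsto_setIntegral_far measurable_id hwσ.abs)).add
        (tendsto_setIntegral_far measurable_snd hHS)
  rw [mul_zero, add_zero, add_zero, add_zero, add_zero] at hlim
  refine ge_of_tendsto' hlim fun j => ?_
  obtain ⟨hFi, hF⟩ := hsol.real_inequality hp hh hprof hχ hσ hστ hT j (hineq j)
  have b1 := (abs_le.1 (hsτ.abs_test_sub_le hd hp hh href hprof hχ (hσ.trans hστ.le) hT j)).1
  have b2 := (abs_le.1 (hsσ.abs_test_sub_le hd hp hh href hprof hχ hσ (hστ.le.trans hT) j)).2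
  obtain ⟨x1, x2, x3⟩ := integral_explicit
    (f := fun s y => potPressure h (ρinf s y) - potPressure h (ρs y))
    (V := fun y => potPressure h (ρs y) • profileVelocity ρs ns y)
    (contDiffOn_pressureDifference hh href hprof.contDiff_potPressure) (hχ.contDiff j)
    (hχ.hasCompactSupport j) (hprof.contDiff_potPressure.smul hprof.contDiff_velocity) hσ hστ.le
  have hHj := hHS.indicator (hmeas j)
  have b3 := integral_mono_ae (((x1.add x2).add hGi).sub hHj) hFi
    (ae_restrict_of_ae_restrict_of_subset hsub (hH j))
  have b4 : ∫ z in Ioc σ τ ×ˢ (univ : Set (Space d)),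
      ({z : ℝ × Space d | (j : ℝ) < ‖z.2‖}.indicator H z) = _ :=
    integral_indicator (hmeas j)
  -- The boundary terms ∫ χ_j(π(ρ∞) - π(ρ*)) in `x3` cancel those in `b1` and `b2`, and the flux
  -- integral in `x3` cancels the integral of the second summand in `b3`.
  rw [integral_sub' ((x1.add x2).add hGi) hHj, integral_add' (x1.add x2) hGi, integral_add' x1 x2,
    x3, b4] at b3
  have b5 : (K (fun y => χ j y • -profileVelocity ρs ns y) : ℝ) * I
      ≤ (θ + Cw * (C₀ / ((j : ℝ) + 1))) * I :=
    mul_le_mul_of_nonneg_right (hweight (χ j) _ (hχ.contDiff j) (hχ.hasCompactSupport j)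
      (fun y => ⟨hχ.nonneg j y, hχ.le_one j y⟩) (hχ.norm_fderiv_le j)) hI0
  linarith

end Relative

/-! ### Convergence to a profile with controlled dissipation -/

section Convergence

variable {d : ℕ} {α θ μ : ℝ} {p h : ℝ → ℝ} {ρhat ρs : Space d → ℝ} {ns : Space d → Space d}
  {K : (Space d → Space d) → ℝ≥0} {κ : Space d → ℝ} {ρinf : ℝ → Space d → ℝ}
  {ρ₀ : Space d → ℝ} {n₀ : Space d → Space d} {ρ : ℝ → Space d → ℝ}
  {n : ℝ → Space d → Space d} {E : ℝ → ℝ} {C₀ : ℝ} {χ : ℕ → Space d → ℝ}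

/-- For finite states 𝓡 is E plus the integral of the entropy shift, so the two terms with d/2 give
-(d/2)𝓡. The defect receives the rate θ from the weight, the relative entropy receives θ +
μe^{-ds/2} from the dissipation; the nonnegative term μe^{-ds/2} · defect is added to obtain a
common rate for 𝓡. -/
lemma IsEnergyVariationalSolution.totalDeviation_le (hd : 1 ≤ d)
    (hsol : IsEnergyVariationalSolution α p h ρhat ρ₀ n₀ ρ n E ρinf K)
    (hp : IsPressure p) (hh : IsPotential p h)
    (hprof : IsRelativeProfile α p h ρhat ρs ns K θ μ κ) (hχ : IsCutoffSequence C₀ χ) {σ τ T : ℝ}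
    (hσ : 0 ≤ σ) (hστ : σ < τ) (hT : τ ≤ T) {rσ : Space d → ℝ} {vσ : Space d → Space d}
    (hsσ : IsFiniteState h ρinf σ rσ vσ) (hsτ : IsFiniteState h ρinf τ (ρ τ) (n τ))
    (hineq : ∀ j, EnvarInequality α p h ρ n E ρinf K (densityTest h ρinf ρs ns (χ j) T)
      (momentumTest ρs ns (χ j) T) σ τ rσ vσ) :
    totalDeviation h E ρinf ρs ns τ (ρ τ) (n τ) ≤ totalDeviation h E ρinf ρs ns σ rσ vσ +
      ∫ s in σ..τ, ((-((d : ℝ) / 2 - θ) + μ * Real.exp (-(d / 2 * s)))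
        * totalDeviation h E ρinf ρs ns s (ρ s) (n s)
        + (∫ y, κ y) * Real.exp (-(d / 2 * s))) := by
  have href := hsol.reference
  have hT0 : 0 ≤ T := hσ.trans (hστ.le.trans hT)
  have hsub := slab_Ioc_subset (d := d) hσ hT
  have hIoc := Ioc_subset_Ioc hσ hT
  have hmain := hsol.relative_inequality hd hp hh hprof hχ hσ hστ hT hsσ hsτ hineq
  have hval : ∀ {t : ℝ} {r : Space d → ℝ} {v : Space d → Space d}, 0 ≤ t →
      IsFiniteState h ρinf t r v → totalDeviation h E ρinf ρs ns t r v
        = E t + ∫ y, entropyShift h ρinf ρs ns t y (r y) (v y) := by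
    intro t r v ht hs
    obtain ⟨-, -, -, h4⟩ := hs.integrable_profile hd hp hh href hprof ht
    rw [totalDeviation, energyDefect, h4]
    ring
  obtain ⟨hw, hη⟩ := hsol.slab_profile hd hp hh hprof hT0
  have hEi : IntegrableOn E (Ioc σ τ) :=
    (intervalIntegrable_of_locallyBoundedVariationOn hsol.energy_bv hσ (hσ.trans hστ.le)).1
  have hDi := (hsol.integrableOn_energyDefect hp hh hT0).mono_set hIoc
  have hw' := hw.mono_set hsub
  have hη' := hη.mono_set hsub
  rw [IntegrableOn, volume_restrict_slab] at hw' hη'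
  set W : ℝ → ℝ := fun s => ∫ y, entropyShift h ρinf ρs ns s y (ρ s y) (n s y) with hW
  set S : ℝ → ℝ := fun s => ∫ y, relEntropyReal h s (ρ s y) (n s y) (ρs y) (ns y) with hS
  set e : ℝ → ℝ := fun s => Real.exp (-(d / 2 * s)) with he
  have hWi : IntegrableOn W (Ioc σ τ) := hw'.integral_prod_left
  have hSi : IntegrableOn S (Ioc σ τ) := hη'.integral_prod_left
  have hei : IntegrableOn e (Ioc σ τ) :=
    ((by fun_prop : Continuous e).integrableOn_Icc).mono_set Ioc_subset_Icc_self
  have hexp : ∀ s ∈ Ioc σ τ, e s ≤ 1 := fun s hs =>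
    Real.exp_le_one_iff.2 (neg_nonpos.2 (mul_nonneg (by positivity) (hσ.trans hs.1.le)))
  have hcS : IntegrableOn (fun s => (θ + μ * e s) * S s) (Ioc σ τ) := by
    refine Integrable.bdd_mul (c := θ + μ) hSi (by fun_prop) ?_
    filter_upwards [ae_restrict_mem measurableSet_Ioc] with s hs
    have h1 := hprof.theta_nonneg
    have h2 := hprof.mu_nonneg
    have h3 : 0 ≤ e s := (Real.exp_pos _).le
    rw [Real.norm_eq_abs, abs_of_nonneg (by positivity)]
    have := mul_le_mul_of_nonneg_left (hexp s hs) h2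
    linarith
  -- the space-time integral as an iterated integral
  have hcS' : Integrable (fun z : ℝ × Space d => (θ + μ * e z.1)
      * relEntropyReal h z.1 (ρ z.1 z.2) (n z.1 z.2) (ρs z.2) (ns z.2))
      ((volume.restrict (Ioc σ τ)).prod volume) := by
    refine hη'.bdd_mul (c := θ + μ) (by fun_prop) ?_
    rw [← volume_restrict_slab]
    filter_upwards [ae_restrict_mem (measurableSet_Ioc.prod MeasurableSet.univ)] with z hz
    have h1 := hprof.theta_nonneg
    have h2 := hprof.mu_nonneg
    have h3 : 0 ≤ e z.1 := (Real.exp_pos _).le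
    rw [Real.norm_eq_abs, abs_of_nonneg (by positivity)]
    have := mul_le_mul_of_nonneg_left (hexp z.1 hz.1) h2
    linarith
  have hκ' : Integrable (fun z : ℝ × Space d => e z.1 * κ z.2)
      ((volume.restrict (Ioc σ τ)).prod volume) := Integrable.mul_prod hei hprof.kappa_integrable
  have hsum : Integrable (fun z : ℝ × Space d => (θ + μ * e z.1)
      * relEntropyReal h z.1 (ρ z.1 z.2) (n z.1 z.2) (ρs z.2) (ns z.2) + e z.1 * κ z.2)
      ((volume.restrict (Ioc σ τ)).prod volume) := hcS'.add hκ'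
  have hslab : ∫ z in Ioc σ τ ×ˢ (univ : Set (Space d)),
      (d / 2 * entropyShift h ρinf ρs ns z.1 z.2 (ρ z.1 z.2) (n z.1 z.2)
        - ((θ + μ * e z.1) * relEntropyReal h z.1 (ρ z.1 z.2) (n z.1 z.2) (ρs z.2) (ns z.2)
          + e z.1 * κ z.2))
      = (∫ s in Ioc σ τ, d / 2 * W s) - ((∫ s in Ioc σ τ, (θ + μ * e s) * S s)
        + ∫ s in Ioc σ τ, (∫ y, κ y) * e s) := by
    rw [volume_restrict_slab, integral_sub (hw'.const_mul _) hsum,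
      integral_add hcS' hκ', integral_prod _ (hw'.const_mul _), integral_prod _ hcS',
      integral_prod _ hκ']
    simp only [integral_const_mul, hW, hS]
    congr 2
    rw [integral_mul_const]
    ring
  have hmain' : (E τ + W τ) - (E σ + ∫ y, entropyShift h ρinf ρs ns σ y (rσ y) (vσ y))
      + (∫ s in Ioc σ τ, (d : ℝ) / 2 * E s) + ((∫ s in Ioc σ τ, d / 2 * W s)
        - ((∫ s in Ioc σ τ, (θ + μ * e s) * S s) + ∫ s in Ioc σ τ, (∫ y, κ y) * e s))
      ≤ θ * ∫ s in Ioc σ τ, energyDefect h E ρinf s (ρ s) (n s) := by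
    rw [← hslab, ← intervalIntegral.integral_of_le hστ.le, ← intervalIntegral.integral_of_le hστ.le]
    exact hmain
  rw [hval (hσ.trans hστ.le) hsτ, hval hσ hsσ, intervalIntegral.integral_of_le hστ.le]
  have hle : (∫ s in Ioc σ τ, (θ * energyDefect h E ρinf s (ρ s) (n s) - d / 2 * E s - d / 2 * W s
      + (θ + μ * e s) * S s + (∫ y, κ y) * e s)) ≤
      ∫ s in Ioc σ τ, ((-((d : ℝ) / 2 - θ) + μ * e s)
        * totalDeviation h E ρinf ρs ns s (ρ s) (n s) + (∫ y, κ y) * e s) := by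
    have hfi : IntegrableOn (fun s => (-((d : ℝ) / 2 - θ) + μ * e s)
        * (energyDefect h E ρinf s (ρ s) (n s) + S s)) (Ioc σ τ) := by
      refine Integrable.bdd_mul (c := |(d : ℝ) / 2 - θ| + μ) (hDi.add hSi) (by fun_prop) ?_
      filter_upwards [ae_restrict_mem measurableSet_Ioc] with s hs
      have h2 := hprof.mu_nonneg
      have h3 : 0 ≤ e s := (Real.exp_pos _).le
      refine (norm_add_le _ _).trans ?_
      rw [norm_neg, Real.norm_eq_abs, Real.norm_eq_abs, abs_of_nonneg (mul_nonneg h2 h3)]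
      have := mul_le_mul_of_nonneg_left (hexp s hs) h2
      linarith
    have hall : ∀ᵐ s ∂(volume.restrict (Ioc σ τ)), S s
        = (relEntropy h s (ρ s) (n s) ρs ns).toReal ∧
        totalDeviation h E ρinf ρs ns s (ρ s) (n s) = E s + W s ∧
        0 ≤ energyDefect h E ρinf s (ρ s) (n s) := by
      refine (ae_restrict_iff' measurableSet_Ioc).2 ?_
      filter_upwards [hsol.slice hp hh] with s hs hs'
      obtain ⟨f1, f2⟩ := hs (hσ.trans_lt hs'.1)
      obtain ⟨-, -, f3, -⟩ := f1.integrable_profile hd hp hh href hprof (hσ.trans hs'.1.le)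
      exact ⟨f3.symm, hval (hσ.trans hs'.1.le) f1, f2⟩
    refine integral_mono_ae ((((hDi.const_mul θ).sub (hEi.const_mul _)).sub
      (hWi.const_mul _)).add hcS |>.add (hei.const_mul _)) ?_ ?_
    · refine (hfi.add (hei.const_mul (∫ y, κ y))).congr ?_
      filter_upwards [hall] with s hs
      simp only [Pi.add_apply, totalDeviation, hs.1]
    · filter_upwards [hall, ae_restrict_mem measurableSet_Ioc] with s hs hs'
      obtain ⟨f1, f2, f3⟩ := hs
      have h2 := mul_nonneg hprof.mu_nonneg (Real.exp_pos (-(d / 2 * s))).le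
      have f4 : energyDefect h E ρinf s (ρ s) (n s) + S s = E s + W s := by
        rw [← f2, totalDeviation, f1]
      simp only [he]
      have f5 : (d : ℝ) / 2 * E s + d / 2 * W s
          = d / 2 * (energyDefect h E ρinf s (ρ s) (n s) + S s) := by rw [f4]; ring
      rw [f2, ← f4]
      linarith [mul_nonneg h2 f3]
  have hsplit : (∫ s in Ioc σ τ, (θ * energyDefect h E ρinf s (ρ s) (n s) - d / 2 * E s
      - d / 2 * W s + (θ + μ * e s) * S s + (∫ y, κ y) * e s))
      = θ * (∫ s in Ioc σ τ, energyDefect h E ρinf s (ρ s) (n s))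
        - (∫ s in Ioc σ τ, (d : ℝ) / 2 * E s) - (∫ s in Ioc σ τ, (d : ℝ) / 2 * W s)
        + (∫ s in Ioc σ τ, (θ + μ * e s) * S s) + ∫ s in Ioc σ τ, (∫ y, κ y) * e s := by
    rw [integral_add, integral_add, integral_sub, integral_sub, integral_const_mul]
    · exact hDi.const_mul θ
    · exact hEi.const_mul _
    · exact (hDi.const_mul θ).sub (hEi.const_mul _)
    · exact hWi.const_mul _
    · exact ((hDi.const_mul θ).sub (hEi.const_mul _)).sub (hWi.const_mul _)
    · exact hcS
    · exact (((hDi.const_mul θ).sub (hEi.const_mul _)).sub (hWi.const_mul _)).add hcS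
    · exact hei.const_mul _
  linarith

/-- Finiteness is assumed relative to ρ̂. The density ρ∞(0) differs from it in a ball only, where
the change of the base point is integrable: ρ₀ is locally integrable, and h'(ρ̂) is bounded there,
because it differs from the continuous h'(ρ*) by a bounded function. -/
lemma IsEnergyVariationalSolution.initial_ne_top (hd : 1 ≤ d)
    (hsol : IsEnergyVariationalSolution α p h ρhat ρ₀ n₀ ρ n E ρinf K)
    (hp : IsPressure p) (hh : IsPotential p h)
    (hprof : IsRelativeProfile α p h ρhat ρs ns K θ μ κ) :
    relEntropy h 0 ρ₀ n₀ (ρinf 0) (fun _ => 0) ≠ ⊤ := by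
  have href := hsol.reference
  have hρ := hsol.initial_density.aestronglyMeasurable.aemeasurable
  have hn := hsol.initial_momentum.aestronglyMeasurable.aemeasurable
  have hhat : ∀ᵐ y : Space d, HasPotDeriv h (ρhat y) := by
    filter_upwards [ae_ne_zero hd] with y hy using hprof.limit_hasPotDeriv y hy
  obtain ⟨hst, hint, -⟩ := state_and_integrable_of_lintegral_ne_top hp hh (t := fun _ => (0 : ℝ))
    (w := fun _ => (0 : Space d)) aemeasurable_const hρ hn hprof.limit_aemeasurable
    aemeasurable_const hhat hsol.initial_finite
  obtain ⟨R, hR0, hR⟩ := href.eq_far 0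
  have hBi : ∀ c : ℝ, IntegrableOn (fun _ => c) (Metric.closedBall (0 : Space d) R) := fun c =>
    continuousOn_const.integrableOn_compact (isCompact_closedBall _ _)
  have hB := isCompact_closedBall (0 : Space d) R
  have hρ0 : IntegrableOn ρ₀ (Metric.closedBall 0 R) :=
    hsol.initial_density.integrableOn_isCompact hB
  have ha : Continuous fun y => potDeriv h (ρinf 0 y) :=
    (contDiff_slice (f := fun s y => potDeriv h (ρinf s y)) href.contDiffOn_potDeriv le_rfl).continuous
  have hπ : Continuous fun y => potPressure h (ρinf 0 y) :=
    (contDiff_slice (f := fun s y => potPressure h (ρinf s y))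
      (href.contDiffOn_potPressure hh) le_rfl).continuous
  obtain ⟨Ma, hMa⟩ := hB.exists_bound_of_continuousOn ha.continuousOn
  have hb := hprof.contDiff_potDeriv.continuous
  obtain ⟨Mb, hMb⟩ := hB.exists_bound_of_continuousOn hb.continuousOn
  obtain ⟨Md, hMd⟩ := hprof.potDeriv_sub_le
  have hi1 : IntegrableOn (fun y => potDeriv h (ρhat y) * ρ₀ y) (Metric.closedBall 0 R) := by
    refine Integrable.bdd_mul (c := Md + Mb) hρ0
      ((aemeasurable_potDeriv hp hh hprof.limit_aemeasurable
        (hhat.mono fun y hy => hy.nonneg)).aestronglyMeasurable.restrict) ?_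
    filter_upwards [ae_restrict_mem hB.measurableSet, ae_restrict_of_ae (ae_ne_zero hd)]
      with y hy hy0
    have h1 := hMd y hy0
    have h2 := hMb y hy
    rw [Real.norm_eq_abs] at h2 ⊢
    have := abs_sub_abs_le_abs_sub (potDeriv h (ρhat y)) (potDeriv h (ρs y))
    linarith
  have hi2 : IntegrableOn (fun y => potDeriv h (ρinf 0 y) * ρ₀ y) (Metric.closedBall 0 R) := by
    refine Integrable.bdd_mul (c := Ma) hρ0 ha.aestronglyMeasurable ?_
    filter_upwards [ae_restrict_mem hB.measurableSet] with y hy using hMa y hy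
  have hi3 : IntegrableOn (fun y => potPressure h (ρhat y)) (Metric.closedBall 0 R) := by
    have h1 : IntegrableOn (fun y => potPressure h (ρhat y) - potPressure h (ρs y))
        (Metric.closedBall 0 R) := by
      refine (hprof.potPressure_sub_integrable.mono ?_ ?_).integrableOn
      · exact ((aemeasurable_potPressure hp hh hprof.limit_aemeasurable
          (hhat.mono fun y hy => hy.nonneg)).sub
          hprof.contDiff_potPressure.continuous.aemeasurable).aestronglyMeasurable
      · refine Eventually.of_forall fun y => ?_
        rw [norm_mul, Real.norm_eq_abs, Real.norm_eq_abs, Real.norm_eq_abs, abs_abs,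
          abs_of_nonneg (by positivity : 0 ≤ 1 + ‖y‖)]
        exact le_mul_of_one_le_left (abs_nonneg _) (by linarith [norm_nonneg y])
    have h2 := hprof.contDiff_potPressure.continuous.continuousOn.integrableOn_compact (μ := volume) hB
    refine (h1.add h2).congr (Eventually.of_forall fun y => ?_)
    simp
  have hi4 := hπ.continuousOn.integrableOn_compact (μ := volume) hB
  have hcorr : Integrable ((Metric.closedBall (0 : Space d) R).indicator fun y =>
      potDeriv h (ρhat y) * ρ₀ y - potDeriv h (ρinf 0 y) * ρ₀ y
        + (potPressure h (ρinf 0 y) - potPressure h (ρhat y))) :=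
    (integrable_indicator_iff hB.measurableSet).2 ((hi1.sub hi2).add (hi4.sub hi3))
  have hint' : Integrable fun y => relEntropyReal h 0 (ρ₀ y) (n₀ y) (ρinf 0 y) 0 := by
    refine (hint.add hcorr).congr (Eventually.of_forall fun y => ?_)
    simp only [Pi.add_apply]
    by_cases hy : y ∈ Metric.closedBall (0 : Space d) R
    · rw [indicator_of_mem hy, relEntropyReal_eq_of_zero, relEntropyReal_eq_of_zero,
        relPot_change h (ρ₀ y) (ρhat y) (ρinf 0 y)]
      ring
    · rw [indicator_of_notMem hy, hR 0 ⟨le_rfl, le_rfl⟩ y (by simpa using hy), add_zero]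
  have h1 : relEntropy h 0 ρ₀ n₀ (ρinf 0) (fun _ => 0) = ENNReal.ofReal _ :=
    lintegral_density_of_integrable hp hh (t := fun _ => (0 : ℝ)) (w := fun _ => 0) hst
      (Eventually.of_forall fun y => href.hasPotDeriv le_rfl y) hint'
  rw [h1]
  exact ENNReal.ofReal_ne_top

end Convergence

/-! ### Exceptional null sets and exponential decay -/

section Convergence

variable {d : ℕ} {α θ μ : ℝ} {p h : ℝ → ℝ} {ρhat ρs : Space d → ℝ} {ns : Space d → Space d}
  {K : (Space d → Space d) → ℝ≥0} {κ : Space d → ℝ} {ρinf : ℝ → Space d → ℝ}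
  {ρ₀ : Space d → ℝ} {n₀ : Space d → Space d} {ρ : ℝ → Space d → ℝ}
  {n : ℝ → Space d → Space d} {E : ℝ → ℝ}

/-- The exceptional times depend on the test functions, so the family has to be countable. In the
application the two indices are an integer time horizon above τ and the number of the spatial
cutoff. -/
lemma IsEnergyVariationalSolution.ae_inequality
    (hsol : IsEnergyVariationalSolution α p h ρhat ρ₀ n₀ ρ n E ρinf K)
    {φ : ℕ × ℕ → ℝ → Space d → ℝ} {ψ : ℕ × ℕ → ℝ → Space d → Space d}
    (hφ : ∀ i, IsTestFunction (φ i)) (hψ : ∀ i, IsTestFunction (ψ i)) :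
    (∀ᵐ σ : ℝ, 0 < σ → ∀ᵐ τ : ℝ, σ < τ →
        ∀ i, EnvarInequality α p h ρ n E ρinf K (φ i) (ψ i) σ τ (ρ σ) (n σ)) ∧
      (∀ᵐ τ : ℝ, 0 < τ → ∀ i, EnvarInequality α p h ρ n E ρinf K (φ i) (ψ i) 0 τ ρ₀ n₀) := by
  have h1 := fun i => hsol.inequality (φ i) (ψ i) (hφ i) (hψ i)
  constructor
  · filter_upwards [ae_all_iff.2 fun i => (h1 i).1] with σ hσ hσ0
    filter_upwards [ae_all_iff.2 fun i => hσ i hσ0] with τ hτ hτ0 i using hτ i hτ0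
  · filter_upwards [ae_all_iff.2 fun i => (h1 i).2] with τ hτ hτ0 i using hτ i hτ0

lemma IsEnergyVariationalSolution.totalDeviation_nonneg
    (hsol : IsEnergyVariationalSolution α p h ρhat ρ₀ n₀ ρ n E ρinf K)
    (hp : IsPressure p) (hh : IsPotential p h) :
    ∀ᵐ t : ℝ, 0 < t → 0 ≤ totalDeviation h E ρinf ρs ns t (ρ t) (n t) := by
  filter_upwards [hsol.slice hp hh] with t ht ht0
    using add_nonneg (ht ht0).2 ENNReal.toReal_nonneg

lemma IsEnergyVariationalSolution.intervalIntegrable_totalDeviation (hd : 1 ≤ d)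
    (hsol : IsEnergyVariationalSolution α p h ρhat ρ₀ n₀ ρ n E ρinf K)
    (hp : IsPressure p) (hh : IsPotential p h)
    (hprof : IsRelativeProfile α p h ρhat ρs ns K θ μ κ) {t : ℝ} (ht : 0 ≤ t) :
    IntervalIntegrable (fun s => totalDeviation h E ρinf ρs ns s (ρ s) (n s)) volume 0 t := by
  rw [intervalIntegrable_iff_integrableOn_Ioc_of_le ht]
  obtain ⟨-, hη⟩ := hsol.slab_profile hd hp hh hprof ht
  rw [slab, IntegrableOn, volume_restrict_slab] at hη
  refine ((hsol.integrableOn_energyDefect hp hh ht).add hη.integral_prod_left).congr ?_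
  refine (ae_restrict_iff' measurableSet_Ioc).2 ?_
  filter_upwards [hsol.slice hp hh] with s hs hs'
  obtain ⟨-, -, f3, -⟩ := (hs hs'.1).1.integrable_profile hd hp hh hsol.reference hprof hs'.1.le
  simp only [Pi.add_apply, totalDeviation]
  rw [f3]

/-- Convergence to a profile with controlled relative dissipation. -/
theorem IsRelativeProfile.convergesToProfile (hd : 1 ≤ d)
    (hsol : IsEnergyVariationalSolution α p h ρhat ρ₀ n₀ ρ n E ρinf K)
    (hp : IsPressure p) (hh : IsPotential p h)
    (hprof : IsRelativeProfile α p h ρhat ρs ns K θ μ κ) (hθκ : θ = 0 → ∫ y, κ y = 0) :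
    ConvergesToProfile h ρ₀ n₀ ρ n E ρinf ρs ns θ μ ((∫ y, κ y) / θ) := by
  have href := hsol.reference
  have hd0 : (0 : ℝ) < d := Nat.cast_pos.2 hd
  have hfin0 := hsol.initial_ne_top hd hp hh hprof
  have hs0 : IsFiniteState h ρinf 0 ρ₀ n₀ := isFiniteState_of_ne_top hp hh href le_rfl
    hsol.initial_density.aestronglyMeasurable.aemeasurable
    hsol.initial_momentum.aestronglyMeasurable.aemeasurable hfin0
  obtain ⟨C₀, -, χ, hχ⟩ := exists_cutoffSequence d
  have hslice := hsol.slice hp hh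
  obtain ⟨hin1, hin2⟩ := hsol.ae_inequality
    (φ := fun i => densityTest h ρinf ρs ns (χ i.2) i.1) (ψ := fun i => momentumTest ρs ns (χ i.2) i.1)
    (fun i => isTestFunction_densityTest href hprof.contDiff_potDeriv hprof.contDiff_velocity
      (hχ.contDiff i.2) (hχ.hasCompactSupport i.2) i.1)
    (fun i => isTestFunction_momentumTest hprof.contDiff_velocity (hχ.contDiff i.2)
      (hχ.hasCompactSupport i.2) i.1)
  have hdecay := gronwall_exp_ae (f := fun t => totalDeviation h E ρinf ρs ns t (ρ t) (n t))
    (f₀ := totalDeviation h E ρinf ρs ns 0 ρ₀ n₀) (c := (d : ℝ) / 2) (by positivity)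
    hprof.theta_nonneg hprof.mu_nonneg (integral_nonneg hprof.kappa_nonneg) hθκ
    (fun t ht => hsol.intervalIntegrable_totalDeviation hd hp hh hprof ht)
    (hsol.totalDeviation_nonneg hp hh) (by
      filter_upwards [hin1, hslice] with σ hσ hσs hσ0
      filter_upwards [hσ hσ0, hslice] with τ hτ hτs hστ
      obtain ⟨T, hT⟩ := exists_nat_ge τ
      exact hsol.totalDeviation_le hd hp hh hprof hχ hσ0.le hστ hT (hσs hσ0).1
        (hτs (hσ0.trans hστ)).1 fun j => hτ hστ (T, j)) (by
      filter_upwards [hin2, hslice] with τ hτ hτs hτ0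
      obtain ⟨T, hT⟩ := exists_nat_ge τ
      exact hsol.totalDeviation_le hd hp hh hprof hχ le_rfl hτ0 hT hs0
        (hτs hτ0).1 fun j => hτ hτ0 (T, j))
  have hfin : ∀ᵐ τ : ℝ, 0 < τ → relEntropy h τ (ρ τ) (n τ) ρs ns ≠ ⊤ := by
    filter_upwards [hslice] with τ hτ hτ0
      using ((hτ hτ0).1.integrable_profile hd hp hh href hprof hτ0.le).2.1
  have hdecay' : ∀ᵐ τ : ℝ, 0 < τ → totalDeviation h E ρinf ρs ns τ (ρ τ) (n τ) ≤
      Real.exp (-((d : ℝ) / 2 - θ) * τ + 2 * μ / d) *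
        (totalDeviation h E ρinf ρs ns 0 ρ₀ n₀ + (∫ y, κ y) / θ) := by
    filter_upwards [hdecay] with τ hτ hτ0
    have h1 := hτ hτ0
    have h2 : μ / ((d : ℝ) / 2) = 2 * μ / d := by field_simp
    rwa [h2] at h1
  have hlim : θ < (d : ℝ) / 2 → Tendsto (fun τ : ℝ =>
      Real.exp (-((d : ℝ) / 2 - θ) * τ + 2 * μ / d) *
        (totalDeviation h E ρinf ρs ns 0 ρ₀ n₀ + (∫ y, κ y) / θ)) (atTop ⊓ ae volume) (𝓝 0) := by
    intro hθ
    have h1 : Tendsto (fun τ : ℝ => -((d : ℝ) / 2 - θ) * τ + 2 * μ / d) atTop atBot :=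
      tendsto_atBot_add_const_right _ _
        (tendsto_id.const_mul_atTop_of_neg (by linarith))
    have h2 := (Real.tendsto_exp_atBot.comp h1).mul_const
      (totalDeviation h E ρinf ρs ns 0 ρ₀ n₀ + (∫ y, κ y) / θ)
    rw [zero_mul] at h2
    exact h2.mono_left inf_le_left
  have hpos : ∀ᶠ τ : ℝ in atTop ⊓ ae volume, 0 < τ :=
    (eventually_gt_atTop 0).filter_mono inf_le_left
  have hae : ∀ {P : ℝ → Prop}, (∀ᵐ τ : ℝ, 0 < τ → P τ) → ∀ᶠ τ in atTop ⊓ ae volume, P τ := by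
    intro P hP
    filter_upwards [hP.filter_mono inf_le_right, hpos] with τ h1 h2 using h1 h2
  have hdef0 : ∀ᵐ τ : ℝ, 0 < τ → 0 ≤ energyDefect h E ρinf τ (ρ τ) (n τ) := by
    filter_upwards [hslice] with τ hτ hτ0 using (hτ hτ0).2
  refine ⟨hfin0, (hs0.integrable_profile hd hp hh href hprof le_rfl).2.1, hfin, hdecay',
    fun hθ => ?_, fun hθ => ?_⟩
  · refine tendsto_of_tendsto_of_tendsto_of_le_of_le' tendsto_const_nhds (hlim hθ) (hae hdef0) ?_
    filter_upwards [hae hdecay'] with τ hτ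
    exact (le_add_of_nonneg_right ENNReal.toReal_nonneg).trans hτ
  · have h1 : Tendsto (fun τ => (relEntropy h τ (ρ τ) (n τ) ρs ns).toReal)
        (atTop ⊓ ae volume) (𝓝 0) := by
      refine tendsto_of_tendsto_of_tendsto_of_le_of_le' tendsto_const_nhds (hlim hθ)
        (Eventually.of_forall fun τ => ENNReal.toReal_nonneg) ?_
      filter_upwards [hae hdecay', hae hdef0] with τ hτ hτ0
      exact (le_add_of_nonneg_left hτ0).trans hτ
    have h2 := ENNReal.tendsto_ofReal h1
    rw [ENNReal.ofReal_zero] at h2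
    refine h2.congr' ?_
    filter_upwards [hae hfin] with τ hτ using ENNReal.ofReal_toReal hτ

end Convergence

/-! ### Constant profiles -/

section Constant

variable {d : ℕ} {α : ℝ} {p h : ℝ → ℝ} {ρhat ρs : Space d → ℝ} {ns : Space d → Space d}
  {K : (Space d → Space d) → ℝ≥0} {ρinf : ℝ → Space d → ℝ}

/-- Homogeneity gives K(0) = K(2 · 0) = 2K(0). -/
lemma IsRegularityWeight.apply_zero (hK : IsRegularityWeight K) : K (fun _ => 0) = 0 := by
  have h1 := hK (fun _ => 0) ⟨contDiff_const, HasCompactSupport.zero⟩ 2 two_pos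
  simp only [smul_zero] at h1
  have h2 : (K (fun _ => 0) : ℝ) = 2 * K (fun _ => 0) := by exact_mod_cast h1
  have h3 : (K (fun _ => 0) : ℝ) = 0 := by linarith
  exact_mod_cast h3

/-- At large |y| the reference density takes the value c, and h' is well defined at all its values.
For c = 0 this yields the differentiability of h at 0. -/
lemma IsReferenceDensity.hasPotDeriv_of_const (hd : 1 ≤ d)
    (href : IsReferenceDensity h ρhat ρinf) {c : ℝ} (hc : ∀ y, ρhat y = c) : HasPotDeriv h c := by
  obtain ⟨R, hR0, hR⟩ := href.eq_far 0
  have h1 : R < ‖EuclideanSpace.single (⟨0, hd⟩ : Fin d) (R + 1)‖ := by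
    rw [PiLp.norm_single, Real.norm_eq_abs, abs_of_pos (by linarith)]
    linarith
  rw [← hc (EuclideanSpace.single (⟨0, hd⟩ : Fin d) (R + 1)), ← hR 0 ⟨le_rfl, le_rfl⟩ _ h1]
  exact href.hasPotDeriv le_rfl _

/-- The velocity is 0 and h'(ρ*) is constant, so all differences and derivatives vanish. The
relative dissipation reduces to αr|v/r|² ≥ 0. -/
lemma isRelativeProfile_const (hα : 0 ≤ α) {c : ℝ} (hc : HasPotDeriv h c)
    (hK : IsRegularityWeight K) (hhat : ∀ y, ρhat y = c) (hs : ∀ y, ρs y = c)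
    (hns : ∀ y, ns y = 0) :
    IsRelativeProfile α p h ρhat ρs ns K 0 0 (fun _ => 0) := by
  obtain rfl : ρhat = fun _ => c := funext hhat
  obtain rfl : ρs = fun _ => c := funext hs
  obtain rfl : ns = fun _ => 0 := funext hns
  have hu : profileVelocity (fun _ : Space d => c) (fun _ => 0) = fun _ => 0 :=
    funext fun y => smul_zero _
  refine ⟨le_rfl, le_rfl, fun _ => le_rfl, integrable_zero _ _ _, fun _ _ => hc, aemeasurable_const,
    ⟨c, fun _ _ => le_rfl⟩, fun _ => hc, contDiff_const,
    contDiff_const, by rw [hu]; exact contDiff_const, fun y v => ?_, ?_, ⟨0, fun y _ => ?_⟩, ?_,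
    ⟨|potPressure h c|, fun _ => le_rfl⟩, by rw [hu]; exact integrable_zero _ _ _, ⟨0, fun y => ?_⟩,
    ⟨0, fun _ => 0, le_rfl, integrable_zero _ _ _, fun y r _ => ?_⟩, ⟨0, le_rfl, fun χ δ _ _ _ _ => ?_⟩,
    fun τ _ y r v hst => ?_⟩
  · simp [hu]
  · simp
  · simp
  · simp
  · simp [hu]
  · simp [hu]
  · simp [hu, hK.apply_zero]
  · simp only [relDissipation, hu, fderiv_fun_const, Pi.zero_apply, zero_apply, map_zero]
    have := mul_nonneg (mul_nonneg hα hst.1) (sq_nonneg ‖r⁻¹ • v‖)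
    simpa using this

end Constant

/-! ### The potential of a `γ`-law -/

section GammaLaw

variable {k γ : ℝ} {p h : ℝ → ℝ}

lemma IsGammaLaw.hasDerivAt (hg : IsGammaLaw k γ p) {z : ℝ} (hz : 0 < z) :
    HasDerivAt p (k * γ * z ^ (γ - 1)) z := by
  have h1 : HasDerivAt (fun z : ℝ => k * z ^ γ) (k * (γ * z ^ (γ - 1))) z :=
    (Real.hasDerivAt_rpow_const (Or.inl hz.ne')).const_mul k
  rw [mul_assoc]
  refine h1.congr_of_eventuallyEq ?_
  filter_upwards [Ioi_mem_nhds hz] with x hx using hg.2.2 x (le_of_lt hx)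

lemma IsGammaLaw.isPressure (hg : IsGammaLaw k γ p) : IsPressure p := by
  refine ⟨?_, ?_, fun z hz => ?_⟩
  · refine ContinuousOn.congr (f := fun z : ℝ => k * z ^ γ) ?_ fun z hz => hg.2.2 z hz
    exact continuousOn_const.mul
      (continuousOn_id.rpow_const fun z _ => Or.inr (by linarith [hg.2.1]))
  · refine ContDiffOn.congr (f := fun z : ℝ => k * z ^ γ) ?_ fun z hz => hg.2.2 z (le_of_lt hz)
    exact contDiffOn_const.mul (contDiffOn_id.rpow_const_of_ne fun z hz => (ne_of_gt hz))
  · rw [(hg.hasDerivAt hz).deriv]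
    have h1 := hg.1
    have h2 : 0 < γ := by linarith [hg.2.1]
    positivity

lemma IsGammaLaw.hasDerivAt_potDeriv (hg : IsGammaLaw k γ p) (hh : IsPotential p h) {z : ℝ}
    (hz : 0 < z) : HasDerivAt (potDeriv h) (k * γ * z ^ (γ - 2)) z := by
  refine (_root_.hasDerivAt_potDeriv hg.isPressure hh hz).congr_deriv ?_
  rw [(hg.hasDerivAt hz).deriv, show γ - 1 = γ - 2 + 1 by ring, Real.rpow_add_one hz.ne']
  field_simp

lemma IsGammaLaw.hasDerivAt_potential (hh : IsPotential p h) {z : ℝ} (hz : 0 < z) :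
    HasDerivAt h (potDeriv h z) z := by
  rw [potDeriv_of_pos hz]
  exact (hh.differentiableAt z hz).hasDerivAt

open scoped ContDiff in
lemma IsGammaLaw.contDiffOn_potDeriv (hg : IsGammaLaw k γ p) (hh : IsPotential p h) :
    ContDiffOn ℝ ∞ (potDeriv h) (Ioi 0) := by
  rw [contDiffOn_infty_iff_deriv_of_isOpen isOpen_Ioi]
  refine ⟨fun z hz => (hg.hasDerivAt_potDeriv hh hz).differentiableAt.differentiableWithinAt, ?_⟩
  refine ContDiffOn.congr (f := fun z : ℝ => k * γ * z ^ (γ - 2)) ?_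
    fun z hz => (hg.hasDerivAt_potDeriv hh hz).deriv
  exact contDiffOn_const.mul (contDiffOn_id.rpow_const_of_ne fun z hz => (ne_of_gt hz))

lemma hasDerivAt_relPot (hh : IsPotential p h) {r : ℝ} (hr : 0 < r) (s : ℝ) :
    HasDerivAt (fun r => relPot h r s) (potDeriv h r - potDeriv h s) r := by
  have h1 := IsGammaLaw.hasDerivAt_potential hh hr
  refine ((h1.sub_const (h s)).sub (((hasDerivAt_id r).sub_const s).const_mul
    (potDeriv h s))).congr_deriv ?_
  simp

lemma continuousOn_relPot (hh : IsPotential p h) (s : ℝ) :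
    ContinuousOn (fun r => relPot h r s) (Ici 0) :=
  (hh.continuousOn.sub continuousOn_const).sub (by fun_prop)

/-- The relative potential of a `γ`-law is a multiple of the relative pressure. -/
lemma IsGammaLaw.mul_relPot (hg : IsGammaLaw k γ p) (hh : IsPotential p h) {r s : ℝ} (hr : 0 ≤ r)
    (hs : 0 < s) : (γ - 1) * relPot h r s = p r - p s - k * γ * s ^ (γ - 1) * (r - s) := by
  -- The function (γ-1)h' - p' is constant on (0,∞), since h'' = p'/z = kγz^{γ-2} and p'' =
  -- (γ-1)kγz^{γ-2}.
  have hD : ∀ z, 0 < z → (γ - 1) * potDeriv h z - k * γ * z ^ (γ - 1)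
      = (γ - 1) * potDeriv h s - k * γ * s ^ (γ - 1) := by
    have h1 : ∀ z ∈ Ioi (0 : ℝ), HasDerivAt
        (fun z => (γ - 1) * potDeriv h z - k * γ * z ^ (γ - 1)) 0 z := by
      intro z hz
      have e1 := (hg.hasDerivAt_potDeriv hh hz).const_mul (γ - 1)
      have e2 : HasDerivAt (fun z : ℝ => k * γ * z ^ (γ - 1))
          (k * γ * ((γ - 1) * z ^ (γ - 1 - 1))) z :=
        (Real.hasDerivAt_rpow_const (Or.inl (ne_of_gt hz))).const_mul _
      refine (e1.sub e2).congr_deriv ?_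
      rw [show γ - 1 - 1 = γ - 2 by ring]
      ring
    intro z hz
    exact isOpen_Ioi.is_const_of_deriv_eq_zero isPreconnected_Ioi
      (fun x hx => (h1 x hx).differentiableAt.differentiableWithinAt)
      (fun x hx => (h1 x hx).deriv) hz hs
  set G : ℝ → ℝ := fun r => (γ - 1) * relPot h r s - (p r - p s - k * γ * s ^ (γ - 1) * (r - s))
    with hG
  have hGd : ∀ z, 0 < z → HasDerivAt G 0 z := by
    intro z hz
    have e1 := (hasDerivAt_relPot hh hz s).const_mul (γ - 1)
    have e2 := ((hg.hasDerivAt hz).sub_const (p s)).sub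
      (((hasDerivAt_id z).sub_const s).const_mul (k * γ * s ^ (γ - 1)))
    refine (e1.sub e2).congr_deriv ?_
    have := hD z hz
    linarith
  have hGc : ContinuousOn G (Ici 0) :=
    (continuousOn_const.mul (continuousOn_relPot hh s)).sub
      ((hg.isPressure.continuousOn.sub continuousOn_const).sub (by fun_prop))
  have hGdiff : DifferentiableOn ℝ G (interior (Ici 0)) := by
    rw [interior_Ici]
    exact fun z hz => (hGd z hz).differentiableAt.differentiableWithinAt
  -- The derivative of G vanishes on (0,∞) only. Together with continuity on [0,∞), G is both
  -- monotone and antitone, so it is constant up to r = 0.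
  have m1 : MonotoneOn G (Ici 0) := monotoneOn_of_deriv_nonneg (convex_Ici 0) hGc hGdiff (by
    rw [interior_Ici]
    exact fun z hz => (hGd z hz).deriv.ge)
  have m2 : AntitoneOn G (Ici 0) := antitoneOn_of_deriv_nonpos (convex_Ici 0) hGc hGdiff (by
    rw [interior_Ici]
    exact fun z hz => (hGd z hz).deriv.le)
  have hGs : G s = 0 := by simp [hG, relPot]
  have hGr : G r = 0 := by
    rcases le_total r s with hrs | hrs
    · exact le_antisymm (hGs ▸ m1 hr hs.le hrs) (hGs ▸ m2 hr hs.le hrs)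
    · exact le_antisymm (hGs ▸ m2 hs.le hr hrs) (hGs ▸ m1 hs.le hr hrs)
  simp only [hG] at hGr
  linarith

/-- For z ≥ s one has h''(z) = kγz^{γ-2} ≥ ks^{γ-1}/z. Integrating twice gives h(r|s) ≥ ks^{γ-1}(r
log(r/s) - r + s), and 2x ≤ 3 + x log x at x = r/s concludes. The explicit constants produce the
summand |R*|/(2k(ρ*)^γ) of μ. -/
lemma IsGammaLaw.le_relPot (hg : IsGammaLaw k γ p) (hh : IsPotential p h) {r s : ℝ} (hr : 0 ≤ r)
    (hs : 0 < s) : r ≤ s * (2 + relPot h r s / (k * s ^ γ)) := by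
  have hk := hg.1
  have hγ := hg.2.1
  have hks : 0 < k * s ^ γ := by positivity
  have h0 : 0 ≤ relPot h r s := relPot_nonneg hg.isPressure hh hr (Or.inl hs)
  rcases le_or_gt r s with hrs | hrs
  · have : 0 ≤ relPot h r s / (k * s ^ γ) := by positivity
    nlinarith
  -- comparison with the case `γ = 1`
  have hlog : ∀ z, s ≤ z → k * s ^ (γ - 1) * (Real.log z - Real.log s)
      ≤ potDeriv h z - potDeriv h s := by
    have hmono : MonotoneOn (fun z => potDeriv h z - k * s ^ (γ - 1) * Real.log z) (Ici s) := by
      have hd : ∀ z, s ≤ z → HasDerivAt (fun z => potDeriv h z - k * s ^ (γ - 1) * Real.log z)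
          (k * γ * z ^ (γ - 2) - k * s ^ (γ - 1) * z⁻¹) z := fun z hz =>
        (hg.hasDerivAt_potDeriv hh (hs.trans_le hz)).sub
          ((Real.hasDerivAt_log (hs.trans_le hz).ne').const_mul _)
      refine monotoneOn_of_deriv_nonneg (convex_Ici s)
        (fun z hz => (hd z hz).continuousAt.continuousWithinAt)
        (fun z hz => (hd z (interior_subset hz)).differentiableAt.differentiableWithinAt) ?_
      intro z hz
      have hsz : s ≤ z := interior_subset hz
      have hz0 := hs.trans_le hsz
      rw [(hd z hsz).deriv, show γ - 2 = γ - 1 - 1 by ring, Real.rpow_sub_one hz0.ne',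
        div_eq_mul_inv]
      have e1 : s ^ (γ - 1) ≤ z ^ (γ - 1) := Real.rpow_le_rpow hs.le hsz (by linarith)
      have e2 : 0 < z⁻¹ := inv_pos.2 hz0
      have e3 : 0 ≤ z ^ (γ - 1) := by positivity
      have e4 : k * s ^ (γ - 1) ≤ k * γ * z ^ (γ - 1) := by
        rw [mul_assoc]
        refine mul_le_mul_of_nonneg_left ?_ hk.le
        nlinarith
      nlinarith [mul_le_mul_of_nonneg_right e4 e2.le]
    intro z hz
    have := hmono (mem_Ici.2 le_rfl) hz hz
    simp only at this
    linarith
  have hmono : MonotoneOn (fun z => relPot h z s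
      - k * s ^ (γ - 1) * (z * (Real.log z - Real.log s) - z)) (Ici s) := by
    have hd : ∀ z, s ≤ z → HasDerivAt (fun z => relPot h z s
        - k * s ^ (γ - 1) * (z * (Real.log z - Real.log s) - z))
        (potDeriv h z - potDeriv h s - k * s ^ (γ - 1) * (Real.log z - Real.log s)) z := by
      intro z hz
      have hz0 := hs.trans_le hz
      have e1 := ((hasDerivAt_id z).mul ((Real.hasDerivAt_log hz0.ne').sub_const
        (Real.log s))).sub (hasDerivAt_id z)
      refine ((hasDerivAt_relPot hh hz0 s).sub (e1.const_mul (k * s ^ (γ - 1)))).congr_deriv ?_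
      simp only [id, mul_inv_cancel₀ hz0.ne']
      ring
    refine monotoneOn_of_deriv_nonneg (convex_Ici s)
      (fun z hz => (hd z hz).continuousAt.continuousWithinAt)
      (fun z hz => (hd z (interior_subset hz)).differentiableAt.differentiableWithinAt) ?_
    intro z hz
    rw [(hd z (interior_subset hz)).deriv]
    linarith [hlog z (interior_subset hz)]
  have h1 := hmono (mem_Ici.2 le_rfl) (mem_Ici.2 hrs.le) hrs.le
  simp only [relPot, sub_self, mul_zero, zero_sub] at h1
  rw [← relPot] at h1
  -- the elementary inequality `2 x ≤ e + x log x`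
  have h2 : 2 * r ≤ 3 * s + r * (Real.log r - Real.log s) := by
    have hr0 := hs.trans hrs
    have hx : 0 < s * Real.exp 1 / r := by positivity
    -- This is the tangent inequality of the logarithm at 1, evaluated at e/x with x = r/s; it
    -- becomes 2x ≤ e + x log x, and e < 3.
    have e1 := Real.log_le_sub_one_of_pos hx
    rw [Real.log_div (by positivity) hr0.ne', Real.log_mul hs.ne' (Real.exp_pos 1).ne',
      Real.log_exp] at e1
    have e2 := mul_le_mul_of_nonneg_left e1 hr0.le
    have e3 : r * (s * Real.exp 1 / r - 1) = s * Real.exp 1 - r := by field_simp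
    have e4 := Real.exp_one_lt_d9
    rw [e3] at e2
    nlinarith
  have h3 : s ^ γ = s ^ (γ - 1) * s := by rw [Real.rpow_sub_one hs.ne']; field_simp
  have hc : 0 < k * s ^ (γ - 1) := by positivity
  have h4 : r - 2 * s ≤ relPot h r s / (k * s ^ (γ - 1)) := by
    rw [le_div_iff₀ hc]
    nlinarith
  have h5 : s * (relPot h r s / (k * s ^ γ)) = relPot h r s / (k * s ^ (γ - 1)) := by
    rw [h3]
    field_simp
  rw [mul_add, h5]
  linarith

lemma exists_lipschitz_Icc {f f' : ℝ → ℝ} (hf : ∀ z, 0 < z → HasDerivAt f (f' z) z)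
    (hf' : ContinuousOn f' (Ioi 0)) {m M : ℝ} (hm : 0 < m) :
    ∃ L : ℝ, 0 ≤ L ∧ ∀ x ∈ Icc m M, ∀ y ∈ Icc m M, |f x - f y| ≤ L * |x - y| := by
  obtain ⟨L, hL⟩ := (isCompact_Icc (a := m) (b := M)).exists_bound_of_continuousOn
    (hf'.mono fun x hx => hm.trans_le hx.1)
  refine ⟨max L 0, le_max_right _ _, fun x hx y hy => ?_⟩
  exact (convex_Icc m M).norm_image_sub_le_of_norm_hasDerivWithin_le
    (fun z hz => (hf z (hm.trans_le hz.1)).hasDerivWithinAt)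
    (fun z hz => (hL z hz).trans (le_max_left _ _)) hy hx

end GammaLaw

/-! ### The positive part of the symmetric part of a matrix -/

section PosPart

variable {d : ℕ}

lemma inner_toEuclideanCLM_transpose (A : Matrix (Fin d) (Fin d) ℝ) (v w : Space d) :
    inner ℝ (Matrix.toEuclideanCLM (n := Fin d) (𝕜 := ℝ) A.transpose v) w
      = inner ℝ v (Matrix.toEuclideanCLM (n := Fin d) (𝕜 := ℝ) A w) := by
  have h1 : A.transpose = star A := by
    rw [Matrix.star_eq_conjTranspose, Matrix.conjTranspose_eq_transpose_of_trivial]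
  rw [h1, map_star, ContinuousLinearMap.star_eq_adjoint, ContinuousLinearMap.adjoint_inner_left]

/-- With g = √f, the matrix f(B) is the square of the symmetric matrix g(B), so the quadratic form
is |g(B)w|². -/
lemma inner_cfc_nonneg {B : Matrix (Fin d) (Fin d) ℝ} {f : ℝ → ℝ}
    (hf : ∀ t ∈ spectrum ℝ B, 0 ≤ f t) (w : Space d) :
    0 ≤ inner ℝ (Matrix.toEuclideanCLM (n := Fin d) (𝕜 := ℝ) (cfc f B) w) w := by
  have hcont : ∀ g : ℝ → ℝ, ContinuousOn g (spectrum ℝ B) := fun g =>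
    (Matrix.finite_real_spectrum (A := B)).continuousOn g
  have h1 : cfc f B = cfc (fun t => √(f t)) B * cfc (fun t => √(f t)) B := by
    rw [← cfc_mul _ _ B (hcont _) (hcont _)]
    exact cfc_congr fun t ht => (Real.mul_self_sqrt (hf t ht)).symm
  have h2 : IsSelfAdjoint (cfc (fun t => √(f t)) B) := cfc_predicate _ _
  have h3 : (cfc (fun t => √(f t)) B).transpose = cfc (fun t => √(f t)) B := by
    have := h2.star_eq
    rwa [Matrix.star_eq_conjTranspose, Matrix.conjTranspose_eq_transpose_of_trivial] at this
  rw [h1, map_mul, mul_apply_eq_comp]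
  nth_rewrite 1 [← h3]
  rw [inner_toEuclideanCLM_transpose, real_inner_self_eq_norm_sq]
  positivity

lemma isSelfAdjoint_symPart (A : Matrix (Fin d) (Fin d) ℝ) :
    IsSelfAdjoint ((1 / 2 : ℝ) • (A + A.transpose)) := by
  rw [IsSelfAdjoint, Matrix.star_eq_conjTranspose, Matrix.conjTranspose_eq_transpose_of_trivial,
    Matrix.transpose_smul, Matrix.transpose_add, Matrix.transpose_transpose, add_comm]

lemma inner_symPart (A : Matrix (Fin d) (Fin d) ℝ) (w : Space d) :
    inner ℝ (Matrix.toEuclideanCLM (n := Fin d) (𝕜 := ℝ) ((1 / 2 : ℝ) • (A + A.transpose)) w) w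
      = inner ℝ (Matrix.toEuclideanCLM (n := Fin d) (𝕜 := ℝ) A w) w := by
  rw [map_smul, map_add, smul_apply, add_apply, real_inner_smul_left, inner_add_left,
    inner_toEuclideanCLM_transpose, real_inner_comm w]
  ring

/-- The antisymmetric part does not contribute to the quadratic form, and max(t,0) - t ≥ 0 makes the
difference of positive part and symmetric part positive semidefinite. -/
lemma inner_le_matrixSpectralNorm (A : Matrix (Fin d) (Fin d) ℝ) (w : Space d) :
    inner ℝ (Matrix.toEuclideanCLM (n := Fin d) (𝕜 := ℝ) A w) w
      ≤ matrixSpectralNorm (symPosPart A) * ‖w‖ ^ 2 := by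
  set B := (1 / 2 : ℝ) • (A + A.transpose) with hB
  have hsa : IsSelfAdjoint B := isSelfAdjoint_symPart A
  have hcont : ∀ g : ℝ → ℝ, ContinuousOn g (spectrum ℝ B) := fun g =>
    (Matrix.finite_real_spectrum (A := B)).continuousOn g
  have h1 : cfc (fun t : ℝ => max t 0 - t) B = symPosPart A - B := by
    rw [cfc_sub _ _ B (hcont _) (hcont _), cfc_id' ℝ B hsa, symPosPart]
  have h2 := inner_cfc_nonneg (B := B) (f := fun t => max t 0 - t)
    (fun t _ => sub_nonneg.2 (le_max_left t 0)) w
  rw [h1, map_sub, sub_apply, inner_sub_left, inner_symPart] at h2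
  have h3 := real_inner_le_norm (Matrix.toEuclideanCLM (n := Fin d) (𝕜 := ℝ) (symPosPart A) w) w
  have h4 := (Matrix.toEuclideanCLM (n := Fin d) (𝕜 := ℝ) (symPosPart A)).le_opNorm w
  rw [matrixSpectralNorm]
  nlinarith [mul_le_mul_of_nonneg_right h4 (norm_nonneg w)]

/-- Testing with eigenvectors bounds the spectrum of the symmetric part by c. Then c² - max(t,0)² ≥
0 on the spectrum, and so |Pw|² ≤ c²|w|² for the positive part P. -/
lemma matrixSpectralNorm_symPosPart_le {A : Matrix (Fin d) (Fin d) ℝ} {c : ℝ} (hc : 0 ≤ c)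
    (hA : ∀ w, inner ℝ (Matrix.toEuclideanCLM (n := Fin d) (𝕜 := ℝ) A w) w ≤ c * ‖w‖ ^ 2) :
    matrixSpectralNorm (symPosPart A) ≤ c := by
  set B := (1 / 2 : ℝ) • (A + A.transpose) with hB
  have hsa : IsSelfAdjoint B := isSelfAdjoint_symPart A
  have hherm : B.IsHermitian := hsa
  have hcont : ∀ g : ℝ → ℝ, ContinuousOn g (spectrum ℝ B) := fun g =>
    (Matrix.finite_real_spectrum (A := B)).continuousOn g
  have hspec : ∀ t ∈ spectrum ℝ B, t ≤ c := by
    intro t ht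
    rw [hherm.spectrum_real_eq_range_eigenvalues] at ht
    obtain ⟨i, rfl⟩ := ht
    have h1 := hA (hherm.eigenvectorBasis i)
    rw [← inner_symPart, ← hB] at h1
    have h2 : Matrix.toEuclideanCLM (n := Fin d) (𝕜 := ℝ) B (hherm.eigenvectorBasis i)
        = hherm.eigenvalues i • hherm.eigenvectorBasis i := by
      ext j
      have := congrFun (hherm.mulVec_eigenvectorBasis i) j
      simpa using this
    rw [h2, real_inner_smul_left, real_inner_self_eq_norm_sq,
      (hherm.eigenvectorBasis.orthonormal.1 i)] at h1
    simpa using h1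
  have hP : symPosPart A = cfc (fun t : ℝ => max t 0) B := rfl
  have hPsa : IsSelfAdjoint (symPosPart A) := hP ▸ cfc_predicate _ _
  have hPt : (symPosPart A).transpose = symPosPart A := by
    have := hPsa.star_eq
    rwa [Matrix.star_eq_conjTranspose, Matrix.conjTranspose_eq_transpose_of_trivial] at this
  refine ContinuousLinearMap.opNorm_le_bound _ hc fun w => ?_
  have h1 : cfc (fun t : ℝ => c ^ 2 - max t 0 * max t 0) B
      = algebraMap ℝ _ (c ^ 2) - symPosPart A * symPosPart A := by
    rw [cfc_sub _ _ B (hcont _) (hcont _), cfc_const _ B hsa, cfc_mul _ _ B (hcont _) (hcont _), hP]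
  have h2 := inner_cfc_nonneg (B := B) (f := fun t => c ^ 2 - max t 0 * max t 0) (fun t ht => by
    have e1 : max t 0 ≤ c := max_le (hspec t ht) hc
    nlinarith [le_max_right t 0]) w
  rw [h1, map_sub, sub_apply, inner_sub_left, map_mul, mul_apply_eq_comp] at h2
  nth_rewrite 1 [← hPt] at h2
  rw [inner_toEuclideanCLM_transpose, real_inner_self_eq_norm_sq, Algebra.algebraMap_eq_smul_one,
    map_smul, map_one, smul_apply, one_apply_eq_self, real_inner_smul_left,
    real_inner_self_eq_norm_sq] at h2
  refine abs_le_of_sq_le_sq' ?_ (by positivity) |>.2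
  rw [mul_pow]
  linarith

lemma toEuclideanCLM_jacobian (v : Space d → Space d) (y w : Space d) :
    Matrix.toEuclideanCLM (n := Fin d) (𝕜 := ℝ) (jacobian v y) w = fderiv ℝ v y w := by
  conv_rhs => rw [← sum_smul_single w, map_sum]
  ext i
  simp [jacobian, Matrix.mulVec, dotProduct, mul_comm]

/-- The one-sided bound of the symmetric part of the gradient. -/
lemma inner_fderiv_le (v : Space d → Space d) (y w : Space d) :
    inner ℝ (fderiv ℝ v y w) w ≤ matrixSpectralNorm (symPosPart (jacobian v y)) * ‖w‖ ^ 2 := by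
  rw [← toEuclideanCLM_jacobian]
  exact inner_le_matrixSpectralNorm _ _

lemma matrixSpectralNorm_jacobian_le {v : Space d → Space d} {y : Space d} {c : ℝ} (hc : 0 ≤ c)
    (hv : ∀ w, inner ℝ (fderiv ℝ v y w) w ≤ c * ‖w‖ ^ 2) :
    matrixSpectralNorm (symPosPart (jacobian v y)) ≤ c :=
  matrixSpectralNorm_symPosPart_le hc fun w => by
    rw [toEuclideanCLM_jacobian]
    exact hv w

end PosPart

/-! ### Regularity and decay of the similarity profile -/

section Profile

variable {d : ℕ}

/-- The essential bound holds on a set of full measure, which is dense, and the set where a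
continuous function obeys it is closed. -/
lemma exists_bound_of_memLp_top {F : Type*} [NormedAddCommGroup F] {f : Space d → F}
    (hf : Continuous f) (hL : MemLp f ⊤) : ∃ M : ℝ, 0 ≤ M ∧ ∀ y, ‖f y‖ ≤ M := by
  refine ⟨(eLpNorm f ⊤ volume).toReal, ENNReal.toReal_nonneg, fun y => ?_⟩
  have h1 : ∀ᵐ y, ‖f y‖ ≤ (eLpNorm f ⊤ volume).toReal := by
    have := ae_le_eLpNormEssSup (f := f) (μ := volume)
    filter_upwards [this] with y hy
    rw [← eLpNorm_exponent_top] at hy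
    rw [← toReal_enorm]
    exact ENNReal.toReal_mono hL.2.ne hy
  have h2 : IsClosed {y | ‖f y‖ ≤ (eLpNorm f ⊤ volume).toReal} :=
    isClosed_le hf.norm continuous_const
  have h3 := (Measure.dense_of_ae h1).closure_eq
  rw [h2.closure_eq] at h3
  exact (h3.symm ▸ mem_univ y : y ∈ {y | ‖f y‖ ≤ (eLpNorm f ⊤ volume).toReal})

/-- Outside of the unit ball 1 + |y| ≤ 2|y|; inside, boundedness of f suffices. -/
lemma integrable_one_add_norm_mul {f : Space d → ℝ} {C : ℝ} (hf : AEStronglyMeasurable f)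
    (hb : ∀ᵐ y, |f y| ≤ C) (hi : Integrable fun y => ‖y‖ * f y) :
    Integrable fun y => (1 + ‖y‖) * f y := by
  have hB := isCompact_closedBall (0 : Space d) 1
  have hBi : Integrable ((Metric.closedBall (0 : Space d) 1).indicator fun _ => C) :=
    (integrable_indicator_iff hB.measurableSet).2 (continuousOn_const.integrableOn_compact hB)
  refine Integrable.mono' (hBi.add (hi.norm.const_mul 2))
    ((by fun_prop : Continuous fun y : Space d => 1 + ‖y‖).aestronglyMeasurable.mul hf) ?_
  filter_upwards [hb] with y hy
  simp only [Pi.add_apply, norm_mul, Real.norm_eq_abs]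
  rw [abs_norm, abs_of_pos (by positivity : 0 < 1 + ‖y‖)]
  by_cases h1 : y ∈ Metric.closedBall (0 : Space d) 1
  · rw [indicator_of_mem h1]
    nlinarith [mul_nonneg (norm_nonneg y) (abs_nonneg (f y))]
  · rw [indicator_of_notMem h1]
    have h2 : 1 < ‖y‖ := by simpa using h1
    nlinarith [abs_nonneg (f y)]

lemma IsAngular.exists_bounds {ρhat : Space d → ℝ} (hd : 1 ≤ d) (hang : IsAngular ρhat) :
    ∃ m M : ℝ, 0 < m ∧ ∀ y, y ≠ 0 → ρhat y ∈ Icc m M := by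
  have : Nonempty (Fin d) := ⟨⟨0, hd⟩⟩
  have : Nontrivial (Space d) := inferInstance
  have hS : IsCompact (Metric.sphere (0 : Space d) 1) := isCompact_sphere _ _
  have hne : (Metric.sphere (0 : Space d) 1).Nonempty := NormedSpace.sphere_nonempty.2 zero_le_one
  have hsub : Metric.sphere (0 : Space d) 1 ⊆ {0}ᶜ := fun y hy h0 => by
    rw [mem_singleton_iff] at h0
    simp [h0] at hy
  have hc := hang.contDiffOn.continuousOn.mono hsub
  obtain ⟨y₁, hy₁, h1⟩ := hS.exists_isMinOn hne hc
  obtain ⟨y₂, hy₂, h2⟩ := hS.exists_isMaxOn hne hc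
  refine ⟨ρhat y₁, ρhat y₂, hang.pos y₁ (hsub hy₁), fun y hy => ?_⟩
  have hy0 : 0 < ‖y‖ := norm_pos_iff.2 hy
  have hmem : ‖y‖⁻¹ • y ∈ Metric.sphere (0 : Space d) 1 := by
    simp [norm_smul, hy0.ne']
  rw [← hang.homogeneous ‖y‖⁻¹ (inv_pos.2 hy0) y hy]
  exact ⟨h1 hmem, h2 hmem⟩

lemma IsAngular.aemeasurable {ρhat : Space d → ℝ} (hd : 1 ≤ d) (hang : IsAngular ρhat) :
    AEMeasurable ρhat := by
  have h1 := hang.contDiffOn.continuousOn.aemeasurable (μ := volume)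
    (measurableSet_singleton (0 : Space d)).compl
  rwa [Measure.restrict_eq_self_of_ae_mem] at h1
  exact ae_ne_zero hd

/-- A similarity profile for a `γ`-law, with values in `[m, M]`. -/
structure IsGammaProfile (α k γ : ℝ) (p h : ℝ → ℝ) (ρhat ρs : Space d → ℝ)
    (ns : Space d → Space d) (m M : ℝ) : Prop where
  dim_pos : 1 ≤ d
  damping_pos : 0 < α
  law : IsGammaLaw k γ p
  potential : IsPotential p h
  angular : IsAngular ρhat
  profile : IsSimilarityProfile α p ρs ns
  admissible : IsAdmissibleProfile ρhat ρs
  lower_pos : 0 < m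
  limit_mem : ∀ y, y ≠ 0 → ρhat y ∈ Icc m M
  mem : ∀ y, ρs y ∈ Icc m M

variable {α k γ m M : ℝ} {p h : ℝ → ℝ} {ρhat ρs : Space d → ℝ} {ns : Space d → Space d}

lemma exists_isGammaProfile (hd : 1 ≤ d) (hα : 0 < α) (hg : IsGammaLaw k γ p)
    (hh : IsPotential p h) (hang : IsAngular ρhat) (hsim : IsSimilarityProfile α p ρs ns)
    (hadm : IsAdmissibleProfile ρhat ρs) : ∃ m M, IsGammaProfile α k γ p h ρhat ρs ns m M := by
  obtain ⟨m, M, hm, hmM⟩ := hang.exists_bounds hd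
  refine ⟨m, M, hd, hα, hg, hh, hang, hsim, hadm, hm, hmM, fun y => ?_⟩
  refine convexHull_min ?_ (convex_Icc m M) (hadm.range_subset (mem_range_self y))
  rintro _ ⟨x, hx, rfl⟩
  exact hmM x hx

namespace IsGammaProfile

lemma pos {y : Space d} (hP : IsGammaProfile α k γ p h ρhat ρs ns m M) : 0 < ρs y :=
  hP.lower_pos.trans_le (hP.mem y).1

lemma law_pos (hP : IsGammaProfile α k γ p h ρhat ρs ns m M) : 0 < k * γ :=
  mul_pos hP.law.1 (by linarith [hP.law.2.1])

lemma hasFDerivAt_density (hP : IsGammaProfile α k γ p h ρhat ρs ns m M) (y : Space d) :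
    HasFDerivAt ρs (fderiv ℝ ρs y) y :=
  ((hP.admissible.contDiff.differentiable (by simp)) y).hasFDerivAt

open scoped ContDiff in
lemma contDiff_fderiv (hP : IsGammaProfile α k γ p h ρhat ρs ns m M) :
    ContDiff ℝ ∞ (fderiv ℝ ρs) :=
  hP.admissible.contDiff.fderiv_right (m := ∞) (by simp)

lemma hasFDerivAt_potDeriv (hP : IsGammaProfile α k γ p h ρhat ρs ns m M) (y : Space d) :
    HasFDerivAt (fun y => potDeriv h (ρs y)) ((k * γ * ρs y ^ (γ - 2)) • fderiv ℝ ρs y) y :=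
  (hP.law.hasDerivAt_potDeriv hP.potential hP.pos).comp_hasFDerivAt y (hP.hasFDerivAt_density y)

lemma hasFDerivAt_pressure (hP : IsGammaProfile α k γ p h ρhat ρs ns m M) (y : Space d) :
    HasFDerivAt (fun y => p (ρs y)) ((k * γ * ρs y ^ (γ - 1)) • fderiv ℝ ρs y) y :=
  (hP.law.hasDerivAt hP.pos).comp_hasFDerivAt y (hP.hasFDerivAt_density y)

open scoped ContDiff in
lemma contDiff_potDeriv (hP : IsGammaProfile α k γ p h ρhat ρs ns m M) :
    ContDiff ℝ ∞ fun y => potDeriv h (ρs y) :=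
  (hP.law.contDiffOn_potDeriv hP.potential).comp_contDiff hP.admissible.contDiff fun _ => hP.pos

/-- The reason is p'(z) = zh''(z). Consequently u* = -(1/α)∇h'(ρ*) is a gradient field, see
`velocity_eq`; this ties θ to the weight of the test field. -/
lemma gradient_pressure (hP : IsGammaProfile α k γ p h ρhat ρs ns m M) (y : Space d) :
    gradient (fun y => p (ρs y)) y = ρs y • gradient (fun y => potDeriv h (ρs y)) y := by
  refine ext_inner_right ℝ fun v => ?_
  rw [inner_gradient_eq, real_inner_smul_left, inner_gradient_eq, (hP.hasFDerivAt_pressure y).fderiv,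
    (hP.hasFDerivAt_potDeriv y).fderiv, show γ - 1 = γ - 2 + 1 by ring,
    Real.rpow_add_one hP.pos.ne']
  simp only [smul_apply, smul_eq_mul]
  ring

lemma momentum_eq (hP : IsGammaProfile α k γ p h ρhat ρs ns m M) (y : Space d) :
    ns y = -(1 / α) • gradient (fun y => p (ρs y)) y := by
  have := hP.profile.2 y
  rw [neg_smul]
  exact eq_neg_of_add_eq_zero_left this.symm

lemma velocity_eq (hP : IsGammaProfile α k γ p h ρhat ρs ns m M) (y : Space d) :
    profileVelocity ρs ns y = -(1 / α) • gradient (fun y => potDeriv h (ρs y)) y := by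
  rw [profileVelocity, hP.momentum_eq, hP.gradient_pressure, smul_comm, inv_smul_smul₀ hP.pos.ne']

lemma momentum_eq_smul (hP : IsGammaProfile α k γ p h ρhat ρs ns m M) (y : Space d) :
    ns y = ρs y • profileVelocity ρs ns y := by
  rw [profileVelocity, smul_inv_smul₀ hP.pos.ne']

open scoped ContDiff in
lemma contDiff_gradient (hP : IsGammaProfile α k γ p h ρhat ρs ns m M) :
    ContDiff ℝ ∞ (gradient fun y => potDeriv h (ρs y)) :=
  ((InnerProductSpace.toDual ℝ (Space d)).symm.toContinuousLinearEquiv.contDiff).comp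
    (hP.contDiff_potDeriv.fderiv_right (m := ∞) (by simp))

open scoped ContDiff in
lemma contDiff_velocity (hP : IsGammaProfile α k γ p h ρhat ρs ns m M) :
    ContDiff ℝ ∞ (profileVelocity ρs ns) := by
  rw [show profileVelocity ρs ns = fun y => -(1 / α) • gradient (fun y => potDeriv h (ρs y)) y
    from funext hP.velocity_eq]
  exact hP.contDiff_gradient.const_smul _

lemma flux (hP : IsGammaProfile α k γ p h ρhat ρs ns m M) (y v : Space d) :
    fderiv ℝ (fun y => potDeriv h (ρs y)) y v = -(α * inner ℝ (profileVelocity ρs ns y) v) := by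
  rw [hP.velocity_eq, real_inner_smul_left, inner_gradient_eq]
  have := hP.damping_pos.ne'
  field_simp

lemma fderiv_velocity (hP : IsGammaProfile α k γ p h ρhat ρs ns m M) (y : Space d) :
    fderiv ℝ (profileVelocity ρs ns) y
      = -(1 / α) • fderiv ℝ (gradient fun y => potDeriv h (ρs y)) y := by
  rw [show profileVelocity ρs ns = fun y => -(1 / α) • gradient (fun y => potDeriv h (ρs y)) y
    from funext hP.velocity_eq]
  exact (((hP.contDiff_gradient.differentiable (by simp)) y).hasFDerivAt.const_smul
    (-(1 / α))).fderiv

/-! #### Bounds -/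

lemma norm_gradient (f : Space d → ℝ) (y : Space d) : ‖gradient f y‖ = ‖fderiv ℝ f y‖ := by
  rw [gradient, LinearIsometryEquiv.norm_map]

lemma integrable_difference (hP : IsGammaProfile α k γ p h ρhat ρs ns m M) :
    Integrable fun y => (1 + ‖y‖) * |ρs y - ρhat y| := by
  have h1 : Integrable fun y => (1 + ‖y‖) * (ρs y - ρhat y) := by
    refine integrable_one_add_norm_mul (C := M - m)
      (hP.admissible.contDiff.continuous.aemeasurable.sub
        (hP.angular.aemeasurable hP.dim_pos)).aestronglyMeasurable ?_
      (memLp_one_iff_integrable.1 (hP.admissible.difference 1 (Or.inl rfl)))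
    filter_upwards [ae_ne_zero hP.dim_pos] with y hy
    obtain ⟨e1, e2⟩ := hP.limit_mem y hy
    obtain ⟨e3, e4⟩ := hP.mem y
    rw [abs_le]
    constructor <;> linarith
  refine h1.norm.congr (Eventually.of_forall fun y => ?_)
  simp only [norm_mul, Real.norm_eq_abs]
  rw [abs_of_pos (by positivity : 0 < 1 + ‖y‖)]

/-- The assumption bounds |y||∇ρ*|, which says nothing near the origin; there continuity is used. -/
lemma exists_fderiv_le (hP : IsGammaProfile α k γ p h ρhat ρs ns m M) :
    ∃ C : ℝ, 0 ≤ C ∧ ∀ y, ‖fderiv ℝ ρs y‖ ≤ C := by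
  have hc : Continuous fun y => ‖fderiv ℝ ρs y‖ :=
    (hP.admissible.contDiff.continuous_fderiv (by simp)).norm
  obtain ⟨C₁, h1, h1'⟩ := exists_bound_of_memLp_top (f := fun y => ‖y‖ * ‖gradient ρs y‖)
    (by simp only [norm_gradient]; exact continuous_norm.mul hc)
    (hP.admissible.gradient ⊤ (Or.inr rfl))
  obtain ⟨C₂, h2⟩ := (isCompact_closedBall (0 : Space d) 1).exists_bound_of_continuousOn
    hc.continuousOn
  refine ⟨max C₁ C₂, h1.trans (le_max_left _ _), fun y => ?_⟩
  by_cases hy : ‖y‖ ≤ 1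
  · have := h2 y (by simpa using hy)
    rw [norm_norm] at this
    exact this.trans (le_max_right _ _)
  · have h3 := h1' y
    rw [norm_mul, norm_norm, norm_norm, norm_gradient] at h3
    exact (le_mul_of_one_le_left (norm_nonneg _) (not_le.1 hy).le).trans
      (h3.trans (le_max_left _ _))

lemma integrable_fderiv (hP : IsGammaProfile α k γ p h ρhat ρs ns m M) :
    Integrable fun y => (1 + ‖y‖) * ‖fderiv ℝ ρs y‖ := by
  obtain ⟨C, -, hC⟩ := hP.exists_fderiv_le
  have h1 := memLp_one_iff_integrable.1 (hP.admissible.gradient 1 (Or.inl rfl))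
  simp only [norm_gradient] at h1
  exact integrable_one_add_norm_mul (C := C)
    (hP.admissible.contDiff.continuous_fderiv (by simp)).norm.aestronglyMeasurable
    (Eventually.of_forall fun y => by rw [abs_norm]; exact hC y) h1

lemma exists_hessian_le (hP : IsGammaProfile α k γ p h ρhat ρs ns m M) :
    ∃ C : ℝ, 0 ≤ C ∧ ∀ y, ‖fderiv ℝ (fderiv ℝ ρs) y‖ ≤ C := by
  have h0 : ∀ y, ‖iteratedFDeriv ℝ 2 ρs y‖ = ‖fderiv ℝ (fderiv ℝ ρs) y‖ := fun y => by
    rw [← norm_iteratedFDeriv_one, norm_iteratedFDeriv_fderiv]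
  obtain ⟨C, hC, hC'⟩ := exists_bound_of_memLp_top (f := fun y => ‖iteratedFDeriv ℝ 2 ρs y‖)
    (by simp only [h0]; exact (hP.contDiff_fderiv.continuous_fderiv (by simp)).norm)
    (hP.admissible.hessian ⊤ (Or.inr rfl))
  refine ⟨C, hC, fun y => ?_⟩
  rw [← h0, ← norm_norm]
  exact hC' y

/-- The powers of the density are bounded. -/
lemma exists_rpow_le (hP : IsGammaProfile α k γ p h ρhat ρs ns m M) (q : ℝ) :
    ∃ C : ℝ, 0 ≤ C ∧ ∀ y, ρs y ^ q ≤ C := by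
  obtain ⟨C, hC⟩ := (isCompact_Icc (a := m) (b := M)).exists_bound_of_continuousOn
    (f := fun z : ℝ => z ^ q)
    (continuousOn_id.rpow_const fun x hx => Or.inl (hP.lower_pos.trans_le hx.1).ne')
  exact ⟨C, (norm_nonneg _).trans (hC _ (hP.mem 0)), fun y => (le_abs_self _).trans (hC _ (hP.mem y))⟩

lemma exists_norm_velocity_le (hP : IsGammaProfile α k γ p h ρhat ρs ns m M) :
    ∃ C : ℝ, 0 ≤ C ∧ ∀ y, ‖profileVelocity ρs ns y‖ ≤ C * ‖fderiv ℝ ρs y‖ := by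
  obtain ⟨C, hC, hC'⟩ := hP.exists_rpow_le (γ - 2)
  have hkγ := hP.law_pos
  have hα := hP.damping_pos
  refine ⟨1 / α * (k * γ * C), by positivity, fun y => ?_⟩
  rw [hP.velocity_eq, norm_smul, norm_neg, norm_gradient, (hP.hasFDerivAt_potDeriv y).fderiv,
    norm_smul, Real.norm_eq_abs, Real.norm_eq_abs, abs_of_pos (by positivity : 0 < 1 / α),
    abs_of_pos (mul_pos hkγ (Real.rpow_pos_of_pos hP.pos _)), ← mul_assoc]
  have := hC' y
  gcongr

lemma exists_velocity_le (hP : IsGammaProfile α k γ p h ρhat ρs ns m M) :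
    ∃ C : ℝ, 0 ≤ C ∧ ∀ y, ‖profileVelocity ρs ns y‖ ≤ C := by
  obtain ⟨C, hC, hC'⟩ := hP.exists_norm_velocity_le
  obtain ⟨D, hD, hD'⟩ := hP.exists_fderiv_le
  exact ⟨C * D, by positivity, fun y => (hC' y).trans (by gcongr; exact hD' y)⟩

lemma integrable_velocity (hP : IsGammaProfile α k γ p h ρhat ρs ns m M) :
    Integrable (profileVelocity ρs ns) := by
  obtain ⟨C, hC, hC'⟩ := hP.exists_norm_velocity_le
  refine Integrable.mono' (hP.integrable_fderiv.const_mul C)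
    hP.contDiff_velocity.continuous.aestronglyMeasurable (Eventually.of_forall fun y => ?_)
  refine (hC' y).trans (mul_le_mul_of_nonneg_left ?_ hC)
  exact le_mul_of_one_le_left (norm_nonneg _) (by linarith [norm_nonneg y])

/-- The second derivatives of `h'(ρ*)` are bounded. -/
lemma exists_fderiv_gradient_le (hP : IsGammaProfile α k γ p h ρhat ρs ns m M) :
    ∃ C : ℝ, 0 ≤ C ∧ ∀ y, ‖fderiv ℝ (gradient fun y => potDeriv h (ρs y)) y‖ ≤ C := by
  obtain ⟨C₁, h1, h1'⟩ := hP.exists_rpow_le (γ - 2)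
  obtain ⟨C₂, h2, h2'⟩ := hP.exists_rpow_le (γ - 2 - 1)
  obtain ⟨D₁, g1, g1'⟩ := hP.exists_fderiv_le
  obtain ⟨D₂, g2, g2'⟩ := hP.exists_hessian_le
  have hkγ := hP.law_pos
  refine ⟨k * γ * C₁ * D₂ + k * γ * (|γ - 2| * C₂) * D₁ * D₁, by positivity, fun y => ?_⟩
  -- The gradient is the derivative composed with the Riesz isometry, so norm bounds for the
  -- derivative of ∇h'(ρ*) reduce to the product rule for h''(ρ*) times the derivative of ρ*.
  let Λ : (Space d →L[ℝ] ℝ) ≃ₗᵢ[ℝ] Space d := (InnerProductSpace.toDual ℝ (Space d)).symm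
  have e0 : (gradient fun y => potDeriv h (ρs y))
      = fun y => Λ ((k * γ * ρs y ^ (γ - 2)) • fderiv ℝ ρs y) := funext fun y => by
    rw [gradient, (hP.hasFDerivAt_potDeriv y).fderiv]
  have hD : HasFDerivAt (fderiv ℝ ρs) (fderiv ℝ (fderiv ℝ ρs) y) y :=
    ((hP.contDiff_fderiv.differentiable (by simp)) y).hasFDerivAt
  have e1 : HasFDerivAt (fun y => k * γ * ρs y ^ (γ - 2))
      ((k * γ) • (((γ - 2) * ρs y ^ (γ - 2 - 1)) • fderiv ℝ ρs y)) y :=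
    (((Real.hasDerivAt_rpow_const (Or.inl hP.pos.ne')).comp_hasFDerivAt y
      (hP.hasFDerivAt_density y)).const_mul (k * γ))
  have e2 : HasFDerivAt (fun y => (k * γ * ρs y ^ (γ - 2)) • fderiv ℝ ρs y) _ y := e1.smul hD
  have e3 : HasFDerivAt (fun y => Λ ((k * γ * ρs y ^ (γ - 2)) • fderiv ℝ ρs y)) _ y :=
    Λ.toContinuousLinearEquiv.hasFDerivAt.comp y e2
  rw [e0, e3.fderiv]
  refine (ContinuousLinearMap.opNorm_comp_le _ _).trans ?_
  have e4 : ‖(Λ.toContinuousLinearEquiv : (Space d →L[ℝ] ℝ) →L[ℝ] Space d)‖ ≤ 1 :=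
    Λ.toLinearIsometry.norm_toContinuousLinearMap_le
  refine (mul_le_of_le_one_left (norm_nonneg _) e4).trans ?_
  refine le_trans (norm_add_le _ _) ?_
  refine add_le_add ?_ ?_
  · rw [norm_smul, Real.norm_eq_abs, abs_of_pos (mul_pos hkγ (Real.rpow_pos_of_pos hP.pos _))]
    have := h1' y
    have := g2' y
    gcongr
  · rw [ContinuousLinearMap.norm_smulRight_apply, norm_smul, norm_smul, Real.norm_eq_abs,
      Real.norm_eq_abs, abs_of_pos hkγ, abs_mul, abs_of_pos (Real.rpow_pos_of_pos hP.pos _),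
      ← mul_assoc]
    have := h2' y
    have := g1' y
    gcongr

end IsGammaProfile

end Profile

/-! ### The weight of the `γ`-law -/

section Weight

variable {d : ℕ} {γ c : ℝ} {v : Space d → Space d}

lemma gammaWeight_le (hγ : 1 ≤ γ) (hc : 0 ≤ c)
    (h1 : ∀ y w, 2 * inner ℝ (fderiv ℝ v y w) w ≤ c * ‖w‖ ^ 2)
    (h2 : ∀ y, (γ - 1) * traceCLM d (fderiv ℝ v y) ≤ c) :
    gammaWeight γ v ≤ ENNReal.ofReal c := by
  refine max_le ?_ ?_
  · have e1 : eLpNorm (fun y => matrixSpectralNorm (symPosPart (jacobian v y))) ⊤ volume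
        ≤ ENNReal.ofReal (c / 2) := by
      rw [eLpNorm_exponent_top]
      refine eLpNormEssSup_le_of_ae_bound (Eventually.of_forall fun y => ?_)
      rw [Real.norm_eq_abs, abs_of_nonneg (show 0 ≤ matrixSpectralNorm _ from norm_nonneg _)]
      exact matrixSpectralNorm_jacobian_le (by positivity) fun w => by linarith [h1 y w]
    calc _ ≤ 2 * ENNReal.ofReal (c / 2) := by gcongr
      _ = ENNReal.ofReal c := by
        rw [← ENNReal.ofReal_ofNat, ← ENNReal.ofReal_mul zero_le_two]
        congr 1
        ring
  -- For γ = 1 the divergence part is 0 whatever the norm is, since 0 · ∞ = 0; otherwise one may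
  -- divide by γ - 1.
  · rcases hγ.eq_or_lt with rfl | hγ
    · simp
    have hγ0 : 0 < γ - 1 := by linarith
    have e1 : eLpNorm (fun y => max (divergence v y) 0) ⊤ volume
        ≤ ENNReal.ofReal (c / (γ - 1)) := by
      rw [eLpNorm_exponent_top]
      refine eLpNormEssSup_le_of_ae_bound (Eventually.of_forall fun y => ?_)
      rw [Real.norm_eq_abs, abs_of_nonneg (le_max_right _ _)]
      refine max_le ?_ (by positivity)
      rw [divergence_eq_traceCLM, le_div_iff₀ hγ0, mul_comm]
      exact h2 y
    calc _ ≤ ENNReal.ofReal (γ - 1) * ENNReal.ofReal (c / (γ - 1)) := by gcongr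
      _ = ENNReal.ofReal c := by
        rw [← ENNReal.ofReal_mul hγ0.le]
        congr 1
        field_simp

lemma ae_le_toReal_eLpNorm_top {f : Space d → ℝ} (hf : eLpNorm f ⊤ volume ≠ ⊤) :
    ∀ᵐ y, f y ≤ (eLpNorm f ⊤ volume).toReal := by
  filter_upwards [ae_le_eLpNormEssSup (f := f) (μ := volume)] with y hy
  rw [← eLpNorm_exponent_top] at hy
  refine (le_abs_self _).trans ?_
  rw [← Real.norm_eq_abs, ← toReal_enorm]
  exact ENNReal.toReal_mono hf hy

lemma forall_le_of_ae_le {f : Space d → ℝ} (hf : Continuous f) (h : ∀ᵐ y, f y ≤ c) (y : Space d) :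
    f y ≤ c := by
  have h2 : IsClosed {y | f y ≤ c} := isClosed_le hf continuous_const
  have h3 := (Measure.dense_of_ae h).closure_eq
  rw [h2.closure_eq] at h3
  exact (h3.symm ▸ mem_univ y : y ∈ {y | f y ≤ c})

/-- The essential suprema give the bounds almost everywhere. They extend to all points by continuity
of the quadratic form for fixed w and of the divergence, so no continuity of the spectral positive
part is needed. -/
lemma le_gammaWeight_toReal (hγ : 1 ≤ γ) (hv : ContDiff ℝ 1 v) (hfin : gammaWeight γ v ≠ ⊤) :
    (∀ y w, 2 * inner ℝ (fderiv ℝ v y w) w ≤ (gammaWeight γ v).toReal * ‖w‖ ^ 2) ∧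
    ∀ y, (γ - 1) * traceCLM d (fderiv ℝ v y) ≤ (gammaWeight γ v).toReal := by
  have hD := hv.continuous_fderiv one_ne_zero
  constructor
  · have e1 : 2 * eLpNorm (fun y => matrixSpectralNorm (symPosPart (jacobian v y))) ⊤ volume
        ≤ gammaWeight γ v := le_max_left _ _
    have e2 : eLpNorm (fun y => matrixSpectralNorm (symPosPart (jacobian v y))) ⊤ volume ≠ ⊤ := by
      intro htop
      rw [htop, ENNReal.mul_top two_ne_zero] at e1
      exact hfin (top_le_iff.1 e1)
    have e3 := ENNReal.toReal_mono hfin e1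
    rw [ENNReal.toReal_mul, ENNReal.toReal_ofNat] at e3
    intro y w
    refine forall_le_of_ae_le (f := fun y => 2 * inner ℝ (fderiv ℝ v y w) w)
      (continuous_const.mul ((hD.clm_apply continuous_const).inner continuous_const)) ?_ y
    filter_upwards [ae_le_toReal_eLpNorm_top e2] with y hy
    have e4 := inner_fderiv_le v y w
    nlinarith [sq_nonneg ‖w‖, mul_le_mul_of_nonneg_right hy (sq_nonneg ‖w‖),
      mul_le_mul_of_nonneg_right e3 (sq_nonneg ‖w‖)]
  · rcases hγ.eq_or_lt with rfl | hγ
    · intro y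
      simp
    have hγ0 : 0 < γ - 1 := by linarith
    have e1 : ENNReal.ofReal (γ - 1) * eLpNorm (fun y => max (divergence v y) 0) ⊤ volume
        ≤ gammaWeight γ v := le_max_right _ _
    have e2 : eLpNorm (fun y => max (divergence v y) 0) ⊤ volume ≠ ⊤ := by
      intro htop
      rw [htop, ENNReal.mul_top (by simpa using hγ)] at e1
      exact hfin (top_le_iff.1 e1)
    have e3 := ENNReal.toReal_mono hfin e1
    rw [ENNReal.toReal_mul, ENNReal.toReal_ofReal hγ0.le] at e3
    intro y
    refine forall_le_of_ae_le (f := fun y => (γ - 1) * traceCLM d (fderiv ℝ v y))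
      (continuous_const.mul ((traceCLM d).continuous.comp hD)) ?_ y
    filter_upwards [ae_le_toReal_eLpNorm_top e2] with y hy
    refine le_trans (mul_le_mul_of_nonneg_left ?_ hγ0.le) e3
    rw [← divergence_eq_traceCLM]
    exact (le_max_left _ _).trans hy

end Weight

/-! ### The residual and the dissipation of the similarity profile -/

namespace IsGammaProfile

variable {d : ℕ} {α k γ m M θ μ : ℝ} {p h : ℝ → ℝ} {ρhat ρs : Space d → ℝ}
  {ns : Space d → Space d}

lemma hasFDerivAt_velocity (hP : IsGammaProfile α k γ p h ρhat ρs ns m M) (y : Space d) :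
    HasFDerivAt (profileVelocity ρs ns) (fderiv ℝ (profileVelocity ρs ns) y) y :=
  ((hP.contDiff_velocity.differentiable (by simp)) y).hasFDerivAt

lemma hasFDerivAt_momentum (hP : IsGammaProfile α k γ p h ρhat ρs ns m M) (y : Space d) :
    HasFDerivAt ns (ρs y • fderiv ℝ (profileVelocity ρs ns) y
      + (fderiv ℝ ρs y).smulRight (profileVelocity ρs ns y)) y := by
  have h1 : HasFDerivAt (fun y => ρs y • profileVelocity ρs ns y) _ y :=
    (hP.hasFDerivAt_density y).smul (hP.hasFDerivAt_velocity y)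
  rwa [show (fun y => ρs y • profileVelocity ρs ns y) = ns from
    funext fun y => (hP.momentum_eq_smul y).symm] at h1

/-- Inserting n* = -(1/α)∇p(ρ*) into the profile equation turns it into the stationary continuity
equation div n* = ½y·∇ρ*. -/
lemma trace_fderiv_momentum (hP : IsGammaProfile α k γ p h ρhat ρs ns m M) (y : Space d) :
    traceCLM d (fderiv ℝ ns y) = 1 / 2 * fderiv ℝ ρs y y := by
  have h1 := hP.profile.1 y
  have hα := hP.damping_pos.ne'
  have h2 : (gradient fun x => p (ρs x)) = fun y => (-α) • ns y := funext fun y => by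
    rw [hP.momentum_eq, smul_smul]
    have : -α * -(1 / α) = 1 := by field_simp
    rw [this, one_smul]
  have h3 : HasFDerivAt (fun y => (-α) • ns y) ((-α) • fderiv ℝ ns y) y :=
    (hP.hasFDerivAt_momentum y).differentiableAt.hasFDerivAt.const_smul (-α)
  rw [divergence_eq_traceCLM, h2, h3.fderiv, map_smul, inner_gradient_eq', map_smul, smul_eq_mul,
    smul_eq_mul] at h1
  field_simp at h1 ⊢
  linarith

lemma density_mul_trace (hP : IsGammaProfile α k γ p h ρhat ρs ns m M) (y : Space d) :
    ρs y * traceCLM d (fderiv ℝ (profileVelocity ρs ns) y)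
      = 1 / 2 * fderiv ℝ ρs y y - fderiv ℝ ρs y (profileVelocity ρs ns y) := by
  have h1 := hP.trace_fderiv_momentum y
  rw [(hP.hasFDerivAt_momentum y).fderiv, map_add, map_smul, traceCLM_smulRight, smul_eq_mul] at h1
  linarith

lemma tensorDivergence_eq (hP : IsGammaProfile α k γ p h ρhat ρs ns m M) (y : Space d) :
    tensorDivergence (fun x => (ρs x)⁻¹ • tensor (ns x) (ns x)) y
      = fderiv ℝ (profileVelocity ρs ns) y (ns y)
        + traceCLM d (fderiv ℝ ns y) • profileVelocity ρs ns y := by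
  have hu := hP.hasFDerivAt_velocity y
  have hn := (hP.hasFDerivAt_momentum y).differentiableAt.hasFDerivAt
  have hent : ∀ i j, fderiv ℝ (fun x => ((ρs x)⁻¹ • tensor (ns x) (ns x)) i j) y
      (EuclideanSpace.single j 1) = profileVelocity ρs ns y i
          * (fderiv ℝ ns y (EuclideanSpace.single j 1)) j
        + ns y j * (fderiv ℝ (profileVelocity ρs ns) y (EuclideanSpace.single j 1)) i := by
    intro i j
    have e1 : HasFDerivAt (fun x => profileVelocity ρs ns x i) _ y :=
      (EuclideanSpace.proj (𝕜 := ℝ) i : Space d →L[ℝ] ℝ).hasFDerivAt.comp y hu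
    have e2 : HasFDerivAt (fun x => ns x j) _ y :=
      (EuclideanSpace.proj (𝕜 := ℝ) j : Space d →L[ℝ] ℝ).hasFDerivAt.comp y hn
    have e3 : HasFDerivAt (fun x => profileVelocity ρs ns x i * ns x j) _ y := e1.mul e2
    have e4 : (fun x => ((ρs x)⁻¹ • tensor (ns x) (ns x)) i j)
        = fun x => profileVelocity ρs ns x i * ns x j := by
      funext x
      simp [tensor, profileVelocity, mul_assoc]
    rw [e4, e3.fderiv]
    simp
  ext i
  rw [tensorDivergence]
  simp only [hent, Finset.sum_add_distrib, PiLp.add_apply, PiLp.smul_apply, smul_eq_mul]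
  rw [← divergence_eq_traceCLM, divergence, ← Finset.mul_sum, add_comm, mul_comm]
  congr 1
  conv_rhs => rw [← sum_smul_single (ns y), map_sum]
  simp

/-- By the stationary continuity equation the terms with derivatives of ρ* cancel: (div n*)u* =
½(y·∇ρ*)u* compensates the part of -½y·∇(ρ*u*) in which ρ* is differentiated. This is the
nonconservative form of the momentum residual. -/
lemma residual_eq (hP : IsGammaProfile α k γ p h ρhat ρs ns m M) (y : Space d) :
    profileResidual ρs ns y = ρs y •
      (fderiv ℝ (profileVelocity ρs ns) y (profileVelocity ρs ns y)
        - (1 / 2 : ℝ) • fderiv ℝ (profileVelocity ρs ns) y y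
        - ((d : ℝ) / 2) • profileVelocity ρs ns y) := by
  rw [profileResidual, hP.tensorDivergence_eq, hP.trace_fderiv_momentum,
    (hP.hasFDerivAt_momentum y).fderiv, hP.momentum_eq_smul y]
  simp only [add_apply, smul_apply, ContinuousLinearMap.smulRight_apply, map_smul]
  module

open scoped ContDiff in
lemma continuous_residual (hP : IsGammaProfile α k γ p h ρhat ρs ns m M) :
    Continuous (profileResidual ρs ns) := by
  have h1 : Continuous (fderiv ℝ (profileVelocity ρs ns)) :=
    hP.contDiff_velocity.continuous_fderiv (by simp)
  have h2 : Continuous (profileVelocity ρs ns) := hP.contDiff_velocity.continuous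
  have h3 : Continuous ρs := hP.admissible.contDiff.continuous
  have h4 : Continuous fun y => ρs y •
      (fderiv ℝ (profileVelocity ρs ns) y (profileVelocity ρs ns y)
        - (1 / 2 : ℝ) • fderiv ℝ (profileVelocity ρs ns) y y
        - ((d : ℝ) / 2) • profileVelocity ρs ns y) := by fun_prop
  exact (funext hP.residual_eq : profileResidual ρs ns = _) ▸ h4

lemma potPressure_eq (hP : IsGammaProfile α k γ p h ρhat ρs ns m M) :
    (fun y => potPressure h (ρs y)) = fun y => p (ρs y) :=
  funext fun _ => potPressure_of_pos hP.potential hP.pos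

/-- The flux relation in direction u* removes α|u*|², and the continuity equation of the profile
removes y·∇ρ*. The remaining pressure terms form the relative pressure p(r|ρ*) times div u*, which
is (γ-1)h(r|ρ*) div u* by `mul_relPot`. -/
lemma relDissipation_eq (hP : IsGammaProfile α k γ p h ρhat ρs ns m M) (τ : ℝ) (y : Space d)
    {r : ℝ} (hr : 0 ≤ r) (v : Space d) :
    relDissipation α p h ρs ns τ y r v = α * r * ‖r⁻¹ • v - profileVelocity ρs ns y‖ ^ 2
      + Real.exp (-(d * τ)) * r *
        (inner ℝ (fderiv ℝ (profileVelocity ρs ns) y (r⁻¹ • v - profileVelocity ρs ns y))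
            (r⁻¹ • v - profileVelocity ρs ns y)
          + (ρs y)⁻¹ * inner ℝ (profileResidual ρs ns y) (r⁻¹ • v - profileVelocity ρs ns y))
      + (γ - 1) * relPot h r (ρs y) * traceCLM d (fderiv ℝ (profileVelocity ρs ns) y) := by
  have h1 := hP.law.mul_relPot hP.potential hr (hP.pos (y := y))
  have h2 := hP.density_mul_trace y
  have h3 := hP.flux y (profileVelocity ρs ns y)
  have h4 : potPressure h (ρs y) = p (ρs y) := potPressure_of_pos hP.potential hP.pos
  have hρ := hP.pos (y := y).ne'
  rw [relDissipation, hP.residual_eq, real_inner_smul_left, inv_mul_cancel_left₀ hρ, hP.potPressure_eq, h4,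
    h1, (hP.hasFDerivAt_pressure y).fderiv, (hP.hasFDerivAt_potDeriv y).fderiv]
  rw [real_inner_self_eq_norm_sq, (hP.hasFDerivAt_potDeriv y).fderiv] at h3
  rw [show γ - 1 = γ - 2 + 1 by ring, Real.rpow_add_one hρ]
  simp only [smul_apply, smul_eq_mul] at h3 ⊢
  linear_combination -r * h3 + k * γ * ρs y ^ (γ - 2) * (r - ρs y) * h2

/-- The lower bound of the dissipation. -/
lemma dissipation_ge (hP : IsGammaProfile α k γ p h ρhat ρs ns m M)
    (hθ1 : ∀ y w, -(2 * inner ℝ (fderiv ℝ (profileVelocity ρs ns) y w) w) ≤ θ * ‖w‖ ^ 2)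
    (hθ2 : ∀ y, -((γ - 1) * traceCLM d (fderiv ℝ (profileVelocity ρs ns) y)) ≤ θ)
    (hμ1 : ∀ y, ‖profileResidual ρs ns y‖ / ρs y ≤ μ)
    (hμ2 : ∀ y, ‖profileResidual ρs ns y‖ / (2 * k * ρs y ^ γ) ≤ μ)
    {τ : ℝ} (y : Space d) {r : ℝ} {v : Space d} (hr : 0 ≤ r) :
    -((θ + μ * Real.exp (-(d / 2 * τ))) * relEntropyReal h τ r v (ρs y) (ns y)
      + Real.exp (-(d / 2 * τ)) * ‖profileResidual ρs ns y‖) ≤ relDissipation α p h ρs ns τ y r v := by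
  rw [hP.relDissipation_eq τ y hr]
  set w := r⁻¹ • v - profileVelocity ρs ns y with hw
  have hη : relEntropyReal h τ r v (ρs y) (ns y)
      = 1 / 2 * Real.exp (-(d * τ)) * r * ‖w‖ ^ 2 + relPot h r (ρs y) := rfl
  -- One factor e^{-dτ/2} is spent on |w| in Young's inequality so that the kinetic part of the
  -- relative entropy appears; the other one remains as the decay factor of all residual terms.
  have hE : Real.exp (-(d * τ)) = Real.exp (-(d / 2 * τ)) ^ 2 := by
    rw [← Real.exp_nat_mul]
    congr 1
    push_cast
    ring
  rw [hη, hE]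
  set e := Real.exp (-(d / 2 * τ)) with he
  have he0 : 0 < e := Real.exp_pos _
  have hρ := hP.pos (y := y)
  have hk := hP.law.1
  have hα := hP.damping_pos
  have hg : 0 ≤ relPot h r (ρs y) := relPot_nonneg hP.law.isPressure hP.potential hr (Or.inl hρ)
  have h1 := hP.law.le_relPot hP.potential hr hρ
  set R := ‖profileResidual ρs ns y‖ with hR
  have hR0 : 0 ≤ R := norm_nonneg _
  set g := relPot h r (ρs y)
  have a1 : 0 ≤ α * r * ‖w‖ ^ 2 := by positivity
  have a2 : -(θ * (1 / 2 * e ^ 2 * r * ‖w‖ ^ 2))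
      ≤ e ^ 2 * r * inner ℝ (fderiv ℝ (profileVelocity ρs ns) y w) w := by
    have := mul_le_mul_of_nonneg_left (hθ1 y w) (by positivity : 0 ≤ 1 / 2 * (e ^ 2 * r))
    linarith
  have a3 : -(θ * g) ≤ (γ - 1) * g * traceCLM d (fderiv ℝ (profileVelocity ρs ns) y) := by
    have := mul_le_mul_of_nonneg_right (hθ2 y) hg
    linarith
  have a4 : -(R * ‖w‖) ≤ inner ℝ (profileResidual ρs ns y) w :=
    neg_le_of_abs_le (abs_real_inner_le_norm _ _)
  -- Young's inequality
  have b1 : e * ‖w‖ ≤ 1 / 2 * (e ^ 2 * ‖w‖ ^ 2) + 1 / 2 := by nlinarith [sq_nonneg (e * ‖w‖ - 1)]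
  have b2 : r / ρs y ≤ 2 + g / (k * ρs y ^ γ) := by
    rw [div_le_iff₀ hρ, mul_comm]
    exact h1
  have b3 : e ^ 2 * r * ((ρs y)⁻¹ * (R * ‖w‖))
      ≤ e * (R / ρs y * (1 / 2 * e ^ 2 * r * ‖w‖ ^ 2) + 1 / 2 * (R * (r / ρs y))) := by
    have := mul_le_mul_of_nonneg_left b1 (by positivity : 0 ≤ e * (R * (r / ρs y)))
    calc _ = e * (R * (r / ρs y)) * (e * ‖w‖) := by rw [div_eq_mul_inv]; ring
      _ ≤ _ := this
      _ = _ := by rw [div_eq_mul_inv, div_eq_mul_inv]; ring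
  have b4 : R / ρs y * (1 / 2 * e ^ 2 * r * ‖w‖ ^ 2) ≤ μ * (1 / 2 * e ^ 2 * r * ‖w‖ ^ 2) :=
    mul_le_mul_of_nonneg_right (hμ1 y) (by positivity)
  -- The ratio r/ρ* is bounded by `le_relPot`: half of its constant 2 leaves exactly |R*|, and the
  -- entropy part has the coefficient |R*|/(2k(ρ*)^γ) ≤ μ.
  have b5 : 1 / 2 * (R * (r / ρs y)) ≤ R + μ * g := by
    have c1 := mul_le_mul_of_nonneg_left b2 hR0
    have c2 := mul_le_mul_of_nonneg_right (hμ2 y) hg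
    have c3 : R / (2 * k * ρs y ^ γ) * g = 1 / 2 * (R * (g / (k * ρs y ^ γ))) := by
      have : 0 < ρs y ^ γ := by positivity
      field_simp
    linarith
  have b6 := mul_le_mul_of_nonneg_left (add_le_add b4 b5) he0.le
  have b7 := mul_le_mul_of_nonneg_left a4 (by positivity : 0 ≤ e ^ 2 * r * (ρs y)⁻¹)
  nlinarith

end IsGammaProfile

/-! ### The similarity profile satisfies the requirements of `IsRelativeProfile` -/

namespace IsGammaProfile

variable {d : ℕ} {α k γ m M : ℝ} {p h : ℝ → ℝ} {ρhat ρs : Space d → ℝ}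
  {ns : Space d → Space d} {K : (Space d → Space d) → ℝ≥0}

lemma gammaWeight_ne_top (hP : IsGammaProfile α k γ p h ρhat ρs ns m M) :
    gammaWeight γ (gradient fun y => potDeriv h (ρs y)) ≠ ⊤ := by
  obtain ⟨C, hC, hC'⟩ := hP.exists_fderiv_gradient_le
  have hγ := hP.law.2.1
  have hγ0 : 0 ≤ γ - 1 := by linarith
  set v := gradient fun y => potDeriv h (ρs y)
  refine ne_top_of_le_ne_top ENNReal.ofReal_ne_top (gammaWeight_le
    (c := 2 * C + (γ - 1) * (‖traceCLM d‖ * C)) hγ (by positivity) (fun y w => ?_) fun y => ?_)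
  · have h1 := real_inner_le_norm (fderiv ℝ v y w) w
    have h2 := (fderiv ℝ v y).le_of_opNorm_le (hC' y) w
    have h3 := mul_le_mul_of_nonneg_right h2 (norm_nonneg w)
    have h4 : 0 ≤ (γ - 1) * (‖traceCLM d‖ * C) * ‖w‖ ^ 2 := by positivity
    nlinarith
  · have h1 := (le_abs_self _).trans ((traceCLM d).le_opNorm (fderiv ℝ v y))
    have h2 := mul_le_mul_of_nonneg_left (hC' y) (norm_nonneg (traceCLM d))
    have h3 := mul_le_mul_of_nonneg_left (h1.trans h2) hγ0
    linarith

lemma profileTheta_ne_top (hP : IsGammaProfile α k γ p h ρhat ρs ns m M) :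
    profileTheta α γ h ρs ≠ ⊤ :=
  ENNReal.mul_ne_top ENNReal.ofReal_ne_top hP.gammaWeight_ne_top

/-- Since -∇u* = (1/α)∇²h'(ρ*), the number θ consists of one-sided bounds for -∇u*. The same bounds
control the dissipation and the regularity weight. -/
lemma le_profileTheta (hP : IsGammaProfile α k γ p h ρhat ρs ns m M) :
    (∀ y w, -(2 * inner ℝ (fderiv ℝ (profileVelocity ρs ns) y w) w)
        ≤ (profileTheta α γ h ρs).toReal * ‖w‖ ^ 2) ∧
    ∀ y, -((γ - 1) * traceCLM d (fderiv ℝ (profileVelocity ρs ns) y))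
        ≤ (profileTheta α γ h ρs).toReal := by
  have hα := hP.damping_pos
  obtain ⟨h1, h2⟩ := le_gammaWeight_toReal hP.law.2.1
    (hP.contDiff_gradient.of_le (by simp)) hP.gammaWeight_ne_top
  have h3 : (profileTheta α γ h ρs).toReal
      = 1 / α * (gammaWeight γ (gradient fun y => potDeriv h (ρs y))).toReal := by
    rw [profileTheta, ENNReal.toReal_mul, ENNReal.toReal_ofReal (by positivity)]
  refine ⟨fun y w => ?_, fun y => ?_⟩
  · have := mul_le_mul_of_nonneg_left (h1 y w) (by positivity : 0 ≤ 1 / α)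
    rw [hP.fderiv_velocity, smul_apply, real_inner_smul_left, h3]
    linarith
  · have := mul_le_mul_of_nonneg_left (h2 y) (by positivity : 0 ≤ 1 / α)
    rw [hP.fderiv_velocity, map_smul, smul_eq_mul, h3]
    linarith

lemma le_profileMu (hP : IsGammaProfile α k γ p h ρhat ρs ns m M)
    (hμ : profileMu k γ ρs ns ≠ ⊤) (y : Space d) :
    ‖profileResidual ρs ns y‖ / ρs y ≤ (profileMu k γ ρs ns).toReal ∧
    ‖profileResidual ρs ns y‖ / (2 * k * ρs y ^ γ) ≤ (profileMu k γ ρs ns).toReal := by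
  have hk := hP.law.1
  have hc : Continuous fun y => ‖profileResidual ρs ns y‖ / (2 * k * ρs y ^ γ)
      + 3 * ‖profileResidual ρs ns y‖ / (2 * ρs y) := by
    have h1 := hP.continuous_residual.norm
    have h2 : Continuous ρs := hP.admissible.contDiff.continuous
    refine (h1.div (continuous_const.mul (h2.rpow_const fun y => Or.inl hP.pos.ne')) fun y => ?_).add
      ((continuous_const.mul h1).div (continuous_const.mul h2) fun y => ?_)
    · exact (mul_pos (by positivity) (Real.rpow_pos_of_pos hP.pos _)).ne'
    · exact (mul_pos two_pos hP.pos).ne'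
  have h1 := forall_le_of_ae_le hc (ae_le_toReal_eLpNorm_top hμ) y
  have hρ := hP.pos (y := y)
  have e1 : 0 ≤ ‖profileResidual ρs ns y‖ / (2 * k * ρs y ^ γ) := by positivity
  have e2 : 0 ≤ ‖profileResidual ρs ns y‖ / ρs y := by positivity
  have e3 : 3 * ‖profileResidual ρs ns y‖ / (2 * ρs y)
      = 3 / 2 * (‖profileResidual ρs ns y‖ / ρs y) := by field_simp
  rw [e3] at h1
  change _ ≤ (profileMu k γ ρs ns).toReal at h1
  constructor <;> linarith

/-- The gradient of -χu* is -χ∇u* up to a term of size |u*||∇χ|. The first part has weight at most θ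
because 0 ≤ χ ≤ 1, and the second is of order δ as u* is bounded. -/
lemma exists_weight_le (hP : IsGammaProfile α k γ p h ρhat ρs ns m M)
    (hK : ∀ ψ, IsSpatialTest ψ → (K ψ : ℝ≥0∞) = gammaWeight γ ψ) :
    ∃ C : ℝ, 0 ≤ C ∧ ∀ (χ : Space d → ℝ) (δ : ℝ), ContDiff ℝ 1 χ → HasCompactSupport χ →
      (∀ y, 0 ≤ χ y ∧ χ y ≤ 1) → (∀ y, ‖fderiv ℝ χ y‖ ≤ δ) →
      (K (fun y => χ y • -profileVelocity ρs ns y) : ℝ)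
        ≤ (profileTheta α γ h ρs).toReal + C * δ := by
  obtain ⟨U, hU, hU'⟩ := hP.exists_velocity_le
  obtain ⟨h1, h2⟩ := hP.le_profileTheta
  have hγ := hP.law.2.1
  have hγ0 : 0 ≤ γ - 1 := by linarith
  refine ⟨2 * U + (γ - 1) * U, by positivity, fun χ δ hχ hχc hχ01 hδ => ?_⟩
  have hδ0 : 0 ≤ δ := (norm_nonneg _).trans (hδ 0)
  set θ := (profileTheta α γ h ρs).toReal
  have hθ : 0 ≤ θ := ENNReal.toReal_nonneg
  set u := profileVelocity ρs ns with hu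
  have hspatial : IsSpatialTest fun y => χ y • -u y :=
    ⟨hχ.smul (hP.contDiff_velocity.of_le (by simp)).neg, hχc.smul_right⟩
  have hD : ∀ y, fderiv ℝ (fun y => χ y • -u y) y
      = χ y • -fderiv ℝ u y + (fderiv ℝ χ y).smulRight (-u y) := fun y => by
    have : HasFDerivAt (fun y => χ y • -u y) _ y :=
      ((hχ.differentiable one_ne_zero) y).hasFDerivAt.smul (hP.hasFDerivAt_velocity y).neg
    exact this.fderiv
  have hχu : ∀ y w, |fderiv ℝ χ y w| ≤ δ * ‖w‖ := fun y w =>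
    (fderiv ℝ χ y).le_of_opNorm_le (hδ y) w
  have h3 : gammaWeight γ (fun y => χ y • -u y)
      ≤ ENNReal.ofReal (θ + (2 * U + (γ - 1) * U) * δ) := by
    refine gammaWeight_le hγ (by positivity) (fun y w => ?_) fun y => ?_
    · obtain ⟨c1, c2⟩ := hχ01 y
      rw [hD]
      simp only [add_apply, smul_apply, neg_apply, ContinuousLinearMap.smulRight_apply,
        inner_add_left, real_inner_smul_left, inner_neg_left]
      have e1 := mul_le_mul_of_nonneg_left (h1 y w) c1
      have e2 : χ y * (θ * ‖w‖ ^ 2) ≤ θ * ‖w‖ ^ 2 := mul_le_of_le_one_left (by positivity) c2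
      have e3 : -(fderiv ℝ χ y w * inner ℝ (u y) w) ≤ U * δ * ‖w‖ ^ 2 := by
        refine (neg_le_abs _).trans ?_
        rw [abs_mul]
        have e4 := (abs_real_inner_le_norm (u y) w).trans
          (mul_le_mul_of_nonneg_right (hU' y) (norm_nonneg w))
        calc _ ≤ δ * ‖w‖ * (U * ‖w‖) :=
              mul_le_mul (hχu y w) e4 (abs_nonneg _) (by positivity)
          _ = _ := by ring
      have e5 : 0 ≤ (γ - 1) * U * δ * ‖w‖ ^ 2 := by positivity
      linarith
    · obtain ⟨c1, c2⟩ := hχ01 y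
      rw [hD, map_add, map_smul, map_neg, traceCLM_smulRight, smul_eq_mul, map_neg]
      have e1 := mul_le_mul_of_nonneg_left (h2 y) c1
      have e2 : χ y * θ ≤ θ := mul_le_of_le_one_left hθ c2
      have e3 : -fderiv ℝ χ y (u y) ≤ U * δ := by
        refine (neg_le_abs _).trans ((hχu y (u y)).trans ?_)
        rw [mul_comm]
        exact mul_le_mul_of_nonneg_right (hU' y) hδ0
      have e4 := mul_le_mul_of_nonneg_left e3 hγ0
      have e5 : 0 ≤ 2 * U * δ := by positivity
      linarith
  rw [← hK _ hspatial] at h3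
  have h4 := ENNReal.toReal_mono ENNReal.ofReal_ne_top h3
  rwa [ENNReal.toReal_ofReal (by positivity), ENNReal.coe_toReal] at h4

/-- Write p(r) = p(ρ*) + p'(ρ*)(r - ρ*) + (γ-1)h(r|ρ*) and bound r by the relative potential. As u*
is bounded and integrable, the pressure term p(ρ)u*·∇χ of the cutoff error is dominated. -/
lemma exists_growth (hP : IsGammaProfile α k γ p h ρhat ρs ns m M) :
    ∃ (C : ℝ) (f : Space d → ℝ), 0 ≤ C ∧ Integrable f ∧ ∀ y r, 0 ≤ r →
      ‖profileVelocity ρs ns y‖ * |p r| ≤ f y + C * relPot h r (ρs y) := by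
  obtain ⟨U, hU, hU'⟩ := hP.exists_velocity_le
  obtain ⟨A, hA, hA'⟩ := hP.exists_rpow_le γ
  obtain ⟨B, hB, hB'⟩ := hP.exists_rpow_le (γ - 1)
  obtain ⟨C, hC, hC'⟩ := le_relPot_bound hP.law.isPressure hP.potential M
  have hγ0 : 0 ≤ γ - 1 := by linarith [hP.law.2.1]
  have hk := hP.law.1
  have hkγ := hP.law_pos
  refine ⟨U * (k * γ * B * C + (γ - 1)), fun y => (k * A + k * γ * B * C) *
    ‖profileVelocity ρs ns y‖, by positivity, hP.integrable_velocity.norm.const_mul _,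
    fun y r hr => ?_⟩
  have hρ := hP.pos (y := y)
  have h1 := hP.law.mul_relPot hP.potential hr hρ
  have h2 := hC' r (ρs y) hr (Or.inl hρ) (hP.mem y).2
  have hg := relPot_nonneg hP.law.isPressure hP.potential hr (Or.inl hρ : HasPotDeriv h (ρs y))
  have h3 : 0 ≤ p r := by
    rw [hP.law.2.2 r hr]
    positivity
  have h4 : p (ρs y) ≤ k * A := by
    rw [hP.law.2.2 _ hρ.le]
    exact mul_le_mul_of_nonneg_left (hA' y) hk.le
  have h5 : k * γ * ρs y ^ (γ - 1) * (r - ρs y)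
      ≤ k * γ * B * (C * (1 + relPot h r (ρs y))) := by
    have e1 : k * γ * ρs y ^ (γ - 1) ≤ k * γ * B := mul_le_mul_of_nonneg_left (hB' y) hkγ.le
    have e2 : 0 ≤ k * γ * ρs y ^ (γ - 1) := by positivity
    have e3 : 0 ≤ k * γ * B := by positivity
    nlinarith [mul_nonneg e2 hρ.le, mul_le_mul_of_nonneg_right e1 hr]
  have h6 : p r ≤ (k * A + k * γ * B * C) + (k * γ * B * C + (γ - 1)) * relPot h r (ρs y) := by
    linarith
  rw [abs_of_nonneg h3]
  have h7 := mul_le_mul_of_nonneg_left h6 (norm_nonneg (profileVelocity ρs ns y))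
  have h8 : 0 ≤ (k * γ * B * C + (γ - 1)) * relPot h r (ρs y) := by positivity
  have h9 := mul_le_mul_of_nonneg_right (hU' y) h8
  linarith

lemma integrable_residual (hP : IsGammaProfile α k γ p h ρhat ρs ns m M)
    (hfin : profileK ρs ns ≠ ⊤) : Integrable fun y => ‖profileResidual ρs ns y‖ :=
  have h1 : HasFiniteIntegral (profileResidual ρs ns) := by
    rw [hasFiniteIntegral_iff_enorm]
    exact lt_top_iff_ne_top.2 hfin
  Integrable.norm ⟨hP.continuous_residual.aestronglyMeasurable, h1⟩

/-- A similarity profile for a `γ`-law has controlled relative dissipation. -/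
theorem isRelativeProfile (hP : IsGammaProfile α k γ p h ρhat ρs ns m M)
    (hK : ∀ ψ, IsSpatialTest ψ → (K ψ : ℝ≥0∞) = gammaWeight γ ψ)
    (hμ : profileMu k γ ρs ns ≠ ⊤) (hfin : profileK ρs ns ≠ ⊤) :
    IsRelativeProfile α p h ρhat ρs ns K (profileTheta α γ h ρs).toReal
      (profileMu k γ ρs ns).toReal fun y => ‖profileResidual ρs ns y‖ := by
  have hp := hP.law.isPressure
  have hh := hP.potential
  have hhat : ∀ᵐ y : Space d, 0 ≤ ρhat y := by
    filter_upwards [ae_ne_zero hP.dim_pos] with y hy using hP.lower_pos.le.trans (hP.limit_mem y hy).1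
  have hhatm := hP.angular.aemeasurable hP.dim_pos
  obtain ⟨L, hL, hL'⟩ := exists_lipschitz_Icc (f := potDeriv h) (M := M)
    (fun z hz => hP.law.hasDerivAt_potDeriv hh hz) (continuousOn_const.mul
      (continuousOn_id.rpow_const fun z hz => Or.inl (ne_of_gt hz))) hP.lower_pos
  obtain ⟨L₂, hL₂, hL₂'⟩ := exists_lipschitz_Icc (f := p) (M := M)
    (fun z hz => hP.law.hasDerivAt hz) (continuousOn_const.mul
      (continuousOn_id.rpow_const fun z hz => Or.inl (ne_of_gt hz))) hP.lower_pos
  have hpos : ∀ y, y ≠ 0 → 0 < ρhat y := fun y hy => hP.lower_pos.trans_le (hP.limit_mem y hy).1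
  refine ⟨ENNReal.toReal_nonneg, ENNReal.toReal_nonneg, fun y => norm_nonneg _,
    hP.integrable_residual hfin, fun y hy => Or.inl (hpos y hy), hhatm,
    ⟨M, fun y hy => (hP.limit_mem y hy).2⟩, fun y => Or.inl hP.pos,
    hP.contDiff_potDeriv.of_le (by simp), ?_,
    hP.contDiff_velocity.of_le (by simp), hP.flux, ?_, ⟨L * (M - m), fun y hy => ?_⟩, ?_, ?_,
    hP.integrable_velocity, ?_, hP.exists_growth, hP.exists_weight_le hK,
    fun τ hτ y r v hst => hP.dissipation_ge hP.le_profileTheta.1 hP.le_profileTheta.2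
      (fun y => (hP.le_profileMu hμ y).1) (fun y => (hP.le_profileMu hμ y).2) y hst.1⟩
  · rw [hP.potPressure_eq]
    exact (hp.contDiffOn.comp_contDiff (hP.admissible.contDiff.of_le (by simp)) fun _ => hP.pos)
  · refine Integrable.mono' (hP.integrable_difference.const_mul L)
      ((aemeasurable_potDeriv hp hh hhatm hhat).sub
        hP.contDiff_potDeriv.continuous.aemeasurable).aestronglyMeasurable ?_
    filter_upwards [ae_ne_zero hP.dim_pos] with y hy
    refine (hL' _ (hP.limit_mem y hy) _ (hP.mem y)).trans (mul_le_mul_of_nonneg_left ?_ hL)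
    rw [abs_sub_comm]
    exact le_mul_of_one_le_left (abs_nonneg _) (by linarith [norm_nonneg y])
  · refine (hL' _ (hP.limit_mem y hy) _ (hP.mem y)).trans (mul_le_mul_of_nonneg_left ?_ hL)
    obtain ⟨e1, e2⟩ := hP.limit_mem y hy
    obtain ⟨e3, e4⟩ := hP.mem y
    rw [abs_le]
    constructor <;> linarith
  · refine Integrable.mono' (hP.integrable_difference.const_mul L₂)
      ((by fun_prop : Continuous fun y : Space d => 1 + ‖y‖).aestronglyMeasurable.mul
        (((aemeasurable_potPressure hp hh hhatm hhat).sub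
          (aemeasurable_potPressure hp hh hP.admissible.contDiff.continuous.aemeasurable
            (Eventually.of_forall fun y => hP.pos.le))).norm.aestronglyMeasurable)) ?_
    filter_upwards [ae_ne_zero hP.dim_pos] with y hy
    rw [potPressure_of_pos hh (hpos y hy), potPressure_of_pos hh hP.pos, norm_mul,
      Real.norm_eq_abs, Real.norm_eq_abs, abs_abs, abs_of_pos (by positivity : 0 < 1 + ‖y‖),
      mul_left_comm L₂]
    refine mul_le_mul_of_nonneg_left ?_ (by positivity)
    rw [abs_sub_comm (ρs y)]
    exact hL₂' _ (hP.limit_mem y hy) _ (hP.mem y)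
  · obtain ⟨A, hA, hA'⟩ := hP.exists_rpow_le γ
    refine ⟨k * A, fun y => ?_⟩
    have hρ := hP.pos (y := y)
    have hk := hP.law.1
    rw [potPressure_of_pos hh hρ, hP.law.2.2 _ hρ.le, abs_of_pos (by positivity)]
    exact mul_le_mul_of_nonneg_left (hA' y) hk.le
  · obtain ⟨U, -, hU'⟩ := hP.exists_velocity_le
    exact ⟨U, hU'⟩

end IsGammaProfile

/-! ### Vanishing and finiteness of the constants of the similarity profile -/

/-- A bounded `C²` function whose Hessian is negative semidefinite is constant. -/
lemma gradient_eq_zero_of_concave {d : ℕ} {b : Space d → ℝ} {C : ℝ} (hb : Differentiable ℝ b)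
    (hg : Differentiable ℝ (gradient b)) (hC : ∀ y, |b y| ≤ C)
    (hH : ∀ y w, inner ℝ (fderiv ℝ (gradient b) y w) w ≤ 0) (y : Space d) : gradient b y = 0 := by
  have hgi := inner_gradient_eq b
  generalize gradient b = G at hg hH hgi ⊢
  -- In the direction of steepest descent the slope stays at most -|∇b(y)|² because the Hessian is
  -- nonpositive. Then b(y + tw) ≤ b(y) - t|∇b(y)|², which contradicts boundedness for large t
  -- unless ∇b(y) = 0.
  set w := -G y with hw
  have hline : ∀ t : ℝ, HasDerivAt (fun t : ℝ => y + t • w) w t := fun t => by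
    simpa using ((hasDerivAt_id t).smul_const w).const_add y
  have h1 : ∀ t : ℝ, HasDerivAt (fun t : ℝ => inner ℝ (G (y + t • w)) w)
      (inner ℝ (fderiv ℝ (G) (y + t • w) w) w) t := fun t => by
    have e1 : HasDerivAt (fun t : ℝ => G (y + t • w)) _ t :=
      (hg (y + t • w)).hasFDerivAt.comp_hasDerivAt t (hline t)
    simpa using e1.inner ℝ (hasDerivAt_const t w)
  have h2 : Antitone fun t : ℝ => inner ℝ (G (y + t • w)) w :=
    antitone_of_deriv_nonpos (fun t => (h1 t).differentiableAt) fun t => by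
      rw [(h1 t).deriv]
      exact hH _ _
  have h3 : ∀ t : ℝ, HasDerivAt (fun t : ℝ => b (y + t • w) - t * inner ℝ (G y) w)
      (inner ℝ (G (y + t • w)) w - inner ℝ (G y) w) t := fun t => by
    have e1 : HasDerivAt (fun t : ℝ => b (y + t • w)) (fderiv ℝ b (y + t • w) w) t :=
      (hb (y + t • w)).hasFDerivAt.comp_hasDerivAt t (hline t)
    rw [← hgi] at e1
    have e2 := e1.sub ((hasDerivAt_id t).mul_const (inner ℝ (G y) w))
    rwa [one_mul] at e2
  have h4 : AntitoneOn (fun t : ℝ => b (y + t • w) - t * inner ℝ (G y) w) (Ici 0) := by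
    refine antitoneOn_of_deriv_nonpos (convex_Ici 0)
      (fun t _ => (h3 t).continuousAt.continuousWithinAt)
      (fun t _ => (h3 t).differentiableAt.differentiableWithinAt) fun t ht => ?_
    rw [interior_Ici] at ht
    rw [(h3 t).deriv]
    have := h2 (le_of_lt ht)
    simp only [zero_smul, add_zero] at this
    linarith
  have h5 : inner ℝ (G y) w = -‖G y‖ ^ 2 := by
    rw [hw, inner_neg_right, real_inner_self_eq_norm_sq]
  have h6 : ∀ t : ℝ, 0 ≤ t → t * ‖G y‖ ^ 2 ≤ 2 * C := fun t ht => by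
    have e1 := h4 self_mem_Ici ht ht
    simp only [zero_smul, add_zero, zero_mul, sub_zero, h5] at e1
    have e2 := abs_le.1 (hC y)
    have e3 := abs_le.1 (hC (y + t • w))
    linarith [e2.2, e3.1]
  by_contra hne
  have h7 : 0 < ‖G y‖ ^ 2 := by positivity
  have hC0 : 0 ≤ C := (abs_nonneg _).trans (hC y)
  have h8 := h6 ((2 * C + 1) / ‖G y‖ ^ 2) (by positivity)
  rw [div_mul_cancel₀ _ h7.ne'] at h8
  linarith

namespace IsGammaProfile

variable {d : ℕ} {α k γ m M : ℝ} {p h : ℝ → ℝ} {ρhat ρs : Space d → ℝ}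
  {ns : Space d → Space d}

lemma exists_abs_potDeriv_le (hP : IsGammaProfile α k γ p h ρhat ρs ns m M) :
    ∃ C : ℝ, ∀ y, |potDeriv h (ρs y)| ≤ C := by
  obtain ⟨C, hC⟩ := (isCompact_Icc (a := m) (b := M)).exists_bound_of_continuousOn
    ((hP.law.contDiffOn_potDeriv hP.potential).continuousOn.mono
      fun z hz => hP.lower_pos.trans_le hz.1)
  exact ⟨C, fun y => hC _ (hP.mem y)⟩

lemma residual_eq_zero_of_velocity (hP : IsGammaProfile α k γ p h ρhat ρs ns m M)
    (h0 : ∀ y, profileVelocity ρs ns y = 0) (y : Space d) : profileResidual ρs ns y = 0 := by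
  rw [hP.residual_eq, show profileVelocity ρs ns = fun _ => 0 from funext h0]
  simp

/-- If `θ = 0`, then the residual vanishes. -/
lemma residual_eq_zero_of_theta (hP : IsGammaProfile α k γ p h ρhat ρs ns m M)
    (hθ : (profileTheta α γ h ρs).toReal = 0) (y : Space d) : profileResidual ρs ns y = 0 := by
  obtain ⟨C, hC⟩ := hP.exists_abs_potDeriv_le
  refine hP.residual_eq_zero_of_velocity (fun y => ?_) y
  -- For θ = 0 the Hessian of h'(ρ*) is negative semidefinite, and h'(ρ*) is bounded because ρ*
  -- takes values in [m, M] with m > 0.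
  rw [hP.velocity_eq, gradient_eq_zero_of_concave (hP.contDiff_potDeriv.differentiable (by simp))
    (hP.contDiff_gradient.differentiable (by simp)) hC (fun y w => ?_), smul_zero]
  have h1 := hP.le_profileTheta.1 y w
  have hα := hP.damping_pos
  rw [hθ, hP.fderiv_velocity, smul_apply, real_inner_smul_left] at h1
  by_contra! h2
  have h3 : 0 < 1 / α * inner ℝ (fderiv ℝ (gradient fun y => potDeriv h (ρs y)) y w) w := by
    positivity
  linarith

end IsGammaProfile

/-! ### Finiteness of μ and K in one dimension: Gaussian decay -/

lemma apply_eq_traceCLM_smul (L : Space 1 →L[ℝ] Space 1) (v : Space 1) :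
    L v = traceCLM 1 L • v := by
  have h1 : v = v 0 • EuclideanSpace.single (0 : Fin 1) (1 : ℝ) := by
    ext i
    fin_cases i
    simp
  have h2 : traceCLM 1 L = L (EuclideanSpace.single (0 : Fin 1) (1 : ℝ)) 0 := by
    simp [traceCLM]
  ext i
  fin_cases i
  rw [h2]
  conv_lhs => rw [h1, map_smul]
  simp [mul_comm]

lemma inner_mul_self_of_one (v w : Space 1) : inner ℝ v w * inner ℝ v w = ‖v‖ ^ 2 * ‖w‖ ^ 2 := by
  simp [EuclideanSpace.norm_sq_eq, PiLp.inner_apply]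
  ring

/-- Use e^x ≥ 1 and e^x ≥ x²/2 at x = as². Of the four powers of 1 + s, two come from the polynomial
factor of the residual and two are left for an integrable majorant on the line. -/
lemma one_add_pow_four_mul_exp_le {a s : ℝ} (ha : 0 < a) :
    (1 + s) ^ 4 * Real.exp (-(a * s ^ 2)) ≤ 8 + 16 / a ^ 2 := by
  have h1 := Real.quadratic_le_exp_of_nonneg (by positivity : 0 ≤ a * s ^ 2)
  have h2 : (1 + s) ^ 4 ≤ 8 + 8 * s ^ 4 := by nlinarith [sq_nonneg (1 - s), sq_nonneg (1 - s ^ 2)]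
  have h3 : 8 + 8 * s ^ 4 ≤ (8 + 16 / a ^ 2) * Real.exp (a * s ^ 2) := by
    have e1 : 1 ≤ Real.exp (a * s ^ 2) := Real.one_le_exp (by positivity)
    have e2 : (a * s ^ 2) ^ 2 / 2 ≤ Real.exp (a * s ^ 2) := by
      nlinarith [mul_nonneg ha.le (sq_nonneg s)]
    have e3 : 8 * s ^ 4 = 16 / a ^ 2 * ((a * s ^ 2) ^ 2 / 2) := by
      field_simp
      ring
    rw [e3, add_mul]
    gcongr
    linarith
  rw [Real.exp_neg, ← div_eq_mul_inv, div_le_iff₀ (Real.exp_pos _)]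
  exact h2.trans h3

namespace IsGammaProfile

section Finite

variable {d : ℕ} {α k γ m M : ℝ} {p h : ℝ → ℝ} {ρhat ρs : Space d → ℝ}
  {ns : Space d → Space d}

lemma profileMu_ne_top (hP : IsGammaProfile α k γ p h ρhat ρs ns m M) {C : ℝ}
    (hC : ∀ y, ‖profileResidual ρs ns y‖ ≤ C) : profileMu k γ ρs ns ≠ ⊤ := by
  obtain ⟨A, hA, hA'⟩ := hP.exists_rpow_le (-γ)
  have hk := hP.law.1
  have hm := hP.lower_pos
  have hC0 : 0 ≤ C := (norm_nonneg _).trans (hC 0)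
  rw [profileMu, eLpNorm_exponent_top]
  refine ne_top_of_le_ne_top (ENNReal.ofReal_ne_top (r := C * A / (2 * k) + 3 * C / (2 * m)))
    (eLpNormEssSup_le_of_ae_bound (Eventually.of_forall fun y => ?_))
  have hρ := hP.pos (y := y)
  rw [Real.norm_eq_abs, abs_of_nonneg (by positivity)]
  have h1 := hC y
  have h2 := hA' y
  have h3 := (hP.mem y).1
  refine add_le_add ?_ (by gcongr)
  rw [mul_comm (2 * k), ← div_div, div_eq_mul_inv _ (ρs y ^ γ), ← Real.rpow_neg hρ.le]
  gcongr

lemma profileK_ne_top {f : Space d → ℝ} (hf : Integrable f)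
    (hC : ∀ y, ‖profileResidual ρs ns y‖ ≤ f y) : profileK ρs ns ≠ ⊤ := by
  refine ne_top_of_le_ne_top hf.2.ne (lintegral_mono fun y => ?_)
  rw [enorm_le_iff_norm_le]
  exact (hC y).trans (le_abs_self _)

lemma fderiv_density_eq (hP : IsGammaProfile α k γ p h ρhat ρs ns m M) (y v : Space d) :
    k * γ * ρs y ^ (γ - 1) * fderiv ℝ ρs y v = -(α * inner ℝ (ns y) v) := by
  have h1 := hP.flux y v
  rw [(hP.hasFDerivAt_potDeriv y).fderiv] at h1
  rw [hP.momentum_eq_smul y, real_inner_smul_left, show γ - 1 = γ - 2 + 1 by ring,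
    Real.rpow_add_one hP.pos.ne']
  simp only [smul_apply, smul_eq_mul] at h1
  linear_combination ρs y * h1

/-- The flux relation is solved for ∇ρ* = -(α/(kγ))(ρ*)^{2-γ}u*, so that decay of the velocity
passes on to the density gradient. -/
lemma exists_norm_fderiv_le (hP : IsGammaProfile α k γ p h ρhat ρs ns m M) :
    ∃ C : ℝ, 0 ≤ C ∧ ∀ y, ‖fderiv ℝ ρs y‖ ≤ C * ‖profileVelocity ρs ns y‖ := by
  obtain ⟨C, hC, hC'⟩ := hP.exists_rpow_le (-(γ - 2))
  have hkγ := hP.law_pos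
  have hk := hP.law.1
  have hγ : 0 < γ := by linarith [hP.law.2.1]
  have hα := hP.damping_pos
  refine ⟨α / (k * γ) * C, by positivity, fun y => ?_⟩
  refine ContinuousLinearMap.opNorm_le_bound _ (by positivity) fun v => ?_
  have h1 := hP.flux y v
  rw [(hP.hasFDerivAt_potDeriv y).fderiv] at h1
  simp only [smul_apply, smul_eq_mul] at h1
  have hρ := hP.pos (y := y)
  have h2 : fderiv ℝ ρs y v
      = -(α / (k * γ) * ρs y ^ (-(γ - 2)) * inner ℝ (profileVelocity ρs ns y) v) := by
    have : 0 < ρs y ^ (γ - 2) := by positivity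
    rw [Real.rpow_neg hρ.le]
    field_simp
    linarith
  rw [h2, norm_neg, norm_mul, Real.norm_eq_abs, Real.norm_eq_abs,
    abs_of_pos (by positivity : 0 < α / (k * γ) * ρs y ^ (-(γ - 2))), mul_assoc _ ‖_‖]
  have h3 := abs_real_inner_le_norm (profileVelocity ρs ns y) v
  have h4 := hC' y
  gcongr

end Finite

section OneDim

variable {α k γ m M : ℝ} {p h : ℝ → ℝ} {ρhat ρs : Space 1 → ℝ} {ns : Space 1 → Space 1}

/-- The Gaussian decay of the momentum in one dimension. -/
lemma exists_momentum_decay (hP : IsGammaProfile α k γ p h ρhat ρs ns m M) :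
    ∃ c : ℝ, 0 < c ∧ ∀ y, ‖ns y‖ ^ 2 ≤ ‖ns 0‖ ^ 2 * Real.exp (-(c * ‖y‖ ^ 2)) := by
  obtain ⟨A, hA, hA'⟩ := hP.exists_rpow_le (γ - 1)
  have hkγ := hP.law_pos
  have hk := hP.law.1
  have hγ : 0 < γ := by linarith [hP.law.2.1]
  have hα := hP.damping_pos
  have hA0 : 0 < A := (Real.rpow_pos_of_pos (hP.pos (y := 0)) _).trans_le (hA' 0)
  set c := α / (2 * (k * γ * A)) with hc
  have hc0 : 0 < c := by positivity
  refine ⟨c, hc0, fun y => ?_⟩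
  have hline : ∀ t : ℝ, HasDerivAt (fun t : ℝ => t • y) y t := fun t => by
    simpa using (hasDerivAt_id t).smul_const y
  have h1 : ∀ t : ℝ, HasDerivAt (fun t : ℝ => ‖ns (t • y)‖ ^ 2)
      (t * (fderiv ℝ ρs (t • y) y * inner ℝ (ns (t • y)) y)) t := fun t => by
    have e1 : HasDerivAt (fun t : ℝ => ns (t • y)) (fderiv ℝ ns (t • y) y) t :=
      HasFDerivAt.comp_hasDerivAt (l := ns) t
        (hP.hasFDerivAt_momentum (t • y)).differentiableAt.hasFDerivAt (hline t)
    have e2 := e1.norm_sq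
    -- In one dimension the derivative of n* is multiplication by its trace, which is ½y·∇ρ* by the
    -- stationary continuity equation.
    rw [apply_eq_traceCLM_smul, hP.trace_fderiv_momentum, real_inner_smul_right, map_smul,
      smul_eq_mul] at e2
    convert e2 using 1
    ring
  have h2 : ∀ t : ℝ, HasDerivAt
      (fun t : ℝ => ‖ns (t • y)‖ ^ 2 * Real.exp (c * (t ^ 2 * ‖y‖ ^ 2)))
      (t * (fderiv ℝ ρs (t • y) y * inner ℝ (ns (t • y)) y)
          * Real.exp (c * (t ^ 2 * ‖y‖ ^ 2))
        + ‖ns (t • y)‖ ^ 2 * (Real.exp (c * (t ^ 2 * ‖y‖ ^ 2)) * (c * (2 * t * ‖y‖ ^ 2)))) t :=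
    fun t => by
      have e1 : HasDerivAt (fun t : ℝ => c * (t ^ 2 * ‖y‖ ^ 2)) (c * (2 * t * ‖y‖ ^ 2)) t := by
        simpa using ((hasDerivAt_pow 2 t).mul_const (‖y‖ ^ 2)).const_mul c
      exact (h1 t).mul e1.exp
  -- The flux relation makes ∇ρ* a negative multiple of n*, so that d/dt |n*(ty)|² =
  -- -(α/q)t|y|²|n*(ty)|² with q = p'(ρ*) ≤ kγA. The choice of c gives 2c ≤ α/q; hence the weighted
  -- square decreases.
  have h3 : AntitoneOn (fun t : ℝ => ‖ns (t • y)‖ ^ 2 * Real.exp (c * (t ^ 2 * ‖y‖ ^ 2)))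
      (Ici 0) := by
    refine antitoneOn_of_deriv_nonpos (convex_Ici 0)
      (fun t _ => (h2 t).continuousAt.continuousWithinAt)
      (fun t _ => (h2 t).differentiableAt.differentiableWithinAt) fun t ht => ?_
    rw [interior_Ici] at ht
    rw [(h2 t).deriv]
    have e1 := hP.fderiv_density_eq (t • y) y
    have e2 := inner_mul_self_of_one (ns (t • y)) y
    have hρ := hP.pos (y := t • y)
    set q := k * γ * ρs (t • y) ^ (γ - 1) with hq
    have hq0 : 0 < q := by positivity
    have hqA : q ≤ k * γ * A := mul_le_mul_of_nonneg_left (hA' _) hkγ.le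
    have e3 : fderiv ℝ ρs (t • y) y * inner ℝ (ns (t • y)) y
        = -(α / q * (‖ns (t • y)‖ ^ 2 * ‖y‖ ^ 2)) := by
      field_simp
      linear_combination inner ℝ (ns (t • y)) y * e1 - α * e2
    have e4 : 2 * c ≤ α / q := by
      rw [hc, le_div_iff₀ hq0]
      calc 2 * (α / (2 * (k * γ * A))) * q ≤ 2 * (α / (2 * (k * γ * A))) * (k * γ * A) := by gcongr
        _ = α := by field_simp
    rw [e3]
    have e5 : 0 ≤ t * Real.exp (c * (t ^ 2 * ‖y‖ ^ 2)) * (‖ns (t • y)‖ ^ 2 * ‖y‖ ^ 2) := by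
      have : 0 < t := ht
      positivity
    nlinarith [mul_le_mul_of_nonneg_right e4 e5]
  have h4 := h3 self_mem_Ici (mem_Ici.2 zero_le_one) zero_le_one
  simp only [one_smul, zero_smul, one_pow, one_mul, ne_eq, OfNat.ofNat_ne_zero, not_false_eq_true,
    zero_pow, zero_mul, mul_zero, Real.exp_zero, mul_one] at h4
  rw [Real.exp_neg, ← div_eq_mul_inv, le_div_iff₀ (Real.exp_pos _)]
  exact h4

lemma exists_velocity_decay (hP : IsGammaProfile α k γ p h ρhat ρs ns m M) :
    ∃ c U : ℝ, 0 < c ∧ 0 ≤ U ∧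
      ∀ y, ‖profileVelocity ρs ns y‖ ≤ U * Real.exp (-(c * ‖y‖ ^ 2)) := by
  obtain ⟨c, hc, h1⟩ := hP.exists_momentum_decay
  have hm := hP.lower_pos
  refine ⟨c / 2, ‖ns 0‖ / m, by positivity, by positivity, fun y => ?_⟩
  have h2 : Real.exp (-(c * ‖y‖ ^ 2)) = Real.exp (-(c / 2 * ‖y‖ ^ 2)) ^ 2 := by
    rw [← Real.exp_nat_mul]
    congr 1
    push_cast
    ring
  have h3 := h1 y
  rw [h2, ← mul_pow] at h3
  have h4 := abs_le_of_sq_le_sq' h3 (by positivity)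
  have h5 : m * ‖profileVelocity ρs ns y‖ ≤ ‖ns y‖ := by
    rw [hP.momentum_eq_smul y, norm_smul, Real.norm_eq_abs, abs_of_pos hP.pos]
    exact mul_le_mul_of_nonneg_right (hP.mem y).1 (norm_nonneg _)
  rw [div_mul_eq_mul_div, le_div_iff₀ hm]
  linarith [h4.2]

/-- The residual contains y·∇u*, for which the assumptions provide no weighted bound. In one
dimension ∇u* is a scalar, determined through `density_mul_trace` by ∇ρ*, u* and y. Since |∇ρ*| is
bounded by a multiple of |u*|, the residual is at most a quadratic polynomial in |y| times |u*|, and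
the Gaussian decay of u* dominates. -/
lemma exists_residual_decay (hP : IsGammaProfile α k γ p h ρhat ρs ns m M) :
    ∃ C : ℝ, 0 ≤ C ∧ ∀ y, ‖profileResidual ρs ns y‖ ≤ C * (1 + ‖y‖) ^ (-2 : ℝ) := by
  obtain ⟨c, U, hc, hU, hu⟩ := hP.exists_velocity_decay
  obtain ⟨D, hD, hD'⟩ := hP.exists_norm_fderiv_le
  have hM : 0 ≤ M := (hP.lower_pos.le.trans (hP.mem 0).1).trans (hP.mem 0).2
  refine ⟨(D * (U + 1) ^ 2 + M) * U * (8 + 16 / c ^ 2), by positivity, fun y => ?_⟩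
  set u := profileVelocity ρs ns y with hu'
  set T := traceCLM 1 (fderiv ℝ (profileVelocity ρs ns) y) with hT
  set s := ‖y‖ with hs
  have hs0 : 0 ≤ s := norm_nonneg _
  have hρ := hP.pos (y := y)
  have huU : ‖u‖ ≤ U := (hu y).trans
    (mul_le_of_le_one_right hU (Real.exp_le_one_iff.2 (by
      have : 0 ≤ c * ‖y‖ ^ 2 := by positivity
      linarith)))
  have h1 : profileResidual ρs ns y
      = (ρs y * T) • (u - (1 / 2 : ℝ) • y) - (ρs y / 2) • u := by
    rw [hP.residual_eq, apply_eq_traceCLM_smul _ (profileVelocity ρs ns y),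
      apply_eq_traceCLM_smul _ y, ← hT, ← hu']
    push_cast
    module
  have h2 : |ρs y * T| ≤ D * ‖u‖ * (U + s) := by
    rw [hP.density_mul_trace y]
    have e1 := (fderiv ℝ ρs y).le_of_opNorm_le (hD' y) y
    have e2 := (fderiv ℝ ρs y).le_of_opNorm_le (hD' y) u
    rw [Real.norm_eq_abs] at e1 e2
    have e3 : 0 ≤ D * ‖u‖ := by positivity
    have e4 := mul_le_mul_of_nonneg_left huU e3
    refine (abs_sub _ _).trans ?_
    rw [abs_mul, abs_of_pos (by norm_num : (0 : ℝ) < 1 / 2)]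
    nlinarith [mul_nonneg e3 hs0]
  have h3 : ‖u - (1 / 2 : ℝ) • y‖ ≤ U + s := by
    refine (norm_sub_le _ _).trans ?_
    rw [norm_smul, Real.norm_eq_abs, abs_of_pos (by norm_num : (0 : ℝ) < 1 / 2)]
    linarith
  have h4 : ‖profileResidual ρs ns y‖ ≤ (D * (U + s) ^ 2 + M) * ‖u‖ := by
    rw [h1]
    refine (norm_sub_le _ _).trans ?_
    rw [norm_smul, norm_smul, Real.norm_eq_abs, Real.norm_eq_abs, abs_of_pos (half_pos hρ)]
    have e1 := mul_le_mul h2 h3 (norm_nonneg _) (by positivity)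
    have e2 : ρs y / 2 * ‖u‖ ≤ M * ‖u‖ := by
      have := (hP.mem y).2
      gcongr
      linarith
    linarith
  have h5 : D * (U + s) ^ 2 + M ≤ (D * (U + 1) ^ 2 + M) * (1 + s) ^ 2 := by
    have e1 : U + s ≤ (U + 1) * (1 + s) := by nlinarith
    have e2 : (U + s) ^ 2 ≤ ((U + 1) * (1 + s)) ^ 2 := pow_le_pow_left₀ (by positivity) e1 2
    have e3 : M ≤ M * (1 + s) ^ 2 := le_mul_of_one_le_right hM (by nlinarith)
    nlinarith [mul_le_mul_of_nonneg_left e2 hD]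
  have h6 := one_add_pow_four_mul_exp_le (s := s) hc
  rw [Real.rpow_neg (by positivity), show (2 : ℝ) = ((2 : ℕ) : ℝ) by norm_num, Real.rpow_natCast,
    ← div_eq_mul_inv, le_div_iff₀ (by positivity)]
  calc ‖profileResidual ρs ns y‖ * (1 + s) ^ 2
      ≤ (D * (U + 1) ^ 2 + M) * (1 + s) ^ 2 * (U * Real.exp (-(c * s ^ 2))) * (1 + s) ^ 2 := by
        gcongr
        exact h4.trans (mul_le_mul h5 (hu y) (norm_nonneg _) (by positivity))
    _ = (D * (U + 1) ^ 2 + M) * U * ((1 + s) ^ 4 * Real.exp (-(c * s ^ 2))) := by ring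
    _ ≤ _ := by gcongr

lemma finite_of_one (hP : IsGammaProfile α k γ p h ρhat ρs ns m M) :
    profileMu k γ ρs ns ≠ ⊤ ∧ profileK ρs ns ≠ ⊤ := by
  obtain ⟨C, hC, hC'⟩ := hP.exists_residual_decay
  refine ⟨hP.profileMu_ne_top (C := C) fun y => (hC' y).trans (mul_le_of_le_one_right hC ?_),
    profileK_ne_top ((integrable_one_add_norm (by simp)).const_mul C) hC'⟩
  exact Real.rpow_le_one_of_one_le_of_nonpos (by linarith [norm_nonneg y]) (by norm_num)

end OneDim

end IsGammaProfile

/-! ### Angular limit densities in several dimensions -/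

section Angular

variable {d : ℕ}

lemma exists_abs_le_mul_norm {g : Space d → ℝ} (hg : Continuous g) (hc : HasCompactSupport g)
    (h0 : (0 : Space d) ∉ tsupport g) : ∃ C : ℝ, 0 ≤ C ∧ ∀ y, |g y| ≤ C * ‖y‖ := by
  obtain ⟨B, hB⟩ := hg.bounded_above_of_compact_support hc
  have hB0 : 0 ≤ B := (norm_nonneg _).trans (hB 0)
  obtain ⟨r, hr, hr'⟩ := Metric.eventually_nhds_iff.1 (notMem_tsupport_iff_eventuallyEq.1 h0)
  refine ⟨B / r, by positivity, fun y => ?_⟩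
  by_cases hy : dist y 0 < r
  · rw [hr' hy, Pi.zero_apply, abs_zero]
    positivity
  · rw [dist_zero_right, not_lt] at hy
    rw [div_mul_eq_mul_div, le_div_iff₀ hr]
    exact mul_le_mul (hB y) hy hr.le hB0

lemma abs_integral_le_of_dilation {F G : Space d → ℝ} {c C : ℝ} (hc : 0 < c) (hG : Integrable G)
    (hF : ∀ᵐ y, |F y| ≤ C * G (c • y)) : |∫ y, F y| ≤ C * ((c ^ d)⁻¹ * ∫ y, G y) := by
  have h1 := norm_integral_le_of_norm_le (f := F) ((hG.comp_smul hc.ne').const_mul C) hF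
  rwa [integral_const_mul, Measure.integral_comp_smul, finrank_euclideanSpace_fin,
    abs_of_pos (by positivity)] at h1

lemma continuous_mul_of_tsupport {f g : Space d → ℝ} {U : Set (Space d)} (hU : IsOpen U)
    (hf : ContinuousOn f U) (hg : Continuous g) (hgU : tsupport g ⊆ U) :
    Continuous fun y => f y * g y :=
  (hf.mul hg.continuousOn).continuous_of_tsupport_subset hU
    ((tsupport_mul_subset_right (f := f) (g := g)).trans hgU)

/-- The weak derivatives of an angular limit density vanish, if it is approximated by the
dilations of a profile whose gradient is integrable with the weight `|y|`. -/
lemma IsAngular.integral_mul_fderiv_eq_zero {ρhat ρs : Space d → ℝ} (hd : 1 ≤ d)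
    (hang : IsAngular ρhat) (hρ : ContDiff ℝ 1 ρs)
    (h1 : Integrable fun y => ‖y‖ * ‖fderiv ℝ ρs y‖)
    (h2 : Integrable fun y => ‖y‖ * |ρs y - ρhat y|) {ζ : Space d → ℝ} (hζ : ContDiff ℝ 1 ζ)
    (hζc : HasCompactSupport ζ) (hζ0 : tsupport ζ ⊆ {0}ᶜ) (e : Space d) :
    ∫ y, ρhat y * fderiv ℝ ζ y e = 0 := by
  have hζd : Continuous fun y => fderiv ℝ ζ y e :=
    (hζ.continuous_fderiv one_ne_zero).clm_apply continuous_const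
  have hζdc : HasCompactSupport fun y => fderiv ℝ ζ y e := hζc.fderiv_apply (𝕜 := ℝ) e
  have hζd0 : tsupport (fun y => fderiv ℝ ζ y e) ⊆ {0}ᶜ :=
    (tsupport_fderiv_apply_subset ℝ e).trans hζ0
  obtain ⟨C₁, hC₁, hC₁'⟩ := exists_abs_le_mul_norm hζ.continuous hζc fun h => hζ0 h rfl
  obtain ⟨C₂, hC₂, hC₂'⟩ := exists_abs_le_mul_norm hζd hζdc fun h => hζd0 h rfl
  set I := C₁ * ‖e‖ * ∫ y, ‖y‖ * ‖fderiv ℝ ρs y‖ with hI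
  set J := C₂ * ∫ y, ‖y‖ * |ρs y - ρhat y| with hJ
  have hi1 : Integrable fun y => ρhat y * fderiv ℝ ζ y e :=
    (continuous_mul_of_tsupport isOpen_compl_singleton hang.contDiffOn.continuousOn hζd
      hζd0).integrable_of_hasCompactSupport hζdc.mul_left
  -- By homogeneity ρ̂ is its own dilation, so ρ̂ is compared with ρ*(c·). As ζ and its derivative
  -- vanish near 0, both are at most a multiple of |y|; this supplies the weight under which ∇ρ* and
  -- ρ* - ρ̂ are integrable. The change of variables gives the factor c^{-d}, even after the factor
  -- c from differentiating ρ*(c·).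
  have hbound : ∀ c : ℝ, 1 ≤ c → |∫ y, ρhat y * fderiv ℝ ζ y e| ≤ (c ^ d)⁻¹ * (I + J) := by
    intro c hc
    have hc0 : 0 < c := by linarith
    have hD : ∀ y, HasFDerivAt (fun y => ρs (c • y)) (c • fderiv ℝ ρs (c • y)) y := fun y => by
      have e1 : HasFDerivAt (fun y : Space d => c • y) (c • ContinuousLinearMap.id ℝ (Space d)) y :=
        (hasFDerivAt_id y).const_smul c
      have e2 := HasFDerivAt.comp (g := ρs) y
        ((hρ.differentiable one_ne_zero) (c • y)).hasFDerivAt e1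
      refine e2.congr_fderiv ?_
      ext v
      simp
    have hcont : Continuous fun y => ρs (c • y) := hρ.continuous.comp (continuous_const_smul c)
    have hcontD : Continuous fun y => fderiv ℝ (fun y => ρs (c • y)) y e := by
      have e1 : (fun y => fderiv ℝ (fun y => ρs (c • y)) y e)
          = fun y => c * fderiv ℝ ρs (c • y) e := funext fun y => by rw [(hD y).fderiv]; rfl
      rw [e1]
      exact continuous_const.mul (((hρ.continuous_fderiv one_ne_zero).comp
        (continuous_const_smul c)).clm_apply continuous_const)
    have hi2 : Integrable fun y => ρs (c • y) * fderiv ℝ ζ y e :=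
      (hcont.mul hζd).integrable_of_hasCompactSupport hζdc.mul_left
    have hparts := integral_mul_fderiv_eq_neg_fderiv_mul_of_integrable (μ := volume)
      (f := fun y => ρs (c • y)) (g := ζ) (v := e)
      ((hcontD.mul hζ.continuous).integrable_of_hasCompactSupport hζc.mul_left) hi2
      ((hcont.mul hζ.continuous).integrable_of_hasCompactSupport hζc.mul_left)
      (fun y _ => (hD y).differentiableAt) (fun y _ => (hζ.differentiable one_ne_zero) y)
    have b1 : |∫ y, fderiv ℝ (fun y => ρs (c • y)) y e * ζ y| ≤ (c ^ d)⁻¹ * I := by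
      have := abs_integral_le_of_dilation (C := C₁ * ‖e‖) hc0 h1
        (F := fun y => fderiv ℝ (fun y => ρs (c • y)) y e * ζ y) (Eventually.of_forall fun y => by
          rw [(hD y).fderiv, abs_mul, smul_apply, smul_eq_mul, abs_mul, abs_of_pos hc0, norm_smul,
            Real.norm_eq_abs, abs_of_pos hc0]
          calc c * |fderiv ℝ ρs (c • y) e| * |ζ y|
              ≤ c * (‖fderiv ℝ ρs (c • y)‖ * ‖e‖) * (C₁ * ‖y‖) := by
                gcongr
                · exact (fderiv ℝ ρs (c • y)).le_opNorm e
                · exact hC₁' y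
            _ = _ := by ring)
      refine this.trans_eq ?_
      rw [hI]
      ring
    have b2 : |∫ y, (ρs (c • y) - ρhat y) * fderiv ℝ ζ y e| ≤ (c ^ d)⁻¹ * J := by
      have := abs_integral_le_of_dilation (C := C₂) hc0 h2
        (F := fun y => (ρs (c • y) - ρhat y) * fderiv ℝ ζ y e) (by
          filter_upwards [ae_ne_zero hd] with y hy
          rw [hang.homogeneous c hc0 y hy, abs_mul, norm_smul, Real.norm_eq_abs, abs_of_pos hc0]
          calc |ρs (c • y) - ρhat y| * |fderiv ℝ ζ y e|
              ≤ |ρs (c • y) - ρhat y| * (C₂ * ‖y‖) := by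
                gcongr
                exact hC₂' y
            _ = C₂ * (1 * ‖y‖ * |ρs (c • y) - ρhat y|) := by ring
            _ ≤ C₂ * (c * ‖y‖ * |ρs (c • y) - ρhat y|) := by gcongr)
      refine this.trans_eq ?_
      rw [hJ]
      ring
    have hsplit : ∫ y, (ρs (c • y) - ρhat y) * fderiv ℝ ζ y e
        = (∫ y, ρs (c • y) * fderiv ℝ ζ y e) - ∫ y, ρhat y * fderiv ℝ ζ y e := by
      rw [← integral_sub hi2 hi1]
      exact integral_congr_ae (Eventually.of_forall fun y => sub_mul _ _ _)
    rw [hsplit, hparts] at b2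
    have e1 := abs_le.1 b1
    have e2 := abs_le.1 b2
    rw [abs_le]
    constructor <;> linarith [e1.1, e1.2, e2.1, e2.2]
  have hlim : Tendsto (fun c : ℝ => (c ^ d)⁻¹ * (I + J)) atTop (𝓝 0) := by
    simpa using ((tendsto_pow_atTop (by omega : d ≠ 0)).inv_tendsto_atTop).mul_const (I + J)
  have h3 : |∫ y, ρhat y * fderiv ℝ ζ y e| ≤ 0 :=
    ge_of_tendsto hlim ((eventually_ge_atTop 1).mono hbound)
  exact abs_nonpos_iff.1 h3

/-- The continuous gradient of ρ̂ vanishes on ℝ^d∖{0}, because it vanishes weakly there. For d ≥ 2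
this set is connected, so ρ̂ is constant on it. -/
lemma IsAngular.eq_of_two_le {ρhat ρs : Space d → ℝ} (hd : 2 ≤ d)
    (hang : IsAngular ρhat) (hρ : ContDiff ℝ 1 ρs)
    (h1 : Integrable fun y => ‖y‖ * ‖fderiv ℝ ρs y‖)
    (h2 : Integrable fun y => ‖y‖ * |ρs y - ρhat y|) {x y : Space d} (hx : x ≠ 0) (hy : y ≠ 0) :
    ρhat x = ρhat y := by
  have hdiff : DifferentiableOn ℝ ρhat {0}ᶜ := hang.contDiffOn.differentiableOn one_ne_zero
  have hcontD := hang.contDiffOn.continuousOn_fderiv_of_isOpen isOpen_compl_singleton le_rfl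
  have hzero : ({0}ᶜ : Set (Space d)).EqOn (fderiv ℝ ρhat) 0 := by
    intro z hz
    ext e
    have hce : ContinuousOn (fun y => fderiv ℝ ρhat y e) {0}ᶜ :=
      hcontD.clm_apply continuousOn_const
    have hae : ∀ᵐ y, y ∈ ({0}ᶜ : Set (Space d)) → fderiv ℝ ρhat y e = 0 := by
      refine isOpen_compl_singleton.ae_eq_zero_of_integral_contDiff_smul_eq_zero
        (hce.locallyIntegrableOn (measurableSet_singleton _).compl) fun ζ hζ hζc hζ0 => ?_
      have hζ1 : ContDiff ℝ 1 ζ := hζ.of_le (by simp)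
      have hζd : Continuous fun y => fderiv ℝ ζ y e :=
        (hζ1.continuous_fderiv one_ne_zero).clm_apply continuous_const
      have hζdc : HasCompactSupport fun y => fderiv ℝ ζ y e := hζc.fderiv_apply (𝕜 := ℝ) e
      have hparts := integral_mul_fderiv_eq_neg_fderiv_mul_of_integrable (μ := volume)
        (f := ρhat) (g := ζ) (v := e)
        ((continuous_mul_of_tsupport isOpen_compl_singleton hce hζ.continuous
          hζ0).integrable_of_hasCompactSupport hζc.mul_left)
        ((continuous_mul_of_tsupport isOpen_compl_singleton hang.contDiffOn.continuousOn hζd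
          ((tsupport_fderiv_apply_subset ℝ e).trans hζ0)).integrable_of_hasCompactSupport
            hζdc.mul_left)
        ((continuous_mul_of_tsupport isOpen_compl_singleton hang.contDiffOn.continuousOn
          hζ.continuous hζ0).integrable_of_hasCompactSupport hζc.mul_left)
        (fun y hy => (hdiff y (hζ0 hy)).differentiableAt
          (isOpen_compl_singleton.mem_nhds (hζ0 hy)))
        (fun y _ => (hζ1.differentiable one_ne_zero) y)
      rw [hang.integral_mul_fderiv_eq_zero (by omega) hρ h1 h2 hζ1 hζc hζ0 e] at hparts
      simp only [smul_eq_mul, mul_comm (ζ _)]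
      linarith
    have hEq := Measure.eqOn_open_of_ae_eq (μ := volume) (g := fun _ => (0 : ℝ))
      ((ae_restrict_iff' (measurableSet_singleton (0 : Space d)).compl).2 hae)
      isOpen_compl_singleton hce continuousOn_const
    simpa using hEq hz
  refine isOpen_compl_singleton.is_const_of_fderiv_eq_zero (𝕜 := ℝ)
    (isConnected_compl_singleton_of_one_lt_rank ?_ (0 : Space d)).isPreconnected hdiff hzero hx hy
  rw [← Module.finrank_eq_rank, finrank_euclideanSpace_fin]
  exact_mod_cast hd

end Angular

namespace IsGammaProfile

variable {d : ℕ} {α k γ m M : ℝ} {p h : ℝ → ℝ} {ρhat ρs : Space d → ℝ}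
  {ns : Space d → Space d}

/-- When ρ̂ is constant, the convex hull of its values is a single point, which forces ρ* to be
constant as well: admissible profiles with nonzero velocity exist at most for d = 1. -/
lemma velocity_eq_zero_of_two_le (hP : IsGammaProfile α k γ p h ρhat ρs ns m M) (hd : 2 ≤ d)
    (y : Space d) : profileVelocity ρs ns y = 0 := by
  have : Nonempty (Fin d) := ⟨⟨0, by omega⟩⟩
  obtain ⟨x₀, hx₀⟩ := exists_ne (0 : Space d)
  have h1 := memLp_one_iff_integrable.1 (hP.admissible.gradient 1 (Or.inl rfl))
  have h2 := (memLp_one_iff_integrable.1 (hP.admissible.difference 1 (Or.inl rfl))).norm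
  simp only [norm_gradient, norm_mul, Real.norm_eq_abs, abs_norm] at h1 h2
  have hconst : ∀ x, ρs x = ρhat x₀ := fun x => by
    have h3 : convexHull ℝ (ρhat '' {0}ᶜ) ⊆ {ρhat x₀} := by
      refine convexHull_min ?_ (convex_singleton _)
      rintro _ ⟨z, hz, rfl⟩
      exact hP.angular.eq_of_two_le hd (hP.admissible.contDiff.of_le (by simp)) h1 h2 hz hx₀
    exact h3 (hP.admissible.range_subset (mem_range_self x))
  rw [hP.velocity_eq, show (fun y => potDeriv h (ρs y)) = fun _ => potDeriv h (ρhat x₀) from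
    funext fun y => by rw [hconst y]]
  simp [gradient]

/-- The constants of the similarity profile are finite. -/
theorem finite (hP : IsGammaProfile α k γ p h ρhat ρs ns m M) :
    profileMu k γ ρs ns ≠ ⊤ ∧ profileK ρs ns ≠ ⊤ := by
  -- The dimensions differ in mechanism: for d = 1 the residual decays rapidly, for d ≥ 2 it
  -- vanishes identically.
  rcases hP.dim_pos.eq_or_lt with rfl | hd
  · exact hP.finite_of_one
  · have h0 := hP.residual_eq_zero_of_velocity (hP.velocity_eq_zero_of_two_le hd)
    exact ⟨hP.profileMu_ne_top (C := 0) fun y => by rw [h0, norm_zero],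
      profileK_ne_top (f := fun _ => 0) (integrable_zero _ _ _) fun y => by rw [h0, norm_zero]⟩

end IsGammaProfile

end

theorem mainTheorem3 {d : ℕ} (hd : 1 ≤ d) (α : ℝ) (p h : ℝ → ℝ) (hh : IsPotential p h)
    (ρhat : Space d → ℝ) (ρ₀ : Space d → ℝ) (n₀ : Space d → Space d)
    (ρ : ℝ → Space d → ℝ) (n : ℝ → Space d → Space d) (E : ℝ → ℝ)
    (ρinf : ℝ → Space d → ℝ) (K : (Space d → Space d) → ℝ≥0)
    (hsol : IsEnergyVariationalSolution α p h ρhat ρ₀ n₀ ρ n E ρinf K)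
    (ρs : Space d → ℝ) (ns : Space d → Space d) :
    -- case (a): constant limit density, general pressure
    (0 ≤ α → IsPressure p →
      (∃ c : ℝ, 0 ≤ c ∧ (∀ y, ρhat y = c) ∧ (∀ y, ρs y = c) ∧ (∀ y, ns y = 0) ∧
        (c = 0 → IsVacuumPressure p)) →
      ConvergesToProfile h ρ₀ n₀ ρ n E ρinf ρs ns 0 0 0) ∧
    -- case (b): angular limit density, `γ`-law pressure, the weight given by the `γ`-law
    (0 < α → ∀ k γ : ℝ, IsGammaLaw k γ p → IsAngular ρhat →
      IsSimilarityProfile α p ρs ns → IsAdmissibleProfile ρhat ρs →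
      (∀ ψ, IsSpatialTest ψ → (K ψ : ℝ≥0∞) = gammaWeight γ ψ) →
      profileTheta α γ h ρs ≠ ⊤ ∧ profileMu k γ ρs ns ≠ ⊤ ∧ profileK ρs ns ≠ ⊤ ∧
      ConvergesToProfile h ρ₀ n₀ ρ n E ρinf ρs ns (profileTheta α γ h ρs).toReal
        (profileMu k γ ρs ns).toReal
        ((profileK ρs ns).toReal / (profileTheta α γ h ρs).toReal)) := by
  refine ⟨fun hα hp ⟨c, _, hhat, hs, hns, _⟩ => ?_, fun hα k γ hg hang hsim hadm hK => ?_⟩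
  · have hc := hsol.reference.hasPotDeriv_of_const hd hhat
    have h1 := (isRelativeProfile_const hα hc hsol.weight hhat hs hns).convergesToProfile
      hd hsol hp hh fun _ => by simp
    simpa using h1
  · obtain ⟨m, M, hP⟩ := exists_isGammaProfile hd hα hg hh hang hsim hadm
    obtain ⟨hμ, hfin⟩ := hP.finite
    refine ⟨hP.profileTheta_ne_top, hμ, hfin, ?_⟩
    have h1 := (hP.isRelativeProfile hK hμ hfin).convergesToProfile hd hsol hg.isPressure hh
      fun hθ => by simp [hP.residual_eq_zero_of_theta hθ]
    rwa [integral_norm_eq_lintegral_enorm hP.continuous_residual.aestronglyMeasurable] at h1
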